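/- All matrices are real, $'$ denotes transposition, and $h>0$ is a sampling period. Consider the following two stationary Gauss–Markov models. (a) The continuous-time model $(F,G,H)$: $dx(t)=Fx(t)\,dt+G\,dw(t)$, $\zeta(t)=Hx(t)$, $t\ge 0$, with $F\in\mathbb R^{n\times n}$, $G\in\mathbb R^{n\times m}$, $H\in\mathbb R^{p\times n}$, where $w$ is a standard $m$-dimensional Wiener process, $x(0)$ is independent of $w$, and $x$ is a stationary Gaussian process with continuous paths. (b) The discrete-time model $(A,B,C)$: $x_{k+1}=Ax_k+Bv_k$, $\zeta_k=Cx_k$, $k=0,1,2,\dots$, where $v_k$ are independent standard normal random vectors (normalized white noise), $x_0$ is independent of $(v_k)_{k\ge0}$, and $(x_k)$ is a stationary Gaussian process. **Theorem.** (1) Suppose that all eigenvalues of $F$ lie in the open left half-plane and that $(F,G)$ is controllable. Put $$A=e^{Fh},\qquad C=H,\qquad Q=\int_0^h e^{F\tau}GG'e^{F'\tau}\,d\tau .$$ Then all eigenvalues of $A$ lie in the open unit disc, and $Q$ is positive definite, so $B=Q^{1/2}$ is a possible choice of a square matrix $B$ with $BB'=Q$. For every square $B$ with $BB'=Q$ and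 every continuous-time model $(x,w,\zeta)$ with parameters $(F,G,H)$ there is a normalized Gaussian white noise $v_k$, on the same probability space, such that $x_k=x(kh)$ and $\zeta_k=\zeta(kh)$ form, with $v_k$, a discrete-time model with parameters $(A,B,C)$, and $$Bv_k=\int_{kh}^{(k+1)h}e^{F((k+1)h-\tau)}G\,dw(\tau)\qquad\text{for all }k\ge 0 .$$ If $B$ has any number of columns and $BB'=Q$, then the state and output $(x_k,\zeta_k)_{k\ge0}$ of every discrete-time model with parameters $(A,B,C)$ have the same joint law as $(x(kh),\zeta(kh))_{k\ge0}$. (2) Conversely, let $A\in\mathbb R^{n\times n}$, $B\in\mathbb R^{n\times r}$, $C\in\mathbb R^{p\times n}$, with all eigenvalues of $A$ in the open unit disc, and suppose that i) $A$ admits a principal logarithm $\log(A)$ (the real matrix $L$ with $e^{L}=A$ and all eigenvalues in $\{|\mathrm{Im}\,z|<\pi\}$), ii) $\det(BB')\ne0$, iii) $\log(A)P+P\log(A)'\le 0$ (negative semidefinite), where $P$ is the solution of $P=APA'+BB'$. Let $F=\frac1h\log(A)$ and $H=C$. Then there is a matrix $G$ of full column rank with $GG'=-(FP+PF')$. For every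 such $G$, all eigenvalues of $F$ lie in the open left half-plane, $(F,G)$ is controllable, $A=e^{Fh}$ and $BB'=\int_0^h e^{F\tau}GG'e^{F'\tau}d\tau$. Moreover, the discrete-time model $(A,B,C)$ arises by sampling the continuous-time model $(F,G,H)$: a continuous-time model $(x,w,\zeta)$ with parameters $(F,G,H)$ exists, and for every such model the sampled process $(x(kh),\zeta(kh))_{k\ge0}$ has the same joint law as the state and output $(x_k,\zeta_k)_{k\ge 0}$ of every discrete-time model with parameters $(A,B,C)$. -/

import Mathlib

open MeasureTheory ProbabilityTheory Filter Topology
open scoped NNReal ENNReal Matrix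

namespace SampledModel

/-! ### Matrices -/

/-- `F` is stable in continuous time: every (complex) eigenvalue of the real matrix `F` lies in the
open left half-plane. -/
def IsHurwitz {n : ℕ} (F : Matrix (Fin n) (Fin n) ℝ) : Prop :=
  ∀ μ ∈ spectrum ℂ (F.map (algebraMap ℝ ℂ)), μ.re < 0

/-- `A` is stable in discrete time: every (complex) eigenvalue of the real matrix `A` lies in the
open unit disc. -/
def IsSchur {n : ℕ} (A : Matrix (Fin n) (Fin n) ℝ) : Prop :=
  ∀ μ ∈ spectrum ℂ (A.map (algebraMap ℝ ℂ)), ‖μ‖ < 1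

/-- The reachability matrix `[G, FG, …, F ^ (n - 1) G]`. -/
def reachabilityMatrix {n m : ℕ} (F : Matrix (Fin n) (Fin n) ℝ) (G : Matrix (Fin n) (Fin m) ℝ) :
    Matrix (Fin n) (Fin n × Fin m) ℝ :=
  Matrix.of fun i q => (F ^ (q.1 : ℕ) * G) i q.2

/-- The pair `(F, G)` is controllable. -/
def IsControllable {n m : ℕ} (F : Matrix (Fin n) (Fin n) ℝ) (G : Matrix (Fin n) (Fin m) ℝ) : Prop :=
  (reachabilityMatrix F G).rank = n

/-- `L` is the principal logarithm of `A`: the real matrix `L` satisfies `exp L = A` and all its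
eigenvalues lie in the open strip `-π < Im z < π`. -/
def IsPrincipalLog {n : ℕ} (L A : Matrix (Fin n) (Fin n) ℝ) : Prop :=
  NormedSpace.exp L = A ∧ ∀ μ ∈ spectrum ℂ (L.map (algebraMap ℝ ℂ)), |μ.im| < Real.pi

/-- The matrix `∫₀ʰ exp(F τ) G Gᵀ exp(Fᵀ τ) dτ`, integrated entry by entry. -/
noncomputable def gramian {n m : ℕ} (F : Matrix (Fin n) (Fin n) ℝ) (G : Matrix (Fin n) (Fin m) ℝ)
    (h : ℝ) : Matrix (Fin n) (Fin n) ℝ :=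
  Matrix.of fun i j =>
    ∫ τ in (0 : ℝ)..h, (NormedSpace.exp (τ • F) * G * Gᵀ * NormedSpace.exp (τ • Fᵀ)) i j

/-! ### Stochastic processes -/

/-- (Strict) stationarity: the law of the process is invariant under time shifts. -/
def IsStationary {Ω T E : Type*} [MeasurableSpace Ω] [Add T] [MeasurableSpace E]
    (X : T → Ω → E) (P : Measure Ω) : Prop :=
  ∀ s : T, IdentDistrib (fun ω t => X (t + s) ω) (fun ω t => X t ω) P P

/-- `w` is a standard `m`-dimensional Wiener process: its components are independent standard
real Brownian motions. -/
structure IsWiener {Ω : Type*} [MeasurableSpace Ω] {m : ℕ} (w : ℝ≥0 → Ω → (Fin m → ℝ))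
    (P : Measure Ω) : Prop where
  measurable : ∀ t, Measurable (w t)
  brownian : ∀ i, IsBrownianReal (fun t ω => w t ω i) P
  indep : iIndepFun (fun (i : Fin m) ω (t : ℝ≥0) => w t ω i) P

/-- `v` is Gaussian normalized white noise: an independent sequence of `r`-vectors, each with the
standard normal law (zero mean, unit variance). -/
structure IsWhiteNoise {Ω : Type*} [MeasurableSpace Ω] {r : ℕ} (v : ℕ → Ω → (Fin r → ℝ))
    (P : Measure Ω) : Prop where
  measurable : ∀ k, Measurable (v k)
  hasLaw : ∀ k, HasLaw (v k) (Measure.pi fun _ : Fin r => gaussianReal 0 1) P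
  indep : iIndepFun v P

/-- `I = ∫ₐᵇ f(τ) dw(τ)` for a (continuous, deterministic) matrix-valued integrand `f`: the
mean-square limit of the sums `∑ f(tᵢ) (w(tᵢ₊₁) - w(tᵢ))` as the mesh of the partition
`a = t₀ ≤ t₁ ≤ … ≤ t_N = b` tends to `0`. -/
def IsWienerIntegral {Ω : Type*} [MeasurableSpace Ω] {n m : ℕ}
    (f : ℝ≥0 → Matrix (Fin n) (Fin m) ℝ) (w : ℝ≥0 → Ω → (Fin m → ℝ)) (a b : ℝ≥0)
    (I : Ω → (Fin n → ℝ)) (P : Measure Ω) : Prop :=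
  MemLp I 2 P ∧
  ∀ ε : ℝ, 0 < ε → ∃ δ : ℝ, 0 < δ ∧ ∀ (N : ℕ) (t : ℕ → ℝ≥0), Monotone t → t 0 = a → t N = b →
    (∀ i < N, (t (i + 1) : ℝ) - (t i : ℝ) < δ) →
    eLpNorm (fun ω => I ω - ∑ i ∈ Finset.range N, f (t i) *ᵥ (w (t (i + 1)) ω - w (t i) ω)) 2 P
      ≤ ENNReal.ofReal ε

/-- The processes `x`, `w`, `ζ` form a stationary Gauss–Markov continuous-time model
`dx = F x dt + G dw`, `ζ = H x` on `[0, ∞)`: `w` is a standard Wiener process, the initial state is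
independent of `w`, the state `x` is a stationary Gaussian process with continuous paths, and the
stochastic differential equation holds in its integrated form. (The noise is additive, so that
`∫₀ᵗ G dw = G w(t)`.) -/
structure IsContinuousModel {Ω : Type*} [MeasurableSpace Ω] {n m p : ℕ}
    (F : Matrix (Fin n) (Fin n) ℝ) (G : Matrix (Fin n) (Fin m) ℝ) (H : Matrix (Fin p) (Fin n) ℝ)
    (x : ℝ≥0 → Ω → (Fin n → ℝ)) (w : ℝ≥0 → Ω → (Fin m → ℝ)) (ζ : ℝ≥0 → Ω → (Fin p → ℝ))
    (P : Measure Ω) : Prop where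
  wiener : IsWiener w P
  measurable_state : ∀ t, Measurable (x t)
  measurable_output : ∀ t, Measurable (ζ t)
  indep_init : IndepFun (x 0) (fun ω t => w t ω) P
  gaussian : IsGaussianProcess x P
  stationary : IsStationary x P
  continuous_paths : ∀ᵐ ω ∂P, Continuous fun t => x t ω
  state_eq : ∀ᵐ ω ∂P, ∀ t : ℝ≥0,
    x t ω = x 0 ω + (∫ s in (0 : ℝ)..(t : ℝ), F *ᵥ x s.toNNReal ω) + G *ᵥ w t ω
  output_eq : ∀ᵐ ω ∂P, ∀ t, ζ t ω = H *ᵥ x t ω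

/-- The sequences `x`, `v`, `ζ` form a stationary Gauss–Markov discrete-time model
`x (k + 1) = A x k + B v k`, `ζ k = C x k` for `k = 0, 1, 2, …`: `v` is normalized white noise, the
initial state is independent of `v`, and the state `x` is a stationary Gaussian process. -/
structure IsDiscreteModel {Ω : Type*} [MeasurableSpace Ω] {n r p : ℕ}
    (A : Matrix (Fin n) (Fin n) ℝ) (B : Matrix (Fin n) (Fin r) ℝ) (C : Matrix (Fin p) (Fin n) ℝ)
    (x : ℕ → Ω → (Fin n → ℝ)) (v : ℕ → Ω → (Fin r → ℝ)) (ζ : ℕ → Ω → (Fin p → ℝ))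
    (P : Measure Ω) : Prop where
  noise : IsWhiteNoise v P
  measurable_state : ∀ k, Measurable (x k)
  measurable_output : ∀ k, Measurable (ζ k)
  indep_init : IndepFun (x 0) (fun ω k => v k ω) P
  gaussian : IsGaussianProcess x P
  stationary : IsStationary x P
  state_eq : ∀ᵐ ω ∂P, ∀ k, x (k + 1) ω = A *ᵥ x k ω + B *ᵥ v k ω
  output_eq : ∀ᵐ ω ∂P, ∀ k, ζ k ω = C *ᵥ x k ω

/-- The process `X` sampled with period `h`: `X_k = X (k h)`. -/
def sampled {Ω E : Type*} (h : ℝ≥0) (X : ℝ≥0 → Ω → E) : ℕ → Ω → E :=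
  fun k => X (k * h)

end SampledModel

/-! Everything rests on variation of constants: x(b) = exp((b-a)F) x(a) plus the integral of
exp((b-τ)F) G dw(τ) over [a,b]. Since the integrand is continuously differentiable, that integral is
defined path by path through integration by parts, and `eq_add_stochasticConvolution` is then
ordinary calculus. Means and covariances of the integral come from mean-square limits of sums over
partitions; its covariance over a step of length h is the Gramian, and integrals over disjoint
intervals are uncorrelated.

Sampling. With A = exp(hF), the prediction errors e_k = x((k+1)h) - A x(kh) are jointly Gaussian
with x(0), uncorrelated with it and with one another, and have covariance BB'. Controllability makes
the Gramian positive definite, so a square B is invertible and v_k = B⁻¹e_k is white noise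
(`exists_isDiscreteModel`). For B of arbitrary width, laws are compared instead: a stable discrete
model has mean zero and lag-l covariance A^l S, where S is the only solution of the Stein equation S
= ASA' + BB'. Hence its law depends only on A, BB' and C (`IsDiscreteModel.identDistrib`).

Converse. The derivative of exp(tF) S exp(tF)' is exp(tF)(FS + SF')exp(tF)'. If GG' = -(FS + SF'),
integration gives Gramian = S - ASA' (`gramian_eq_sub`), which is BB' by the Stein equation.
Spectral mapping makes F stable, and a positive definite Gramian forces controllability.

Existence. A Wiener process is built by the Lévy–Ciesielski series (`exists_brownian`). Variation of
constants is then started from an independent normal vector with covariance S. The same Gramian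
identity keeps the covariance equal to S, so the lag covariances do not depend on time, and a
Gaussian process with this property is stationary. -/

namespace SampledModel

/-! ### Spectral mapping for the exponential, and powers of stable matrices. -/

section Spectrum

open scoped Matrix.Norms.Operator

variable {n : ℕ}

lemma exp_mulVec_of_mulVec_eq {M : Matrix (Fin n) (Fin n) ℂ} {v : Fin n → ℂ} {l : ℂ}
    (h : M *ᵥ v = l • v) : NormedSpace.exp M *ᵥ v = Complex.exp l • v := by
  have hpow : ∀ k : ℕ, M ^ k *ᵥ v = l ^ k • v := by
    intro k
    induction k with
    | zero => simp
    | succ k ih => rw [pow_succ, ← Matrix.mulVec_mulVec, h, Matrix.mulVec_smul, ih, smul_smul,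
        pow_succ, mul_comm]
  have h1 := NormedSpace.exp_series_hasSum_exp' (𝕂 := ℂ) M
  have h2 := NormedSpace.exp_series_hasSum_exp' (𝕂 := ℂ) l
  have hc : Continuous fun N : Matrix (Fin n) (Fin n) ℂ => N *ᵥ v := by fun_prop
  have h3 := h1.map (Matrix.mulVec.addMonoidHomLeft v) hc
  have h4 := h2.smul_const v
  rw [← Complex.exp_eq_exp_ℂ] at h4
  refine h3.unique (h4.congr_fun fun k => ?_)
  simp [Matrix.mulVec.addMonoidHomLeft, Matrix.smul_mulVec, hpow, smul_smul]

lemma mem_spectrum_iff_exists_mulVec {M : Matrix (Fin n) (Fin n) ℂ} {l : ℂ} :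
    l ∈ spectrum ℂ M ↔ ∃ v ≠ 0, M *ᵥ v = l • v := by
  rw [← Matrix.spectrum_toLin', ← Module.End.hasEigenvalue_iff_mem_spectrum]
  constructor
  · intro h
    obtain ⟨v, hv⟩ := h.exists_hasEigenvector
    exact ⟨v, hv.2, by simpa using hv.apply_eq_smul⟩
  · rintro ⟨v, hv, h⟩
    exact Module.End.hasEigenvalue_of_hasEigenvector (x := v)
      ⟨Module.End.mem_eigenspace_iff.2 (by simpa using h), hv⟩

/-- `M` commutes with its exponential, so it maps the μ-eigenspace of the exponential to itself.
Over ℂ it has an eigenvector there, and on that vector the exponential acts by both μ and exp l. -/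
lemma exists_mem_spectrum_of_mem_spectrum_exp {M : Matrix (Fin n) (Fin n) ℂ} {μ : ℂ}
    (h : μ ∈ spectrum ℂ (NormedSpace.exp M)) : ∃ l ∈ spectrum ℂ M, μ = Complex.exp l := by
  rw [← Matrix.spectrum_toLin', ← Module.End.hasEigenvalue_iff_mem_spectrum] at h
  have hcomm : Commute (Matrix.toLin' (NormedSpace.exp M)) (Matrix.toLin' M) := by
    have : Commute (NormedSpace.exp M) M := (Commute.refl M).exp_left
    exact this.map (Matrix.toLinAlgEquiv' (R := ℂ) (n := Fin n))
  have hmaps := Module.End.mapsTo_genEigenspace_of_comm hcomm μ 1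
  have : Nontrivial (Module.End.genEigenspace (Matrix.toLin' (NormedSpace.exp M)) μ 1) :=
    Submodule.nontrivial_iff_ne_bot.2 h
  obtain ⟨l, hl⟩ := Module.End.exists_eigenvalue ((Matrix.toLin' M).restrict hmaps)
  obtain ⟨⟨v, hvE⟩, hv⟩ := hl.exists_hasEigenvector
  have hv0 : v ≠ 0 := fun h0 => hv.2 (by ext1; exact h0)
  have hvl : M *ᵥ v = l • v :=
    congrArg Subtype.val hv.apply_eq_smul
  refine ⟨l, mem_spectrum_iff_exists_mulVec.2 ⟨v, hv0, hvl⟩, ?_⟩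
  have h1 := exp_mulVec_of_mulVec_eq hvl
  have h2 : NormedSpace.exp M *ᵥ v = μ • v := by
    simpa using Module.End.mem_eigenspace_iff.1 hvE
  exact smul_left_injective ℂ hv0 (h2.symm.trans h1)

lemma exp_mem_spectrum_exp {M : Matrix (Fin n) (Fin n) ℂ} {l : ℂ}
    (h : l ∈ spectrum ℂ M) : Complex.exp l ∈ spectrum ℂ (NormedSpace.exp M) := by
  obtain ⟨v, hv, h⟩ := mem_spectrum_iff_exists_mulVec.1 h
  exact mem_spectrum_iff_exists_mulVec.2 ⟨v, hv, exp_mulVec_of_mulVec_eq h⟩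

lemma map_exp_algebraMap (F : Matrix (Fin n) (Fin n) ℝ) :
    (NormedSpace.exp F).map (algebraMap ℝ ℂ) = NormedSpace.exp (F.map (algebraMap ℝ ℂ)) :=
  NormedSpace.map_exp (RingHom.mapMatrix (algebraMap ℝ ℂ))
    (continuous_id.matrix_map (by exact Complex.continuous_ofReal)) F

lemma mem_spectrum_smul_iff {M : Matrix (Fin n) (Fin n) ℂ} {l : ℂ} {h : ℝ} (hh : h ≠ 0) :
    (h : ℂ) * l ∈ spectrum ℂ ((h : ℂ) • M) ↔ l ∈ spectrum ℂ M := by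
  have hc : (h : ℂ) ≠ 0 := by exact_mod_cast hh
  simp_rw [mem_spectrum_iff_exists_mulVec, Matrix.smul_mulVec, mul_smul]
  simp only [smul_right_inj hc]

lemma map_smul_algebraMap (F : Matrix (Fin n) (Fin n) ℝ) (h : ℝ) :
    (h • F).map (algebraMap ℝ ℂ) = (h : ℂ) • F.map (algebraMap ℝ ℂ) := by
  ext i j; simp

lemma IsHurwitz.isSchur_exp {F : Matrix (Fin n) (Fin n) ℝ} (hF : IsHurwitz F) {h : ℝ}
    (hh : 0 < h) : IsSchur (NormedSpace.exp (h • F)) := by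
  intro μ hμ
  rw [map_exp_algebraMap, map_smul_algebraMap] at hμ
  obtain ⟨l, hl, rfl⟩ := exists_mem_spectrum_of_mem_spectrum_exp hμ
  have hc : (h : ℂ) ≠ 0 := by exact_mod_cast hh.ne'
  have hl' : (h : ℂ) * (l / h) ∈ spectrum ℂ ((h : ℂ) • F.map (algebraMap ℝ ℂ)) := by
    rwa [mul_div_cancel₀ _ hc]
  have := hF _ ((mem_spectrum_smul_iff hh.ne').1 hl')
  rw [Complex.div_ofReal_re] at this
  rw [Complex.norm_exp, Real.exp_lt_one_iff]
  by_contra hcon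
  exact absurd this (not_lt.2 (div_nonneg (not_lt.1 hcon) hh.le))

lemma IsHurwitz.of_isSchur_exp {F : Matrix (Fin n) (Fin n) ℝ} {h : ℝ}
    (hh : 0 < h) (hA : IsSchur (NormedSpace.exp (h • F))) : IsHurwitz F := by
  intro l hl
  have h1 := exp_mem_spectrum_exp ((mem_spectrum_smul_iff hh.ne').2 hl)
  rw [← map_smul_algebraMap, ← map_exp_algebraMap] at h1
  have := hA _ h1
  rw [Complex.norm_exp, Real.exp_lt_one_iff] at this
  have h2 : h * l.re < 0 := by simpa using this
  exact (pos_iff_neg_of_mul_neg h2).1 hh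

/-- Gelfand's formula: once the spectral radius is below some r < 1, the norms of the powers are
eventually at most r^k. This is done over ℂ and carried back entry by entry through real parts. -/
lemma IsSchur.tendsto_pow {A : Matrix (Fin n) (Fin n) ℝ} (hA : IsSchur A) :
    Tendsto (fun k : ℕ => A ^ k) atTop (𝓝 0) := by
  have key : Tendsto (fun k : ℕ => (A.map (algebraMap ℝ ℂ)) ^ k) atTop (𝓝 0) := by
    set a := A.map (algebraMap ℝ ℂ) with ha
    cases isEmpty_or_nonempty (Fin n) with
    | inl h => exact tendsto_const_nhds.congr fun k => Subsingleton.elim _ _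
    | inr h =>
    have hr : spectralRadius ℂ a < ((1 : ℝ≥0) : ℝ≥0∞) :=
      spectrum.spectralRadius_lt_of_forall_lt a fun k hk => by
        have := hA k hk
        exact_mod_cast this
    obtain ⟨r, hr1, hr2⟩ := ENNReal.lt_iff_exists_nnreal_btwn.1 hr
    have hlim := spectrum.pow_nnnorm_pow_one_div_tendsto_nhds_spectralRadius a
    have hev := hlim.eventually_lt_const hr1
    have hr2' : r < 1 := by exact_mod_cast hr2
    refine squeeze_zero_norm' (a := fun k => (r : ℝ) ^ k) ?_
      (tendsto_pow_atTop_nhds_zero_of_lt_one r.2 hr2')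
    filter_upwards [hev, eventually_gt_atTop 0] with k hk hk0
    have hk' : (0 : ℝ) < k := by exact_mod_cast hk0
    have h3 : (‖a ^ k‖₊ : ℝ≥0∞) ≤ (r : ℝ≥0∞) ^ (k : ℝ) := by
      have := ENNReal.rpow_le_rpow hk.le hk'.le
      rwa [← ENNReal.rpow_mul, one_div, inv_mul_cancel₀ hk'.ne', ENNReal.rpow_one] at this
    rw [ENNReal.rpow_natCast] at h3
    exact_mod_cast h3
  refine tendsto_pi_nhds.2 fun i => tendsto_pi_nhds.2 fun j => ?_
  have h1 := ((tendsto_pi_nhds.1 ((tendsto_pi_nhds.1 key) i)) j)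
  have h2 : ∀ k : ℕ, ((A.map (algebraMap ℝ ℂ)) ^ k) i j = ((A ^ k) i j : ℂ) := by
    intro k
    have : (A.map (algebraMap ℝ ℂ)) ^ k = (A ^ k).map (algebraMap ℝ ℂ) :=
      (map_pow (RingHom.mapMatrix (algebraMap ℝ ℂ)) A k).symm
    rw [this]; rfl
  simp_rw [h2] at h1
  have h5 := (Complex.continuous_re.tendsto _).comp h1
  simpa [Function.comp_def] using h5

end Spectrum

/-! ### The Stein equation S = ASA' + Q for stable A. -/

section Stein

variable {n r : ℕ}

lemma eq_conj_pow {A D : Matrix (Fin n) (Fin n) ℝ} (h : D = A * D * Aᵀ) (k : ℕ) :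
    D = A ^ k * D * (A ^ k)ᵀ := by
  induction k with
  | zero => simp
  | succ k ih =>
    rw [pow_succ, Matrix.transpose_mul]
    calc D = A ^ k * D * (A ^ k)ᵀ := ih
      _ = A ^ k * (A * D * Aᵀ) * (A ^ k)ᵀ := by rw [← h]
      _ = _ := by simp only [Matrix.mul_assoc]

lemma IsSchur.tendsto_conj_pow {A : Matrix (Fin n) (Fin n) ℝ} (hA : IsSchur A)
    (D : Matrix (Fin n) (Fin n) ℝ) :
    Tendsto (fun k : ℕ => A ^ k * D * (A ^ k)ᵀ) atTop (𝓝 0) := by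
  have h1 := hA.tendsto_pow
  have hc : Continuous fun N : Matrix (Fin n) (Fin n) ℝ => N * D * Nᵀ := by fun_prop
  simpa [Function.comp_def] using (hc.tendsto 0).comp h1

lemma IsSchur.eq_zero_of_eq_conj {A D : Matrix (Fin n) (Fin n) ℝ} (hA : IsSchur A)
    (h : D = A * D * Aᵀ) : D = 0 :=
  tendsto_nhds_unique (tendsto_const_nhds.congr fun k => eq_conj_pow h k) (hA.tendsto_conj_pow D)

/-- The difference D of two solutions satisfies D = A^k D (A^k)' for every k, and the right side
tends to 0. -/
lemma IsSchur.stein_unique {A S T Q : Matrix (Fin n) (Fin n) ℝ} (hA : IsSchur A)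
    (hS : S = A * S * Aᵀ + Q) (hT : T = A * T * Aᵀ + Q) : S = T := by
  refine sub_eq_zero.1 (hA.eq_zero_of_eq_conj ?_)
  conv_lhs => rw [hS, hT]
  rw [Matrix.mul_sub, Matrix.sub_mul]; abel

lemma IsSchur.eq_zero_of_mulVec_eq {A : Matrix (Fin n) (Fin n) ℝ} (hA : IsSchur A)
    {m : Fin n → ℝ} (h : m = A *ᵥ m) : m = 0 := by
  have h1 : ∀ k : ℕ, m = A ^ k *ᵥ m := by
    intro k
    induction k with
    | zero => simp
    | succ k ih => rw [pow_succ, ← Matrix.mulVec_mulVec, ← h]; exact ih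
  have hc : Continuous fun N : Matrix (Fin n) (Fin n) ℝ => N *ᵥ m := by fun_prop
  have h2 := (hc.tendsto 0).comp hA.tendsto_pow
  simp only [Matrix.zero_mulVec] at h2
  exact tendsto_nhds_unique (tendsto_const_nhds.congr h1) h2

lemma IsSchur.transpose_stein {A S Q : Matrix (Fin n) (Fin n) ℝ} (hA : IsSchur A)
    (hQ : Qᵀ = Q) (hS : S = A * S * Aᵀ + Q) : Sᵀ = S := by
  refine hA.stein_unique (Q := Q) ?_ hS
  conv_lhs => rw [hS]
  simp [Matrix.transpose_mul, hQ, Matrix.mul_assoc]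

/-- S - A^k S (A^k)' is the partial sum of A^j BB' (A^j)' over j < k, hence positive semidefinite;
the subtracted term vanishes in the limit. -/
lemma IsSchur.posSemidef_stein {A S : Matrix (Fin n) (Fin n) ℝ} {B : Matrix (Fin n) (Fin r) ℝ}
    (hA : IsSchur A) (hS : S = A * S * Aᵀ + B * Bᵀ) : S.PosSemidef := by
  have hB : (B * Bᵀ).PosSemidef := by
    simpa [Matrix.conjTranspose_eq_transpose_of_trivial] using
      Matrix.posSemidef_self_mul_conjTranspose B
  have hsymm : Sᵀ = S := hA.transpose_stein (by simp) hS
  have hk : ∀ k : ℕ, (S - A ^ k * S * (A ^ k)ᵀ).PosSemidef := by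
    intro k
    induction k with
    | zero => simpa using Matrix.PosSemidef.zero
    | succ k ih =>
      have h1 : S - A ^ (k + 1) * S * (A ^ (k + 1))ᵀ
          = A * (S - A ^ k * S * (A ^ k)ᵀ) * Aᵀ + B * Bᵀ := by
        conv_lhs => enter [1]; rw [hS]
        rw [pow_succ', Matrix.transpose_mul, Matrix.mul_sub, Matrix.sub_mul]
        simp only [Matrix.mul_assoc]; abel
      rw [h1]
      refine Matrix.PosSemidef.add ?_ hB
      simpa [Matrix.conjTranspose_eq_transpose_of_trivial] using ih.mul_mul_conjTranspose_same A
  refine Matrix.PosSemidef.of_dotProduct_mulVec_nonneg ?_ fun z => ?_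
  · rw [Matrix.IsHermitian, Matrix.conjTranspose_eq_transpose_of_trivial, hsymm]
  have hc : Continuous fun N : Matrix (Fin n) (Fin n) ℝ => star z ⬝ᵥ ((S - N) *ᵥ z) := by
    fun_prop
  have h2 := (hc.tendsto 0).comp (hA.tendsto_conj_pow S)
  simp only [sub_zero] at h2
  exact ge_of_tendsto' h2 fun k => (hk k).dotProduct_mulVec_nonneg z

end Stein

/-! ### Factors of positive semidefinite matrices. -/

section FullRankFactor

/-- The columns of G are the eigenvectors with nonzero eigenvalue, each scaled by the square root of
the eigenvalue. Their number is the rank of M, and GG' has the same rank as G. -/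
lemma exists_fullRank_factor {n : ℕ} {M : Matrix (Fin n) (Fin n) ℝ} (hM : M.PosSemidef) :
    ∃ (m : ℕ) (G : Matrix (Fin n) (Fin m) ℝ), G.rank = m ∧ G * Gᵀ = M := by
  classical
  set l := hM.1.eigenvalues
  set U : Matrix (Fin n) (Fin n) ℝ := (hM.1.eigenvectorUnitary : Matrix (Fin n) (Fin n) ℝ)
  let κ := {i // l i ≠ 0}
  let e : Fin (Fintype.card κ) ≃ κ := (Fintype.equivFin κ).symm
  let G : Matrix (Fin n) (Fin (Fintype.card κ)) ℝ :=
    Matrix.of fun i j => U i (e j).1 * √(l (e j).1)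
  have hG : G * Gᵀ = M := by
    have hspec := hM.1.spectral_theorem
    ext i k
    have h1 : (G * Gᵀ) i k = ∑ j : κ, U i j.1 * l j.1 * U k j.1 := by
      rw [Matrix.mul_apply, ← e.sum_comp]
      refine Finset.sum_congr rfl fun j _ => ?_
      have := Real.mul_self_sqrt (hM.eigenvalues_nonneg (e j).1)
      simp only [G, Matrix.transpose_apply, Matrix.of_apply]
      calc _ = U i (e j).1 * (√(l (e j).1) * √(l (e j).1)) * U k (e j).1 := by ring
        _ = _ := by rw [this]
    have h2 : ∑ j : κ, U i j.1 * l j.1 * U k j.1 = ∑ j, U i j * l j * U k j := by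
      rw [← Finset.sum_filter_of_ne (p := fun j => l j ≠ 0)]
      · exact (Finset.sum_subtype _ (by simp) fun j => U i j * l j * U k j).symm
      · intro j _ hj h0
        simp [h0] at hj
    rw [h1, h2]
    conv_rhs => rw [hspec]
    simp [Unitary.conjStarAlgAut_apply, Matrix.mul_apply, Matrix.diagonal_apply, U, l]
  refine ⟨_, G, ?_, hG⟩
  have h1 : (G * Gᵀ).rank = G.rank := Matrix.rank_self_mul_transpose G
  rw [← h1, hG, hM.1.rank_eq_card_non_zero_eigs]

lemma exists_posDef_factor {n : ℕ} {M : Matrix (Fin n) (Fin n) ℝ} (hM : M.PosDef) :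
    ∃ B : Matrix (Fin n) (Fin n) ℝ, B.PosDef ∧ B * Bᵀ = M := by
  open scoped MatrixOrder in
  have h0 : (CFC.sqrt M).PosSemidef := Matrix.nonneg_iff_posSemidef.1 (CFC.sqrt_nonneg M)
  have h1 : CFC.sqrt M * CFC.sqrt M = M :=
    CFC.sqrt_mul_sqrt_self M (Matrix.nonneg_iff_posSemidef.2 hM.posSemidef)
  refine ⟨CFC.sqrt M, h0.posDef_iff_det_ne_zero.2 fun h => ?_, ?_⟩
  · apply hM.det_pos.ne'
    rw [← h1, Matrix.det_mul, h, zero_mul]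
  · have h2 := h0.1
    rw [Matrix.IsHermitian, Matrix.conjTranspose_eq_transpose_of_trivial] at h2
    rw [h2, h1]

end FullRankFactor

/-! ### Differentiating the matrix exponential. -/

section Exp

open scoped Matrix.Norms.Operator

variable {n m : ℕ}

lemma hasDerivAt_exp_smul (F : Matrix (Fin n) (Fin n) ℝ) (t : ℝ) :
    HasDerivAt (fun t : ℝ => NormedSpace.exp (t • F)) (NormedSpace.exp (t • F) * F) t :=
  hasDerivAt_exp_smul_const F t

lemma hasDerivAt_exp_smul' (F : Matrix (Fin n) (Fin n) ℝ) (t : ℝ) :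
    HasDerivAt (fun t : ℝ => NormedSpace.exp (t • F)) (F * NormedSpace.exp (t • F)) t :=
  hasDerivAt_exp_smul_const' F t

lemma hasDerivAt_matrix_iff {k : ℕ} {f : ℝ → Matrix (Fin n) (Fin k) ℝ}
    {f' : Matrix (Fin n) (Fin k) ℝ} {t : ℝ} :
    HasDerivAt f f' t ↔ ∀ i j, HasDerivAt (fun s => f s i j) (f' i j) t := by
  have h1 := hasDerivAt_pi (φ := f) (φ' := f') (x := t)
  exact h1.trans (forall_congr' fun i => hasDerivAt_pi)

lemma continuous_exp_smul (F : Matrix (Fin n) (Fin n) ℝ) :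
    Continuous fun t : ℝ => NormedSpace.exp (t • F) :=
  continuous_iff_continuousAt.2 fun t => (hasDerivAt_exp_smul F t).continuousAt

lemma exp_add_smul (F : Matrix (Fin n) (Fin n) ℝ) (s t : ℝ) :
    NormedSpace.exp ((s + t) • F) = NormedSpace.exp (s • F) * NormedSpace.exp (t • F) := by
  rw [add_smul]
  exact Matrix.exp_add_of_commute _ _ (((Commute.refl F).smul_left s).smul_right t)

/-- F is kept on the inner side of both exponentials, so that the Lyapunov expression FS + SF'
stands between them. -/
lemma hasDerivAt_exp_conj (F S : Matrix (Fin n) (Fin n) ℝ) (t : ℝ) :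
    HasDerivAt (fun t : ℝ => NormedSpace.exp (t • F) * S * (NormedSpace.exp (t • F))ᵀ)
      (NormedSpace.exp (t • F) * (F * S + S * Fᵀ) * (NormedSpace.exp (t • F))ᵀ) t := by
  have h1 := hasDerivAt_exp_smul F t
  have h2 : HasDerivAt (fun t : ℝ => (NormedSpace.exp (t • F))ᵀ)
      (Fᵀ * (NormedSpace.exp (t • F))ᵀ) t := by
    have := hasDerivAt_exp_smul' Fᵀ t
    simpa [← Matrix.transpose_smul, Matrix.exp_transpose] using this
  refine ((h1.mul_const S).mul h2).congr_deriv ?_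
  simp only [Matrix.mul_add, Matrix.add_mul, Matrix.mul_assoc]

end Exp

/-! ### The Gramian and controllability. -/

section Gramian

variable {n m : ℕ}

lemma gramian_apply (F : Matrix (Fin n) (Fin n) ℝ) (G : Matrix (Fin n) (Fin m) ℝ) (h : ℝ)
    (i j : Fin n) : gramian F G h i j = ∫ τ in (0 : ℝ)..h,
      (NormedSpace.exp (τ • F) * (G * Gᵀ) * (NormedSpace.exp (τ • F))ᵀ) i j := by
  simp [gramian, ← Matrix.transpose_smul, Matrix.exp_transpose, Matrix.mul_assoc]

lemma continuous_exp_conj_apply (F M : Matrix (Fin n) (Fin n) ℝ) (i j : Fin n) :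
    Continuous fun τ : ℝ => (NormedSpace.exp (τ • F) * M * (NormedSpace.exp (τ • F))ᵀ) i j := by
  have := continuous_exp_smul F
  exact Continuous.matrix_elem (by fun_prop) i j

/-- The fundamental theorem of calculus for exp(tF) S exp(tF)'. It serves twice: with the Stein
equation it identifies the Gramian with BB', and it shows that S is preserved by the dynamics of the
constructed process. -/
lemma gramian_eq_sub {F S : Matrix (Fin n) (Fin n) ℝ} {G : Matrix (Fin n) (Fin m) ℝ}
    (hG : G * Gᵀ = -(F * S + S * Fᵀ)) (h : ℝ) :
    gramian F G h = S - NormedSpace.exp (h • F) * S * (NormedSpace.exp (h • F))ᵀ := by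
  open scoped Matrix.Norms.Operator in
  ext i j
  have hd : ∀ t ∈ Set.uIcc 0 h, HasDerivAt
      (fun t : ℝ => (NormedSpace.exp (t • F) * S * (NormedSpace.exp (t • F))ᵀ) i j)
      ((NormedSpace.exp (t • F) * (F * S + S * Fᵀ) * (NormedSpace.exp (t • F))ᵀ) i j) t :=
    fun t _ => hasDerivAt_matrix_iff.1 (hasDerivAt_exp_conj F S t) i j
  have h1 := intervalIntegral.integral_eq_sub_of_hasDerivAt hd
    ((continuous_exp_conj_apply F _ i j).intervalIntegrable _ _)
  rw [gramian_apply, hG]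
  simp only [Matrix.mul_neg, Matrix.neg_mul, Matrix.neg_apply, intervalIntegral.integral_neg, h1]
  simp

lemma dotProduct_gramian_mulVec (F : Matrix (Fin n) (Fin n) ℝ) (G : Matrix (Fin n) (Fin m) ℝ)
    (h : ℝ) (z : Fin n → ℝ) : z ⬝ᵥ gramian F G h *ᵥ z = ∫ τ in (0 : ℝ)..h,
      (z ᵥ* (NormedSpace.exp (τ • F) * G)) ⬝ᵥ (z ᵥ* (NormedSpace.exp (τ • F) * G)) := by
  have h1 : ∀ τ : ℝ, (z ᵥ* (NormedSpace.exp (τ • F) * G)) ⬝ᵥ (z ᵥ* (NormedSpace.exp (τ • F) * G))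
      = ∑ i, ∑ j, z i *
        ((NormedSpace.exp (τ • F) * (G * Gᵀ) * (NormedSpace.exp (τ • F))ᵀ) i j * z j) := by
    intro τ
    have : NormedSpace.exp (τ • F) * (G * Gᵀ) * (NormedSpace.exp (τ • F))ᵀ
        = (NormedSpace.exp (τ • F) * G) * (NormedSpace.exp (τ • F) * G)ᵀ := by
      simp [Matrix.transpose_mul, Matrix.mul_assoc]
    rw [this]
    set M := NormedSpace.exp (τ • F) * G
    calc (z ᵥ* M) ⬝ᵥ (z ᵥ* M) = z ⬝ᵥ (M * Mᵀ) *ᵥ z := by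
          rw [← Matrix.mulVec_mulVec, Matrix.dotProduct_mulVec, Matrix.mulVec_transpose]
      _ = _ := by simp only [dotProduct, Matrix.mulVec, Finset.mul_sum]
  simp_rw [h1]
  have hc : ∀ i j, Continuous fun τ : ℝ => z i *
      ((NormedSpace.exp (τ • F) * (G * Gᵀ) * (NormedSpace.exp (τ • F))ᵀ) i j * z j) := fun i j =>
    continuous_const.mul ((continuous_exp_conj_apply F (G * Gᵀ) i j).mul continuous_const)
  rw [intervalIntegral.integral_finsetSum]
  · simp only [dotProduct, Matrix.mulVec, gramian_apply, Finset.mul_sum]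
    refine Finset.sum_congr rfl fun i _ => ?_
    rw [intervalIntegral.integral_finsetSum]
    · simp
    · exact fun j _ => (hc i j).intervalIntegrable _ _
  · exact fun i _ => (continuous_finsetSum _ fun j _ => hc i j).intervalIntegrable _ _

/-- Cayley–Hamilton: every power of F is a polynomial in F of degree below n. -/
lemma vecMul_pow_mul_eq_zero {F : Matrix (Fin n) (Fin n) ℝ} {G : Matrix (Fin n) (Fin m) ℝ}
    {z : Fin n → ℝ} (h : ∀ k < n, z ᵥ* (F ^ k * G) = 0) (k : ℕ) : z ᵥ* (F ^ k * G) = 0 := by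
  rcases Nat.eq_zero_or_pos n with rfl | hn
  · rw [Subsingleton.elim z 0, Matrix.zero_vecMul]
  rw [Matrix.pow_eq_aeval_mod_charpoly F k, Polynomial.aeval_eq_sum_range' (n := n)]
  · rw [Matrix.sum_mul, Matrix.vecMul_sum]
    refine Finset.sum_eq_zero fun j hj => ?_
    rw [Matrix.smul_mul, Matrix.vecMul_smul, h j (Finset.mem_range.1 hj), smul_zero]
  · have hdeg : F.charpoly.natDegree = n := by simp
    refine (Polynomial.natDegree_modByMonic_lt _ F.charpoly_monic fun h1 => ?_).trans_eq hdeg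
    rw [h1, Polynomial.natDegree_one] at hdeg
    omega

/-- By rank–nullity for the transpose, full rank means that no nonzero z annihilates all columns
from the left; Cayley–Hamilton removes the bound on the powers. -/
lemma isControllable_iff {F : Matrix (Fin n) (Fin n) ℝ} {G : Matrix (Fin n) (Fin m) ℝ} :
    IsControllable F G ↔ ∀ z : Fin n → ℝ, (∀ k, z ᵥ* (F ^ k * G) = 0) → z = 0 := by
  have h1 : ∀ z : Fin n → ℝ, (reachabilityMatrix F G)ᵀ *ᵥ z = 0 ↔ ∀ k, z ᵥ* (F ^ k * G) = 0 := by
    intro z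
    rw [Matrix.mulVec_transpose]
    constructor
    · refine fun h => vecMul_pow_mul_eq_zero fun k hk => ?_
      ext j
      exact congrFun h (⟨k, hk⟩, j)
    · intro h
      ext ⟨k, j⟩
      exact congrFun (h k) j
  rw [IsControllable, ← Matrix.rank_transpose]
  have h2 := LinearMap.finrank_range_add_finrank_ker (reachabilityMatrix F G)ᵀ.mulVecLin
  rw [Module.finrank_fin_fun] at h2
  rw [Matrix.rank]
  have h3 : Module.finrank ℝ (LinearMap.range (reachabilityMatrix F G)ᵀ.mulVecLin) = n ↔
      LinearMap.ker (reachabilityMatrix F G)ᵀ.mulVecLin = ⊥ := by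
    rw [← Submodule.finrank_eq_zero (R := ℝ)]
    omega
  rw [h3, LinearMap.ker_eq_bot']
  simp only [Matrix.mulVecLin_apply, h1]

lemma gramian_isHermitian (F : Matrix (Fin n) (Fin n) ℝ) (G : Matrix (Fin n) (Fin m) ℝ) (h : ℝ) :
    (gramian F G h).IsHermitian := by
  ext i j
  simp only [Matrix.conjTranspose_apply, star_trivial, gramian_apply]
  congr 1
  ext τ
  have h1 : (NormedSpace.exp (τ • F) * (G * Gᵀ) * (NormedSpace.exp (τ • F))ᵀ)ᵀ
      = NormedSpace.exp (τ • F) * (G * Gᵀ) * (NormedSpace.exp (τ • F))ᵀ := by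
    simp only [Matrix.transpose_mul, Matrix.transpose_transpose, Matrix.mul_assoc]
  exact congrFun (congrFun h1 i) j

section VecMul

open scoped Matrix.Norms.Operator

/-- The continuous linear map `N ↦ z ᵥ* (N * G)`. -/
noncomputable def vecMulMul (z : Fin n → ℝ) (G : Matrix (Fin n) (Fin m) ℝ) :
    Matrix (Fin n) (Fin n) ℝ →L[ℝ] (Fin m → ℝ) :=
  LinearMap.toContinuousLinearMap
    { toFun := fun N => z ᵥ* (N * G)
      map_add' := by intro a b; simp [Matrix.add_mul, Matrix.vecMul_add]
      map_smul' := by intro a b; simp [Matrix.vecMul_smul] }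

end VecMul

/-- The quadratic form at z is the integral of |z' exp(τF) G|². If it vanishes, so does the
integrand on (0,h), and with it all derivatives z' exp(τF) F^k G. Letting τ → 0 gives z'F^kG = 0 for
all k. -/
lemma gramian_posDef {F : Matrix (Fin n) (Fin n) ℝ} {G : Matrix (Fin n) (Fin m) ℝ} {h : ℝ}
    (hh : 0 < h) (hc : IsControllable F G) : (gramian F G h).PosDef := by
  open scoped Matrix.Norms.Operator in
  refine Matrix.PosDef.of_dotProduct_mulVec_pos (gramian_isHermitian F G h) fun z hz => ?_
  rw [star_trivial, dotProduct_gramian_mulVec]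
  have hcont := continuous_exp_smul F
  have hφ : ∀ M : Matrix (Fin n) (Fin m) ℝ,
      Continuous fun τ : ℝ => z ᵥ* (NormedSpace.exp (τ • F) * M) := by
    intro M; fun_prop
  set φ : ℝ → ℝ := fun τ => (z ᵥ* (NormedSpace.exp (τ • F) * G)) ⬝ᵥ
    (z ᵥ* (NormedSpace.exp (τ • F) * G)) with hφdef
  have hφc : Continuous φ := by have := hφ G; fun_prop
  have hφ0 : ∀ τ, 0 ≤ φ τ := fun τ => Finset.sum_nonneg fun i _ => mul_self_nonneg _
  by_contra hneg
  have hzero : ∫ τ in (0 : ℝ)..h, φ τ = 0 :=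
    le_antisymm (not_lt.1 hneg) (intervalIntegral.integral_nonneg hh.le fun τ _ => hφ0 τ)
  have hφz : ∀ τ ∈ Set.Ioo 0 h, z ᵥ* (NormedSpace.exp (τ • F) * G) = 0 := by
    intro τ hτ
    by_contra hne
    refine absurd hzero (ne_of_gt (intervalIntegral.integral_pos hh hφc.continuousOn
      (fun τ _ => hφ0 τ) ⟨τ, Set.Ioo_subset_Icc_self hτ, ?_⟩))
    exact lt_of_le_of_ne (hφ0 τ) fun h0 => hne (dotProduct_self_eq_zero.1 h0.symm)
  have hk : ∀ k : ℕ, ∀ τ ∈ Set.Ioo 0 h, z ᵥ* (NormedSpace.exp (τ • F) * (F ^ k * G)) = 0 := by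
    intro k
    induction k with
    | zero => simpa using hφz
    | succ k ih =>
      intro τ hτ
      have hd : HasDerivAt (fun τ : ℝ => z ᵥ* (NormedSpace.exp (τ • F) * (F ^ k * G)))
          (z ᵥ* (NormedSpace.exp (τ • F) * (F ^ (k + 1) * G))) τ := by
        have h1 := (vecMulMul z (F ^ k * G)).hasFDerivAt.comp_hasDerivAt τ (hasDerivAt_exp_smul F τ)
        refine h1.congr_deriv ?_
        change z ᵥ* (NormedSpace.exp (τ • F) * F * (F ^ k * G)) = _
        rw [pow_succ', Matrix.mul_assoc, Matrix.mul_assoc]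
      -- The induction runs over the open interval because a function vanishing near τ has zero
      -- derivative there.
      have hev : (fun τ : ℝ => z ᵥ* (NormedSpace.exp (τ • F) * (F ^ k * G))) =ᶠ[𝓝 τ]
          fun _ => 0 := by
        filter_upwards [Ioo_mem_nhds hτ.1 hτ.2] with s hs using ih s hs
      exact (hd.congr_of_eventuallyEq hev.symm).unique (hasDerivAt_const τ 0)
  refine hz (isControllable_iff.1 hc z fun k => ?_)
  have h1 : Tendsto (fun τ : ℝ => z ᵥ* (NormedSpace.exp (τ • F) * (F ^ k * G))) (𝓝[>] 0)
      (𝓝 (z ᵥ* (F ^ k * G))) := by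
    have := ((hφ (F ^ k * G)).tendsto 0).mono_left (nhdsWithin_le_nhds (s := Set.Ioi 0))
    simpa using this
  refine tendsto_nhds_unique h1 (tendsto_const_nhds.congr' ?_)
  filter_upwards [Ioo_mem_nhdsGT hh] with τ hτ using (hk k τ hτ).symm

/-- If z'F^kG = 0 for all k, the exponential series gives z' exp(τF) G = 0 for all τ, so the
quadratic form vanishes at z. -/
lemma isControllable_of_gramian_posDef {F : Matrix (Fin n) (Fin n) ℝ}
    {G : Matrix (Fin n) (Fin m) ℝ} {h : ℝ} (hQ : (gramian F G h).PosDef) :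
    IsControllable F G := by
  open scoped Matrix.Norms.Operator in
  rw [isControllable_iff]
  intro z hz
  by_contra hne
  have h1 := hQ.dotProduct_mulVec_pos hne
  rw [star_trivial, dotProduct_gramian_mulVec] at h1
  have h2 : ∀ τ : ℝ, z ᵥ* (NormedSpace.exp (τ • F) * G) = 0 := by
    intro τ
    have hs := NormedSpace.exp_series_hasSum_exp' (𝕂 := ℝ) (τ • F)
    have h3 := hs.mapL (vecMulMul z G)
    refine h3.unique ?_
    convert hasSum_zero using 1
    ext1 k
    change z ᵥ* ((((k.factorial : ℝ)⁻¹) • (τ • F) ^ k) * G) = 0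
    rw [smul_pow, smul_smul, Matrix.smul_mul, Matrix.vecMul_smul, hz k, smul_zero]
  simp [h2] at h1

end Gramian

/-! ### Mean-square limits of Gaussian processes, and laws determined by means and covariances. -/

section Gaussian

variable {Ω Ω' : Type*} [MeasurableSpace Ω] [MeasurableSpace Ω'] {P : Measure Ω} {P' : Measure Ω'}

/-- Convergence of real random variables in mean square. -/
structure TendstoL2 (X : ℕ → Ω → ℝ) (Y : Ω → ℝ) (P : Measure Ω) : Prop where
  memLp : ∀ N, MemLp (X N) 2 P
  memLp_lim : MemLp Y 2 P
  tendsto : Tendsto (fun N => eLpNorm (fun ω => X N ω - Y ω) 2 P) atTop (𝓝 0)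

namespace TendstoL2

variable {X X' : ℕ → Ω → ℝ} {Y Y' : Ω → ℝ}

lemma const (hY : MemLp Y 2 P) : TendstoL2 (fun _ => Y) Y P :=
  ⟨fun _ => hY, hY, by simp⟩

lemma add (h : TendstoL2 X Y P) (h' : TendstoL2 X' Y' P) :
    TendstoL2 (fun N ω => X N ω + X' N ω) (fun ω => Y ω + Y' ω) P where
  memLp N := (h.memLp N).add (h'.memLp N)
  memLp_lim := h.memLp_lim.add h'.memLp_lim
  tendsto := by
    refine tendsto_of_tendsto_of_tendsto_of_le_of_le tendsto_const_nhds
      (by simpa using h.tendsto.add h'.tendsto) (fun _ => zero_le) fun N => ?_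
    have : (fun ω => X N ω + X' N ω - (Y ω + Y' ω))
        = (fun ω => X N ω - Y ω) + fun ω => X' N ω - Y' ω := by
      ext ω; simp only [Pi.add_apply]; ring
    simp only [this]
    exact eLpNorm_add_le ((h.memLp N).sub h.memLp_lim).1 ((h'.memLp N).sub h'.memLp_lim).1
      (by norm_num)

lemma const_mul (h : TendstoL2 X Y P) (c : ℝ) :
    TendstoL2 (fun N ω => c * X N ω) (fun ω => c * Y ω) P where
  memLp N := (h.memLp N).const_mul c
  memLp_lim := h.memLp_lim.const_mul c
  tendsto := by
    have h1 : ∀ N, eLpNorm (fun ω => c * X N ω - c * Y ω) 2 P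
        = ‖c‖ₑ * eLpNorm (fun ω => X N ω - Y ω) 2 P := by
      intro N
      rw [← eLpNorm_const_smul]
      congr 1
      ext ω
      simp [mul_sub]
    simp_rw [h1]
    simpa using ENNReal.Tendsto.const_mul h.tendsto (Or.inr (by simp))

lemma sum {ι : Type*} (s : Finset ι) {X : ι → ℕ → Ω → ℝ} {Y : ι → Ω → ℝ}
    (h : ∀ i ∈ s, TendstoL2 (X i) (Y i) P) :
    TendstoL2 (fun N ω => ∑ i ∈ s, X i N ω) (fun ω => ∑ i ∈ s, Y i ω) P := by
  classical
  induction s using Finset.induction_on with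
  | empty => simpa using TendstoL2.const (P := P) (Y := fun _ => (0 : ℝ)) MemLp.zero'
  | insert i s hi ih =>
    simp only [Finset.sum_insert hi]
    exact (h i (by simp)).add (ih fun j hj => h j (by simp [hj]))

lemma tendsto_toLp (h : TendstoL2 X Y P) :
    Tendsto (fun N => (h.memLp N).toLp (X N)) atTop (𝓝 (h.memLp_lim.toLp Y)) := by
  rw [Lp.tendsto_Lp_iff_tendsto_eLpNorm'']
  exact h.tendsto

lemma tendsto_integral_mul (h : TendstoL2 X Y P) (h' : TendstoL2 X' Y' P) :
    Tendsto (fun N => ∫ ω, X N ω * X' N ω ∂P) atTop (𝓝 (∫ ω, Y ω * Y' ω ∂P)) := by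
  have key : ∀ {f g : Ω → ℝ} (hf : MemLp f 2 P) (hg : MemLp g 2 P),
      inner ℝ (hf.toLp f) (hg.toLp g) = ∫ ω, f ω * g ω ∂P := by
    intro f g hf hg
    rw [L2.inner_def]
    refine integral_congr_ae ?_
    filter_upwards [hf.coeFn_toLp, hg.coeFn_toLp] with ω h1 h2
    rw [h1, h2]
    simp [mul_comm]
  have := h.tendsto_toLp.inner (𝕜 := ℝ) h'.tendsto_toLp
  simpa only [key] using this

lemma tendsto_integral [IsProbabilityMeasure P] (h : TendstoL2 X Y P) :
    Tendsto (fun N => ∫ ω, X N ω ∂P) atTop (𝓝 (∫ ω, Y ω ∂P)) := by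
  simpa using h.tendsto_integral_mul (TendstoL2.const (P := P) (Y := fun _ => (1 : ℝ))
    (memLp_const 1))

lemma tendsto_covariance [IsProbabilityMeasure P] (h : TendstoL2 X Y P)
    (h' : TendstoL2 X' Y' P) :
    Tendsto (fun N => cov[X N, X' N; P]) atTop (𝓝 cov[Y, Y'; P]) := by
  simp_rw [fun N => covariance_eq_sub (h.memLp N) (h'.memLp N),
    covariance_eq_sub h.memLp_lim h'.memLp_lim]
  exact (h.tendsto_integral_mul h').sub (h.tendsto_integral.mul h'.tendsto_integral)

/-- Mean-square convergence gives convergence in distribution as well as convergence of mean and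
variance. The Gaussian characteristic functions therefore converge to one of the same form, which
may be degenerate. -/
lemma hasGaussianLaw [IsProbabilityMeasure P] (h : TendstoL2 X Y P)
    (hX : ∀ N, HasGaussianLaw (X N) P) : HasGaussianLaw Y P := by
  have hm := h.tendsto_integral
  have hv := h.tendsto_covariance h
  simp_rw [fun N => covariance_self (h.memLp N).1.aemeasurable,
    covariance_self h.memLp_lim.1.aemeasurable] at hv
  have hmeas : TendstoInMeasure P X atTop Y :=
    tendstoInMeasure_of_tendsto_eLpNorm (p := 2) (by norm_num) (fun N => (h.memLp N).1)
      h.memLp_lim.1 h.tendsto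
  have hd := (hmeas.tendstoInDistribution fun N => (h.memLp N).1.aemeasurable).tendsto
  replace hd := ProbabilityMeasure.tendsto_iff_tendsto_charFun.1 hd
  constructor
  have : P.map Y = gaussianReal P[Y] Var[Y; P].toNNReal := by
    have := Measure.isProbabilityMeasure_map (μ := P) h.memLp_lim.1.aemeasurable
    refine Measure.ext_of_charFun ?_
    ext t
    refine tendsto_nhds_unique (hd t) ?_
    -- Truncating the variance at 0 makes the formula continuous on the whole plane, including at a
    -- limit variance of 0.
    have h1 : Continuous fun q : ℝ × ℝ => Complex.exp (t * q.1 * Complex.I -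
        ((q.2.toNNReal : ℝ) : ℂ) * t ^ 2 / 2) := by fun_prop
    have h2 := (h1.tendsto (∫ ω, Y ω ∂P, Var[Y; P])).comp (hm.prodMk_nhds hv)
    have h3 : ∀ (m : ℝ) (v : ℝ), charFun (gaussianReal m v.toNNReal) t
        = Complex.exp (t * m * Complex.I - ((v.toNNReal : ℝ) : ℂ) * t ^ 2 / 2) :=
      fun m v => charFun_gaussianReal t
    rw [h3]
    refine h2.congr fun N => ?_
    rw [Function.comp_apply, ← h3, ← (hX N).map_eq_gaussianReal]
    rfl
  rw [this]
  infer_instance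

end TendstoL2

lemma exists_dual_eq_sum {ι : Type*} [Fintype ι] (L : (ι → ℝ) →L[ℝ] ℝ) :
    ∃ c : ι → ℝ, ∀ x, L x = ∑ i, c i * x i := by
  classical
  refine ⟨fun i => L (Pi.single i 1), fun x => ?_⟩
  conv_lhs => rw [← Finset.univ_sum_single x]
  rw [map_sum]
  refine Finset.sum_congr rfl fun i _ => ?_
  have : (Pi.single i (x i) : ι → ℝ) = x i • Pi.single i 1 := by
    rw [← Pi.single_smul]; simp
  rw [this, map_smul, smul_eq_mul, mul_comm]

/-- Cramér–Wold: it is enough to test finite linear combinations, and these converge in mean square.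
-/
lemma isGaussianProcess_of_tendstoL2 [IsProbabilityMeasure P] {T : Type*} {X : ℕ → T → Ω → ℝ}
    {Y : T → Ω → ℝ} (hX : ∀ N, IsGaussianProcess (X N) P)
    (h : ∀ t, TendstoL2 (fun N => X N t) (Y t) P) : IsGaussianProcess Y P where
  hasGaussianLaw I := by
    have hm : AEMeasurable (fun ω => I.restrict fun t => Y t ω) P :=
      aemeasurable_pi_lambda _ fun t => (h t).memLp_lim.1.aemeasurable
    constructor
    refine isGaussian_of_isGaussian_map fun L => ?_
    rw [AEMeasurable.map_map_of_aemeasurable (by fun_prop) hm]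
    obtain ⟨c, hL⟩ := exists_dual_eq_sum L
    have h1 : HasGaussianLaw (fun ω => ∑ i : I, c i * Y i ω) P := by
      refine TendstoL2.hasGaussianLaw (X := fun N ω => ∑ i : I, c i * X N i ω)
        (TendstoL2.sum _ fun i _ => (h i).const_mul _) fun N => ?_
      have := ((hX N).hasGaussianLaw I).map L
      refine this.congr (ae_of_all _ fun ω => ?_)
      simp only [Function.comp_apply, hL]
      rfl
    convert h1.isGaussian_map using 2
    ext ω
    simp only [Function.comp_apply, hL]
    rfl

/-- The characteristic function of a Gaussian vector involves only the mean and variance of linear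
functionals, and these expand bilinearly in the given data. -/
lemma map_restrict_eq_of_covariance_eq {T : Type*} {X : T → Ω → ℝ} {Y : T → Ω' → ℝ}
    (hX : IsGaussianProcess X P) (hY : IsGaussianProcess Y P')
    (hm : ∀ t, P[X t] = P'[Y t]) (hc : ∀ s t, cov[X s, X t; P] = cov[Y s, Y t; P'])
    (I : Finset T) :
    P.map (fun ω => I.restrict fun t => X t ω) = P'.map (fun ω => I.restrict fun t => Y t ω) := by
  have hPX := hX.isProbabilityMeasure
  have hPY := hY.isProbabilityMeasure
  have := (hX.hasGaussianLaw I).isGaussian_map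
  have := (hY.hasGaussianLaw I).isGaussian_map
  have hmX : AEMeasurable (fun ω => I.restrict fun t => X t ω) P :=
    aemeasurable_pi_lambda _ fun t => hX.aemeasurable t
  have hmY : AEMeasurable (fun ω => I.restrict fun t => Y t ω) P' :=
    aemeasurable_pi_lambda _ fun t => hY.aemeasurable t
  have hLX : ∀ t, MemLp (X t) 2 P := fun t => (hX.hasGaussianLaw_eval t).memLp_two
  have hLY : ∀ t, MemLp (Y t) 2 P' := fun t => (hY.hasGaussianLaw_eval t).memLp_two
  refine Measure.ext_of_charFunDual ?_
  ext L
  rw [IsGaussian.charFunDual_eq, IsGaussian.charFunDual_eq, integral_complex_ofReal,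
    integral_complex_ofReal]
  obtain ⟨c, hL⟩ := exists_dual_eq_sum L
  have e1 : ∫ x, L x ∂(P.map fun ω => I.restrict fun t => X t ω)
      = ∫ x, L x ∂(P'.map fun ω => I.restrict fun t => Y t ω) := by
    rw [integral_map hmX (by fun_prop), integral_map hmY (by fun_prop)]
    simp only [hL, Finset.restrict]
    rw [integral_finsetSum _ fun (i : I) _ => ((hLX i).integrable (by norm_num)).const_mul _,
      integral_finsetSum _ fun (i : I) _ => ((hLY i).integrable (by norm_num)).const_mul _]
    simp only [integral_const_mul, hm]
  have e2 : Var[L; P.map fun ω => I.restrict fun t => X t ω]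
      = Var[L; P'.map fun ω => I.restrict fun t => Y t ω] := by
    rw [variance_map (by fun_prop) hmX, variance_map (by fun_prop) hmY,
      ← covariance_self (by fun_prop), ← covariance_self (by fun_prop)]
    have eX : (L ∘ fun ω => I.restrict fun t => X t ω)
        = fun ω => ∑ i : I, c i * X i ω := by
      ext ω; simp only [Function.comp_apply, hL]; rfl
    have eY : (L ∘ fun ω => I.restrict fun t => Y t ω)
        = fun ω => ∑ i : I, c i * Y i ω := by
      ext ω; simp only [Function.comp_apply, hL]; rfl
    rw [eX, eY, covariance_fun_sum_fun_sum (fun i : I => (hLX i).const_mul _)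
      (fun i : I => (hLX i).const_mul _),
      covariance_fun_sum_fun_sum (fun i : I => (hLY i).const_mul _)
      (fun i : I => (hLY i).const_mul _)]
    simp only [covariance_const_mul_left, covariance_const_mul_right, hc]
  rw [e1, e2]

lemma isGaussianProcess_uncurry {T : Type*} {n : ℕ} {X : T → Ω → (Fin n → ℝ)}
    (hX : IsGaussianProcess X P) : IsGaussianProcess (fun (q : T × Fin n) ω => X q.1 ω q.2) P :=
  hX.of_isGaussianProcess fun q => ⟨{q.1},
    (ContinuousLinearMap.proj q.2).comp
      (ContinuousLinearMap.proj (R := ℝ) (φ := fun _ : ({q.1} : Finset T) => Fin n → ℝ)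
        ⟨q.1, by simp⟩), fun ω => rfl⟩

lemma isGaussianProcess_curry {T : Type*} {n : ℕ} {X : T → Ω → (Fin n → ℝ)}
    (hX : IsGaussianProcess (fun (q : T × Fin n) ω => X q.1 ω q.2) P) : IsGaussianProcess X P := by
  classical
  refine hX.of_isGaussianProcess fun t => ⟨Finset.univ.image fun i => (t, i),
    ContinuousLinearMap.pi fun i => ContinuousLinearMap.proj
      (R := ℝ) (φ := fun _ : (Finset.univ.image fun i : Fin n => (t, i) : Finset (T × Fin n)) => ℝ)
        ⟨(t, i), by simp⟩, fun ω => rfl⟩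

/-- After flattening to the scalar index set of pairs (time, coordinate), the finite-dimensional
laws agree, and a projective limit of probability measures is unique. -/
lemma identDistrib_of_covariance_eq {T : Type*} {n : ℕ} {X : T → Ω → (Fin n → ℝ)}
    {Y : T → Ω' → (Fin n → ℝ)} (hX : IsGaussianProcess X P) (hY : IsGaussianProcess Y P')
    (hmX : ∀ t, Measurable (X t)) (hmY : ∀ t, Measurable (Y t))
    (hm : ∀ t i, ∫ ω, X t ω i ∂P = ∫ ω, Y t ω i ∂P')
    (hc : ∀ s t i j, cov[fun ω => X s ω i, fun ω => X t ω j; P]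
      = cov[fun ω => Y s ω i, fun ω => Y t ω j; P']) :
    IdentDistrib (fun ω t => X t ω) (fun ω t => Y t ω) P P' := by
  have hPX := hX.isProbabilityMeasure
  have hPY := hY.isProbabilityMeasure
  have hX' := isGaussianProcess_uncurry hX
  have hY' := isGaussianProcess_uncurry hY
  have hmX' : Measurable fun ω (q : T × Fin n) => X q.1 ω q.2 := by
    have := hmX; fun_prop
  have hmY' : Measurable fun ω (q : T × Fin n) => Y q.1 ω q.2 := by
    have := hmY; fun_prop
  have key : P.map (fun ω (q : T × Fin n) => X q.1 ω q.2)
      = P'.map (fun ω (q : T × Fin n) => Y q.1 ω q.2) := by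
    refine IsProjectiveLimit.unique (isProjectiveLimit_map
      (X := fun (q : T × Fin n) ω => X q.1 ω q.2) hmX'.aemeasurable) ?_
    intro I
    rw [isProjectiveLimit_map (X := fun (q : T × Fin n) ω => Y q.1 ω q.2) hmY'.aemeasurable I]
    exact (map_restrict_eq_of_covariance_eq hX' hY' (fun q => hm q.1 q.2)
      (fun q q' => hc q.1 q'.1 q.2 q'.2) I).symm
  have hid : IdentDistrib (fun ω (q : T × Fin n) => X q.1 ω q.2)
      (fun ω (q : T × Fin n) => Y q.1 ω q.2) P P' :=
    ⟨hmX'.aemeasurable, hmY'.aemeasurable, key⟩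
  exact hid.comp (u := fun (x : T × Fin n → ℝ) t i => x (t, i)) (by fun_prop)

end Gaussian

/-! ### Tent functions and the Brownian bridge covariance. -/

section Schauder

/-- The tent function on `[0, 1]`. -/
noncomputable def tent (v : ℝ) : ℝ := max 0 (min v (1 - v))

lemma continuous_tent : Continuous tent := by unfold tent; fun_prop

lemma tent_nonneg (v : ℝ) : 0 ≤ tent v := le_max_left _ _

lemma tent_le_one (v : ℝ) : tent v ≤ 1 := by
  unfold tent
  rcases le_total v (1 - v) with h | h
  · rw [min_eq_left h]; exact max_le zero_le_one (by linarith)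
  · rw [min_eq_right h]; exact max_le zero_le_one (by linarith)

lemma tent_eq_zero {v : ℝ} (h : v ≤ 0 ∨ 1 ≤ v) : tent v = 0 := by
  unfold tent
  rcases h with h | h
  · exact max_eq_left ((min_le_left _ _).trans h)
  · exact max_eq_left ((min_le_right _ _).trans (by linarith))

/-- Integer translates of a function vanishing off (0,1) do not overlap: only k = ⌊v⌋ can
contribute. -/
lemma sum_shift_le_one {f : ℝ → ℝ} (h1 : ∀ v, f v ≤ 1) (h2 : ∀ v, v ≤ 0 ∨ 1 ≤ v → f v = 0)
    (K : ℕ) (v : ℝ) : ∑ k ∈ Finset.range K, f (v - k) ≤ 1 := by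
  have hz : ∀ k ∈ Finset.range K, k ≠ ⌊v⌋₊ → f (v - k) = 0 := by
    intro k _ hk
    apply h2
    rcases lt_or_gt_of_ne hk with h | h
    · right
      have : ((k + 1 : ℕ) : ℝ) ≤ v := by
        rcases le_or_gt 0 v with hv | hv
        · exact (Nat.le_floor_iff hv).1 h
        · rw [Nat.floor_of_nonpos hv.le] at h; omega
      push_cast at this; linarith
    · left
      have : v < k := Nat.lt_of_floor_lt h
      linarith
  by_cases hm : ⌊v⌋₊ ∈ Finset.range K
  · rw [Finset.sum_eq_single_of_mem _ hm hz]; exact h1 _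
  · rw [Finset.sum_eq_zero fun k hk => hz k hk fun h => hm (h ▸ hk)]; exact zero_le_one

/-- The covariance of the Brownian bridge, extended by zero. -/
noncomputable def bridgeCov (s t : ℝ) : ℝ :=
  min (max 0 (min s 1)) (max 0 (min t 1)) - max 0 (min s 1) * max 0 (min t 1)

lemma bridgeCov_of_mem {s t : ℝ} (hs : s ∈ Set.Icc (0 : ℝ) 1) (ht : t ∈ Set.Icc (0 : ℝ) 1) :
    bridgeCov s t = min s t - s * t := by
  simp [bridgeCov, hs.1, hs.2, ht.1, ht.2]

/-- Midpoint displacement: a bridge is a normal multiple of the tent plus two independent bridges on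
the half intervals, and halving the time halves the variance. The proof sorts s ≤ t by their
position relative to 0, 1/2 and 1. -/
lemma bridgeCov_rec (s t : ℝ) : bridgeCov s t =
    tent s * tent t + (bridgeCov (2 * s) (2 * t) + bridgeCov (2 * s - 1) (2 * t - 1)) / 2 := by
  wlog hst : s ≤ t generalizing s t
  · have hsymm : ∀ a b, bridgeCov a b = bridgeCov b a := fun a b => by
      simp only [bridgeCov, min_comm (max 0 (min a 1)), mul_comm (max 0 (min a 1))]
    rw [hsymm s t, hsymm (2 * s), hsymm (2 * s - 1), mul_comm (tent s)]
    exact this t s (le_of_not_ge hst)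
  have z1 : ∀ a b : ℝ, a ≤ 0 → bridgeCov a b = 0 := fun a b h => by
    have : max 0 (min a 1) = 0 := max_eq_left ((min_le_left _ _).trans h)
    simp [bridgeCov, this]
  have z2 : ∀ a b : ℝ, 1 ≤ b → bridgeCov a b = 0 := fun a b h => by
    have : max 0 (min a 1) ≤ 1 := max_le zero_le_one (min_le_right _ _)
    simp [bridgeCov, min_eq_right h, this]
  have t1 : ∀ a : ℝ, 0 ≤ a → a ≤ 1 / 2 → tent a = a := fun a h h' => by
    rw [tent, min_eq_left (by linarith), max_eq_right h]
  have t2 : ∀ a : ℝ, 1 / 2 ≤ a → a ≤ 1 → tent a = 1 - a := fun a h h' => by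
    rw [tent, min_eq_right (by linarith), max_eq_right (by linarith)]
  have b1 : ∀ a b : ℝ, 0 ≤ a → a ≤ b → b ≤ 1 → bridgeCov a b = a - a * b := fun a b h h' h'' => by
    rw [bridgeCov_of_mem ⟨h, h'.trans h''⟩ ⟨h.trans h', h''⟩, min_eq_left h']
  rcases le_or_gt s 0 with hs | hs
  · rw [z1 _ _ hs, z1 (2 * s) _ (by linarith), z1 (2 * s - 1) _ (by linarith),
      tent_eq_zero (.inl hs)]
    ring
  rcases le_or_gt 1 t with ht | ht
  · rw [z2 _ _ ht, z2 _ (2 * t) (by linarith), z2 _ (2 * t - 1) (by linarith),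
      tent_eq_zero (.inr ht)]
    ring
  rw [b1 s t hs.le hst ht.le]
  rcases le_or_gt t (1 / 2) with h | h
  · rw [b1 (2 * s) (2 * t) (by linarith) (by linarith) (by linarith),
      z1 (2 * s - 1) _ (by linarith), t1 s hs.le (by linarith), t1 t (by linarith) h]
    ring
  rw [z2 _ (2 * t) (by linarith), t2 t h.le ht.le]
  rcases le_or_gt s (1 / 2) with h' | h'
  · rw [z1 (2 * s - 1) _ (by linarith), t1 s hs.le h']
    ring
  · rw [b1 (2 * s - 1) (2 * t - 1) (by linarith) (by linarith) (by linarith),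
      t2 s h'.le (by linarith)]
    ring

lemma bridgeCov_nonneg (s t : ℝ) : 0 ≤ bridgeCov s t := by
  unfold bridgeCov
  set a := max 0 (min s 1) with ha
  set b := max 0 (min t 1) with hb
  have ha0 : 0 ≤ a := le_max_left _ _
  have hb0 : 0 ≤ b := le_max_left _ _
  have ha1 : a ≤ 1 := max_le zero_le_one (min_le_right _ _)
  have hb1 : b ≤ 1 := max_le zero_le_one (min_le_right _ _)
  rcases le_total a b with h | h
  · rw [min_eq_left h]; nlinarith
  · rw [min_eq_right h]; nlinarith

lemma bridgeCov_le (s t : ℝ) :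
    bridgeCov s t ≤ max 0 (min s 1) * (1 - max 0 (min s 1)) := by
  unfold bridgeCov
  set a := max 0 (min s 1) with ha
  set b := max 0 (min t 1) with hb
  have ha0 : 0 ≤ a := le_max_left _ _
  have ha1 : a ≤ 1 := max_le zero_le_one (min_le_right _ _)
  rcases le_total a b with h | h
  · rw [min_eq_left h]; nlinarith
  · rw [min_eq_right h]; nlinarith

lemma sum_bridgeCov_le_one (K : ℕ) (s t : ℝ) :
    ∑ k ∈ Finset.range K, bridgeCov (s - k) (t - k) ≤ 1 := by
  refine (Finset.sum_le_sum fun k _ => bridgeCov_le _ _).trans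
    (sum_shift_le_one (f := fun s => max 0 (min s 1) * (1 - max 0 (min s 1))) ?_ ?_ K s)
  · intro v
    nlinarith [sq_nonneg (max 0 (min v 1) - 1)]
  · rintro v (h | h)
    · simp [max_eq_left ((min_le_left v 1).trans h)]
    · simp [min_eq_right h]

lemma sum_range_two_mul {M : Type*} [AddCommMonoid M] (g : ℕ → M) (K : ℕ) :
    ∑ k ∈ Finset.range (2 * K), g k = ∑ k ∈ Finset.range K, (g (2 * k) + g (2 * k + 1)) := by
  induction K with
  | zero => simp
  | succ K ih =>
    rw [mul_add_one, Finset.sum_range_succ, Finset.sum_range_succ, ih, Finset.sum_range_succ,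
      add_assoc]

/-- The self-similarity relation iterated N times; interval k of one level splits into 2k and 2k+1
of the next. -/
lemma bridgeCov_eq_sum (N : ℕ) (s t : ℝ) : bridgeCov s t =
    ∑ n ∈ Finset.range N, (1 / 2 : ℝ) ^ n *
      ∑ k ∈ Finset.range (2 ^ n), tent (2 ^ n * s - k) * tent (2 ^ n * t - k) +
    (1 / 2 : ℝ) ^ N * ∑ k ∈ Finset.range (2 ^ N), bridgeCov (2 ^ N * s - k) (2 ^ N * t - k) := by
  induction N with
  | zero => simp
  | succ N ih =>
    have h1 : ∑ k ∈ Finset.range (2 ^ N), bridgeCov (2 ^ N * s - k) (2 ^ N * t - k) =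
        ∑ k ∈ Finset.range (2 ^ N), tent (2 ^ N * s - k) * tent (2 ^ N * t - k) +
        (1 / 2) * ∑ k ∈ Finset.range (2 ^ (N + 1)),
          bridgeCov (2 ^ (N + 1) * s - k) (2 ^ (N + 1) * t - k) := by
      rw [pow_succ' 2 N, sum_range_two_mul, Finset.mul_sum, ← Finset.sum_add_distrib]
      refine Finset.sum_congr rfl fun k _ => ?_
      rw [bridgeCov_rec]
      push_cast
      ring_nf
    rw [ih, h1, Finset.sum_range_succ]
    ring

/-- The remainder after N levels lies between 0 and 2^(-N), because the translated bridge
covariances do not overlap. -/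
lemma hasSum_bridgeCov (s t : ℝ) : Tendsto (fun N => ∑ n ∈ Finset.range N, (1 / 2 : ℝ) ^ n *
      ∑ k ∈ Finset.range (2 ^ n), tent (2 ^ n * s - k) * tent (2 ^ n * t - k)) atTop
    (𝓝 (bridgeCov s t)) := by
  have h1 : Tendsto (fun N : ℕ => (1 / 2 : ℝ) ^ N *
      ∑ k ∈ Finset.range (2 ^ N), bridgeCov (2 ^ N * s - k) (2 ^ N * t - k)) atTop (𝓝 0) := by
    refine squeeze_zero (fun N => by
      have := fun k => bridgeCov_nonneg (2 ^ N * s - (k : ℕ)) (2 ^ N * t - k)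
      exact mul_nonneg (by positivity) (Finset.sum_nonneg fun k _ => this k)) (fun N => ?_)
      (tendsto_pow_atTop_nhds_zero_of_lt_one (r := (1 / 2 : ℝ)) (by norm_num) (by norm_num))
    exact mul_le_of_le_one_right (by positivity) (sum_bridgeCov_le_one _ _ _)
  have h2 := (tendsto_const_nhds (x := bridgeCov s t)).sub h1
  rw [sub_zero] at h2
  refine h2.congr fun N => ?_
  rw [bridgeCov_eq_sum N s t]
  ring

/-- The terms of the Lévy–Ciesielski series with coefficients `c`. -/
noncomputable def schauderTerm (c : ℕ × ℕ → ℝ) (n : ℕ) (u : ℝ) : ℝ :=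
  (√2)⁻¹ ^ n * ∑ k ∈ Finset.range (2 ^ n), c (n, k) * tent (2 ^ n * u - k)

lemma continuous_schauderTerm (c : ℕ × ℕ → ℝ) (n : ℕ) : Continuous (schauderTerm c n) := by
  have := continuous_tent
  unfold schauderTerm
  fun_prop

/-- The tents of one level have disjoint interiors, so a bound for each scaled coefficient bounds
the whole level uniformly in u. -/
lemma abs_schauderTerm_le {c : ℕ × ℕ → ℝ} {n : ℕ} {D : ℝ}
    (h : ∀ k < 2 ^ n, |c (n, k)| * (√2)⁻¹ ^ n ≤ D) (u : ℝ) : |schauderTerm c n u| ≤ D := by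
  have hD : 0 ≤ D := le_trans (by positivity) (h 0 (by positivity))
  rw [schauderTerm, Finset.mul_sum]
  calc |∑ k ∈ Finset.range (2 ^ n), (√2)⁻¹ ^ n * (c (n, k) * tent (2 ^ n * u - k))|
      ≤ ∑ k ∈ Finset.range (2 ^ n), |(√2)⁻¹ ^ n * (c (n, k) * tent (2 ^ n * u - k))| :=
        Finset.abs_sum_le_sum_abs _ _
    _ ≤ ∑ k ∈ Finset.range (2 ^ n), D * tent (2 ^ n * u - k) := by
        refine Finset.sum_le_sum fun k hk => ?_
        rw [abs_mul, abs_mul, abs_of_nonneg (tent_nonneg _),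
          abs_of_nonneg (by positivity : (0 : ℝ) ≤ (√2)⁻¹ ^ n), ← mul_assoc, mul_comm (_ ^ n)]
        exact mul_le_mul_of_nonneg_right (h k (Finset.mem_range.1 hk)) (tent_nonneg _)
    _ ≤ D * 1 := by
        rw [← Finset.mul_sum]
        exact mul_le_mul_of_nonneg_left (sum_shift_le_one tent_le_one (fun _ => tent_eq_zero) _ _)
          hD
    _ = D := mul_one D

lemma summable_geometric_aux (D : ℝ) : Summable fun n : ℕ => D * (9 / 10 : ℝ) ^ n :=
  (summable_geometric_of_lt_one (by norm_num) (by norm_num)).mul_left D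

end Schauder

/-! ### Mean-square convergence of a series with geometrically decaying terms. -/

section Series

variable {Ω : Type*} [MeasurableSpace Ω] {P : Measure Ω}

lemma eLpNorm_two_le_of_integral_sq_le {f : Ω → ℝ} (hf : MemLp f 2 P) {c : ℝ} (hc : 0 ≤ c)
    (h : ∫ ω, f ω * f ω ∂P ≤ c ^ 2) : eLpNorm f 2 P ≤ ENNReal.ofReal c := by
  rw [hf.eLpNorm_eq_integral_rpow_norm (by norm_num) (by norm_num)]
  refine ENNReal.ofReal_le_ofReal ?_
  have : ∀ ω, ‖f ω‖ ^ (2 : ℝ≥0∞).toReal = f ω * f ω := by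
    intro ω
    simp [← pow_two]
  simp_rw [this]
  rw [ENNReal.toReal_ofNat, ← one_div, ← Real.sqrt_eq_rpow]
  exact Real.sqrt_le_left hc |>.2 h 

/-- Blocks of terms are bounded in L² by geometric tails, and lower semicontinuity of the norm
passes the bound to the almost sure limit. -/
lemma tendstoL2_of_series {Y : ℕ → Ω → ℝ} {Z : Ω → ℝ} {r : ℝ} (hr0 : 0 ≤ r) (hr : r < 1)
    (hY : ∀ n, MemLp (Y n) 2 P) (hb : ∀ n, eLpNorm (Y n) 2 P ≤ ENNReal.ofReal (r ^ n))
    (hZm : AEStronglyMeasurable Z P)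
    (hZ : ∀ᵐ ω ∂P, Tendsto (fun N => ∑ n ∈ Finset.range N, Y n ω) atTop (𝓝 (Z ω))) :
    TendstoL2 (fun N ω => ∑ n ∈ Finset.range N, Y n ω) Z P := by
  have hS : ∀ N, MemLp (fun ω => ∑ n ∈ Finset.range N, Y n ω) 2 P :=
    fun N => memLp_finsetSum _ fun n _ => hY n
  have key : ∀ N, eLpNorm (fun ω => ∑ n ∈ Finset.range N, Y n ω - Z ω) 2 P
      ≤ ENNReal.ofReal (r ^ N * (1 - r)⁻¹) := by
    intro N
    refine Lp.eLpNorm_le_of_ae_tendsto (u := atTop) (f := fun M ω =>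
      ∑ n ∈ Finset.range N, Y n ω - ∑ n ∈ Finset.range M, Y n ω) ?_
      (fun M => ((hS N).sub (hS M)).1) ?_
    · filter_upwards [eventually_ge_atTop N] with M hM
      have h1 : (fun ω => ∑ n ∈ Finset.range N, Y n ω - ∑ n ∈ Finset.range M, Y n ω)
          = -∑ n ∈ Finset.Ico N M, Y n := by
        ext ω
        rw [Pi.neg_apply, Finset.sum_apply, Finset.sum_Ico_eq_sub _ hM]
        ring
      rw [h1, eLpNorm_neg]
      refine (eLpNorm_sum_le (fun n _ => (hY n).1) (by norm_num)).trans ?_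
      refine (Finset.sum_le_sum fun n _ => hb n).trans ?_
      rw [← ENNReal.ofReal_sum_of_nonneg fun n _ => by positivity]
      refine ENNReal.ofReal_le_ofReal ?_
      rw [Finset.sum_Ico_eq_sum_range]
      simp_rw [pow_add, ← Finset.mul_sum]
      refine mul_le_mul_of_nonneg_left ?_ (by positivity)
      rw [← tsum_geometric_of_lt_one hr0 hr]
      exact (summable_geometric_of_lt_one hr0 hr).sum_le_tsum _ fun _ _ => by positivity
    · filter_upwards [hZ] with ω hω using tendsto_const_nhds.sub hω
  have hZL : MemLp Z 2 P := by
    have h0 := key 0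
    simp only [Finset.range_zero, Finset.sum_empty, zero_sub] at h0
    have : MemLp (-Z) 2 P := ⟨hZm.neg, h0.trans_lt ENNReal.ofReal_lt_top⟩
    exact memLp_neg_iff.1 this
  refine ⟨hS, hZL, ?_⟩
  refine tendsto_of_tendsto_of_tendsto_of_le_of_le tendsto_const_nhds ?_ (fun _ => zero_le) key
  have h1 : Tendsto (fun N : ℕ => r ^ N * (1 - r)⁻¹) atTop (𝓝 0) := by
    simpa using (tendsto_pow_atTop_nhds_zero_of_lt_one hr0 hr).mul_const (1 - r)⁻¹
  simpa using ENNReal.tendsto_ofReal h1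

end Series

/-! ### The Lévy–Ciesielski series with independent normal coefficients: moments and convergence. -/

section Brownian

variable {Ω : Type*} [MeasurableSpace Ω] {P : Measure Ω}
  {ξ : ℕ × ℕ → Ω → ℝ}

lemma memLp_two_of_hasLaw {X : Ω → ℝ} {m : ℝ} {v : ℝ≥0} (h : HasLaw X (gaussianReal m v) P) :
    MemLp X 2 P := h.hasGaussianLaw.memLp_two

lemma integral_of_hasLaw {X : Ω → ℝ} {m : ℝ} {v : ℝ≥0} (h : HasLaw X (gaussianReal m v) P) :
    ∫ ω, X ω ∂P = m := by
  rw [h.integral_eq, integral_id_gaussianReal]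

lemma covariance_iid {ι : Type*} [DecidableEq ι] {ξ : ι → Ω → ℝ}
    (hlaw : ∀ i, HasLaw (ξ i) (gaussianReal 0 1) P) (hind : iIndepFun ξ P) (i j : ι) :
    cov[ξ i, ξ j; P] = if i = j then 1 else 0 := by
  split_ifs with h
  · subst h
    rw [covariance_self (hlaw i).aemeasurable, (hlaw i).variance_eq, variance_id_gaussianReal]
    simp
  · exact (hind.indepFun h).covariance_eq_zero (memLp_two_of_hasLaw (hlaw i))
      (memLp_two_of_hasLaw (hlaw j))

lemma covariance_sum_iid {ι κ : Type*} [IsProbabilityMeasure P] [DecidableEq ι] {ξ : ι → Ω → ℝ}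
    (hlaw : ∀ i, HasLaw (ξ i) (gaussianReal 0 1) P) (hind : iIndepFun ξ P) {e : κ → ι}
    (he : Function.Injective e) (J : Finset κ) (f g : κ → ℝ) :
    cov[fun ω => ∑ x ∈ J, f x * ξ (e x) ω, fun ω => ∑ x ∈ J, g x * ξ (e x) ω; P]
      = ∑ x ∈ J, f x * g x := by
  classical
  have hL := fun i => memLp_two_of_hasLaw (hlaw i)
  rw [covariance_fun_sum_fun_sum' (fun x _ => (hL (e x)).const_mul _)
    (fun x _ => (hL (e x)).const_mul _)]
  refine Finset.sum_congr rfl fun x hx => ?_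
  simp_rw [covariance_const_mul_left, covariance_const_mul_right, covariance_iid hlaw hind,
    he.eq_iff]
  simp [hx]

lemma isGaussianProcess_iid {ι : Type*} {ξ : ι → Ω → ℝ}
    (hlaw : ∀ i, HasLaw (ξ i) (gaussianReal 0 1) P) (hind : iIndepFun ξ P) :
    IsGaussianProcess ξ P where
  hasGaussianLaw I := (hind.precomp (g := fun i : I => (i : ι))
    Subtype.val_injective).hasGaussianLaw fun i => (hlaw i).hasGaussianLaw

lemma schauder_partial_sum_eq (c : ℕ × ℕ → ℝ) (s : Finset ℕ) (u : ℝ) :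
    ∑ n ∈ s, schauderTerm c n u = ∑ x ∈ s.sigma fun n => Finset.range (2 ^ n),
      ((√2)⁻¹ ^ x.1 * tent (2 ^ x.1 * u - x.2)) * c (x.1, x.2) := by
  rw [Finset.sum_sigma]
  refine Finset.sum_congr rfl fun n _ => ?_
  rw [schauderTerm, Finset.mul_sum]
  exact Finset.sum_congr rfl fun k _ => by ring

lemma injective_sigma_prod : Function.Injective fun x : (_ : ℕ) × ℕ => (x.1, x.2) := by
  rintro ⟨a, b⟩ ⟨c, d⟩ h
  simpa using h

lemma memLp_schauder (hlaw : ∀ i, HasLaw (ξ i) (gaussianReal 0 1) P) (s : Finset ℕ) (u : ℝ) :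
    MemLp (fun ω => ∑ n ∈ s, schauderTerm (fun p => ξ p ω) n u) 2 P := by
  simp_rw [schauder_partial_sum_eq]
  exact memLp_finsetSum _ fun x _ => (memLp_two_of_hasLaw (hlaw _)).const_mul _

lemma integral_schauder [IsProbabilityMeasure P]
    (hlaw : ∀ i, HasLaw (ξ i) (gaussianReal 0 1) P) (s : Finset ℕ) (u : ℝ) :
    ∫ ω, ∑ n ∈ s, schauderTerm (fun p => ξ p ω) n u ∂P = 0 := by
  simp_rw [schauder_partial_sum_eq]
  rw [integral_finsetSum _ fun x _ =>
    ((memLp_two_of_hasLaw (hlaw _)).integrable (by norm_num)).const_mul _]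
  simp [integral_const_mul, fun i => integral_of_hasLaw (hlaw i)]

lemma covariance_schauder [IsProbabilityMeasure P]
    (hlaw : ∀ i, HasLaw (ξ i) (gaussianReal 0 1) P) (hind : iIndepFun ξ P)
    (s : Finset ℕ) (u v : ℝ) :
    cov[fun ω => ∑ n ∈ s, schauderTerm (fun p => ξ p ω) n u,
      fun ω => ∑ n ∈ s, schauderTerm (fun p => ξ p ω) n v; P] =
    ∑ n ∈ s, (1 / 2 : ℝ) ^ n *
      ∑ k ∈ Finset.range (2 ^ n), tent (2 ^ n * u - k) * tent (2 ^ n * v - k) := by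
  simp_rw [schauder_partial_sum_eq]
  rw [covariance_sum_iid hlaw hind injective_sigma_prod, Finset.sum_sigma]
  refine Finset.sum_congr rfl fun n _ => ?_
  rw [Finset.mul_sum]
  refine Finset.sum_congr rfl fun k _ => ?_
  have h2 : ((√2)⁻¹ : ℝ) ^ n * (√2)⁻¹ ^ n = (1 / 2) ^ n := by
    rw [← mul_pow, ← mul_inv, Real.mul_self_sqrt (by norm_num), one_div]
  simp only
  rw [← h2]; ring

/-- The term is centred, so its second moment is 2^(-n) times a sum of squared tents, which is at
most 1. -/
lemma eLpNorm_schauderTerm_le [IsProbabilityMeasure P]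
    (hlaw : ∀ i, HasLaw (ξ i) (gaussianReal 0 1) P)
    (hind : iIndepFun ξ P) (n : ℕ) (u : ℝ) :
    eLpNorm (fun ω => schauderTerm (fun p => ξ p ω) n u) 2 P ≤ ENNReal.ofReal ((√2)⁻¹ ^ n) := by
  have hm := memLp_schauder hlaw {n} u
  have hi := integral_schauder hlaw {n} u
  have hc := covariance_schauder hlaw hind {n} u u
  rw [covariance_eq_sub hm hm, hi] at hc
  simp only [Finset.sum_singleton] at hm hc
  refine eLpNorm_two_le_of_integral_sq_le hm (by positivity) ?_
  have h2 : ((√2)⁻¹ ^ n : ℝ) ^ 2 = (1 / 2) ^ n := by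
    rw [pow_right_comm, inv_pow, Real.sq_sqrt (by norm_num), one_div]
  simp only [mul_zero, sub_zero, Pi.mul_apply] at hc
  rw [h2, hc]
  refine mul_le_of_le_one_right (by positivity) ?_
  refine sum_shift_le_one (f := fun v => tent v * tent v) (fun v => ?_) (fun v hv => ?_) _ _
  · exact mul_le_one₀ (tent_le_one v) (tent_nonneg v) (tent_le_one v)
  · simp [tent_eq_zero hv]

/-- The set of coefficients for which the Lévy–Ciesielski series converges uniformly. -/
def schauderGood : Set (ℕ × ℕ → ℝ) :=
  {c | ∑' n : ℕ, ∑ k ∈ Finset.range (2 ^ n),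
    ENNReal.ofReal ((c (n, k) * (√2)⁻¹ ^ n / (9 / 10) ^ n) ^ 4) ≠ ∞}

lemma measurableSet_schauderGood : MeasurableSet schauderGood := by
  refine (MeasurableSet.singleton (∞ : ℝ≥0∞)).compl.preimage ?_
  refine Measurable.tsum fun n => Finset.measurable_sum _ fun k _ => ?_
  fun_prop

lemma exists_bound_of_mem_schauderGood {c : ℕ × ℕ → ℝ} (hc : c ∈ schauderGood) :
    ∃ D : ℝ, ∀ n, ∀ k < 2 ^ n, |c (n, k)| * (√2)⁻¹ ^ n ≤ D * (9 / 10) ^ n := by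
  set Z := ∑' n : ℕ, ∑ k ∈ Finset.range (2 ^ n),
    ENNReal.ofReal ((c (n, k) * (√2)⁻¹ ^ n / (9 / 10) ^ n) ^ 4) with hZ
  refine ⟨1 + Z.toReal, fun n k hk => ?_⟩
  have h1 : ENNReal.ofReal ((c (n, k) * (√2)⁻¹ ^ n / (9 / 10) ^ n) ^ 4) ≤ Z :=
    (Finset.single_le_sum (f := fun k => ENNReal.ofReal
      ((c (n, k) * (√2)⁻¹ ^ n / (9 / 10) ^ n) ^ 4)) (fun _ _ => zero_le)
      (Finset.mem_range.2 hk)).trans (ENNReal.le_tsum n)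
  rw [ENNReal.ofReal_le_iff_le_toReal hc] at h1
  rw [← div_le_iff₀ (by positivity)]
  set y := |c (n, k)| * (√2)⁻¹ ^ n / (9 / 10) ^ n with hy
  have hy0 : 0 ≤ y := by positivity
  have h2 : y ^ 4 ≤ Z.toReal := by
    refine le_trans (le_of_eq ?_) h1
    have hy' : y = |c (n, k) * (√2)⁻¹ ^ n / (9 / 10) ^ n| := by
      rw [abs_div, abs_mul, abs_of_nonneg (by positivity : (0 : ℝ) ≤ (√2)⁻¹ ^ n),
        abs_of_nonneg (by positivity : (0 : ℝ) ≤ (9 / 10) ^ n)]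
    rw [hy']
    exact Even.pow_abs (by decide) _
  -- This is y ≤ 1 + y^4, which replaces a fourth root.
  nlinarith [sq_nonneg (y ^ 2 - 1), sq_nonneg (y - 1), sq_nonneg y]

/-- The defining sum has finite expectation: level n contributes 2^n fourth moments, each with
factor (1/4)^n (9/10)^(-4n), for a ratio (1/2)/(9/10)^4 < 1. Second moments would not do, since the
factors 2^n and 2^(-n) cancel; 9/10 is a rate that is summable yet slow enough for this ratio. -/
lemma ae_mem_schauderGood (hmeas : ∀ i, Measurable (ξ i))
    (hlaw : ∀ i, HasLaw (ξ i) (gaussianReal 0 1) P) :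
    ∀ᵐ ω ∂P, (fun p => ξ p ω) ∈ schauderGood := by
  set M : ℝ≥0∞ := ∫⁻ x, ENNReal.ofReal (x ^ 4) ∂(gaussianReal 0 1) with hM
  have hMfin : M ≠ ∞ := by
    have := memLp_id_gaussianReal' (μ := 0) (v := 1) 4 (by norm_num)
    have h1 := (this.integrable_norm_pow (p := 4) (by norm_num))
    have h2 : Integrable (fun x : ℝ => x ^ 4) (gaussianReal 0 1) := by
      refine h1.congr (ae_of_all _ fun x => ?_)
      simp only [id, Real.norm_eq_abs]
      exact Even.pow_abs (by decide) _
    exact h2.lintegral_lt_top.ne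
  refine (ae_lt_top ?_ ?_).mono fun ω hω => hω.ne
  · refine Measurable.tsum fun n => Finset.measurable_sum _ fun k _ => ?_
    have := hmeas
    fun_prop
  rw [lintegral_tsum fun n => by have := hmeas; fun_prop]
  have h1 : ∀ n : ℕ, ∫⁻ ω, ∑ k ∈ Finset.range (2 ^ n),
      ENNReal.ofReal ((ξ (n, k) ω * (√2)⁻¹ ^ n / (9 / 10) ^ n) ^ 4) ∂P
      = ENNReal.ofReal ((1 / 2 / (9 / 10) ^ 4) ^ n) * M := by
    intro n
    rw [lintegral_finsetSum _ fun k _ => by have := hmeas; fun_prop]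
    have h2 : ∀ k, ∫⁻ ω, ENNReal.ofReal ((ξ (n, k) ω * (√2)⁻¹ ^ n / (9 / 10) ^ n) ^ 4) ∂P
        = ENNReal.ofReal ((1 / 4 / (9 / 10) ^ 4) ^ n) * M := by
      intro k
      have h3 : ∀ x : ℝ, ENNReal.ofReal ((x * (√2)⁻¹ ^ n / (9 / 10) ^ n) ^ 4)
          = ENNReal.ofReal ((1 / 4 / (9 / 10) ^ 4) ^ n) * ENNReal.ofReal (x ^ 4) := by
        intro x
        rw [← ENNReal.ofReal_mul (by positivity)]
        congr 1
        have h4 : ((√2)⁻¹ : ℝ) ^ 4 = 1 / 4 := by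
          rw [inv_pow, show (√2 : ℝ) ^ 4 = (√2 ^ 2) ^ 2 by ring, Real.sq_sqrt (by norm_num)]
          norm_num
        rw [mul_div_assoc, mul_pow, div_pow, pow_right_comm, h4, pow_right_comm (9 / 10 : ℝ),
          ← div_pow, mul_comm]
      simp_rw [h3]
      rw [lintegral_const_mul' _ _ ENNReal.ofReal_ne_top, hM, ← (hlaw (n, k)).map_eq,
        lintegral_map (by fun_prop) (hmeas _)]
    simp_rw [h2]
    rw [Finset.sum_const, Finset.card_range, nsmul_eq_mul, ← mul_assoc]
    congr 1
    rw [← ENNReal.ofReal_natCast, ← ENNReal.ofReal_mul (by positivity)]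
    congr 1
    push_cast
    rw [← mul_pow]
    congr 1
    norm_num
  simp_rw [h1]
  rw [ENNReal.tsum_mul_right, ← ENNReal.ofReal_tsum_of_nonneg (fun n => by positivity)
    (summable_geometric_of_lt_one (by norm_num) (by norm_num))]
  exact ENNReal.mul_ne_top ENNReal.ofReal_ne_top hMfin

end Brownian

/-! ### Brownian motion from the series. -/

section Brownian

/-- The sum of the Lévy–Ciesielski series, where it converges uniformly. -/
noncomputable def schauderSum (c : ℕ × ℕ → ℝ) (u : ℝ) : ℝ :=
  open scoped Classical in if c ∈ schauderGood then ∑' n, schauderTerm c n u else 0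

lemma summable_schauder {c : ℕ × ℕ → ℝ} (hc : c ∈ schauderGood) (u : ℝ) :
    Summable fun n => schauderTerm c n u := by
  obtain ⟨D, hD⟩ := exists_bound_of_mem_schauderGood hc
  exact Summable.of_norm_bounded (summable_geometric_aux D) fun n => abs_schauderTerm_le (hD n) u

/-- The default value 0 off the convergence set makes every path continuous, not just almost every
one. -/
lemma continuous_schauderSum (c : ℕ × ℕ → ℝ) : Continuous (schauderSum c) := by
  by_cases hc : c ∈ schauderGood
  · obtain ⟨D, hD⟩ := exists_bound_of_mem_schauderGood hc
    have : schauderSum c = fun u => ∑' n, schauderTerm c n u := by ext u; simp [schauderSum, hc]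
    rw [this]
    exact continuous_tsum (continuous_schauderTerm c) (summable_geometric_aux D)
      fun n u => abs_schauderTerm_le (hD n) u
  · have : schauderSum c = fun _ => 0 := by ext u; simp [schauderSum, hc]
    rw [this]
    exact continuous_const

lemma measurable_schauderTerm (n : ℕ) (u : ℝ) :
    Measurable fun c : ℕ × ℕ → ℝ => schauderTerm c n u := by
  unfold schauderTerm
  fun_prop

lemma measurable_schauderSum (u : ℝ) : Measurable fun c : ℕ × ℕ → ℝ => schauderSum c u := by
  have h1 : Measurable fun c : ℕ × ℕ → ℝ =>
      schauderGood.indicator (fun c => ∑' n, schauderTerm c n u) c := by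
    have h2 : Measurable fun c : ℕ × ℕ → ℝ => ∑' n, schauderTerm c n u :=
      Measurable.tsum fun n => measurable_schauderTerm n u
    exact h2.indicator measurableSet_schauderGood
  convert h1 using 2 with c
  by_cases hc : c ∈ schauderGood <;> simp [schauderSum, hc]

variable {Ω : Type*} [MeasurableSpace Ω] {P : Measure Ω} [IsProbabilityMeasure P]
  {ξ : ℕ × ℕ → Ω → ℝ}

lemma tendstoL2_schauder (hmeas : ∀ i, Measurable (ξ i))
    (hlaw : ∀ i, HasLaw (ξ i) (gaussianReal 0 1) P) (hind : iIndepFun ξ P) (u : ℝ) :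
    TendstoL2 (fun N ω => ∑ n ∈ Finset.range N, schauderTerm (fun p => ξ p ω) n u)
      (fun ω => schauderSum (fun p => ξ p ω) u) P := by
  refine tendstoL2_of_series (r := (√2)⁻¹) (by positivity) ?_ (fun n => ?_)
    (fun n => eLpNorm_schauderTerm_le hlaw hind n u) ?_ ?_
  · exact inv_lt_one_of_one_lt₀ (Real.lt_sqrt_of_sq_lt (by norm_num))
  · simpa using memLp_schauder hlaw {n} u
  · exact ((measurable_schauderSum u).comp (measurable_pi_lambda _ hmeas)).aestronglyMeasurable
  · filter_upwards [ae_mem_schauderGood hmeas hlaw] with ω hω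
    have := (summable_schauder hω u).hasSum.tendsto_sum_nat
    simpa [schauderSum, hω] using this

/-- The series gives a bridge b on [0,1]; then (1+t) b(t/(1+t)) is a Brownian motion on [0,∞).
Indeed for s ≤ t the covariance (1+s)(1+t) · s/(1+s) · (1 - t/(1+t)) equals s. -/
theorem exists_brownian : ∃ (Ω : Type) (_ : MeasurableSpace Ω) (P : Measure Ω)
    (B : ℝ≥0 → Ω → ℝ), IsProbabilityMeasure P ∧ (∀ t, Measurable (B t)) ∧
      (∀ ω, Continuous fun t => B t ω) ∧ IsBrownianReal B P := by
  obtain ⟨Ω, mΩ, P, ξ, hmeas, hlaw, hind, hP⟩ := exists_iid (ℕ × ℕ) (gaussianReal 0 1)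
  let τ : ℝ≥0 → ℝ := fun t => t / (1 + t)
  have hτ : ∀ t, τ t ∈ Set.Icc (0 : ℝ) 1 := fun t =>
    ⟨by positivity, div_le_one_of_le₀ (by linarith) (by positivity)⟩
  let B : ℝ≥0 → Ω → ℝ := fun t ω => (1 + (t : ℝ)) * schauderSum (fun p => ξ p ω) (τ t)
  have hlim := fun t => (tendstoL2_schauder hmeas hlaw hind (τ t)).const_mul (1 + (t : ℝ))
  have hlim0 := fun t => tendstoL2_schauder hmeas hlaw hind (τ t)
  have hcont : ∀ ω, Continuous fun t => B t ω := by
    intro ω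
    have h1 := continuous_schauderSum fun p => ξ p ω
    have h2 : Continuous τ := by
      refine Continuous.div (by fun_prop) (by fun_prop) fun t => ?_
      have : (0 : ℝ) ≤ t := t.2
      positivity
    fun_prop
  have hgauss : IsGaussianProcess B P := by
    refine isGaussianProcess_of_tendstoL2 (fun N => ?_) hlim
    have hξ := isGaussianProcess_iid hlaw hind
    refine hξ.of_isGaussianProcess fun t => ?_
    let J : Finset ((_ : ℕ) × ℕ) := (Finset.range N).sigma fun n => Finset.range (2 ^ n)
    refine ⟨J.image fun x => (x.1, x.2), ∑ x : J, ((1 + (t : ℝ)) *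
      ((√2)⁻¹ ^ x.1.1 * tent (2 ^ x.1.1 * τ t - x.1.2))) • ContinuousLinearMap.proj (R := ℝ)
        (φ := fun _ : (J.image fun x => (x.1, x.2) : Finset (ℕ × ℕ)) => ℝ)
        ⟨(x.1.1, x.1.2), Finset.mem_image_of_mem _ x.2⟩, fun ω => ?_⟩
    rw [schauder_partial_sum_eq, Finset.mul_sum, _root_.sum_apply,
      ← Finset.sum_coe_sort]
    refine Finset.sum_congr rfl fun x _ => ?_
    simp [mul_assoc]
  have hmean : ∀ t, P[B t] = 0 := by
    intro t
    have h1 := (hlim0 t).tendsto_integral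
    simp_rw [integral_schauder hlaw] at h1
    have h2 : ∫ ω, schauderSum (fun p => ξ p ω) (τ t) ∂P = 0 :=
      tendsto_nhds_unique h1 tendsto_const_nhds
    simp only [B]
    rw [integral_const_mul, h2, mul_zero]
  have hcov : ∀ s t, s ≤ t → cov[B s, B t; P] = s := by
    intro s t hst
    have h1 := (hlim0 s).tendsto_covariance (hlim0 t)
    simp_rw [covariance_schauder hlaw hind] at h1
    have h2 := tendsto_nhds_unique h1 (hasSum_bridgeCov (τ s) (τ t))
    simp only [B]
    rw [covariance_const_mul_left, covariance_const_mul_right, h2, bridgeCov_of_mem (hτ s) (hτ t)]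
    have hs : (0 : ℝ) < 1 + s := by positivity
    have ht : (0 : ℝ) < 1 + t := by positivity
    have hst' : (s : ℝ) ≤ t := by exact_mod_cast hst
    have h3 : τ s ≤ τ t := by
      simp only [τ]
      rw [div_le_div_iff₀ hs ht]
      nlinarith
    rw [min_eq_left h3]
    simp only [τ]
    field_simp
    ring
  refine ⟨Ω, mΩ, P, B, hP, fun t => ?_, hcont, ?_⟩
  · exact ((measurable_schauderSum (τ t)).comp (measurable_pi_lambda _ hmeas)).const_mul _
  · have h := hgauss.isPreBrownianReal_of_covariance hmean hcov
    exact { toIsPreBrownianReal := h, cont := ae_of_all _ hcont }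

end Brownian

/-! ### Riemann sums of continuous functions. -/

section RiemannSum

lemma abs_integral_sub_sum_le {g : ℝ → ℝ} (hg : Continuous g) {t : ℕ → ℝ} (ht : Monotone t)
    {ε : ℝ} (N : ℕ) (h : ∀ i < N, ∀ s ∈ Set.Icc (t i) (t (i + 1)), |g s - g (t i)| ≤ ε) :
    |(∫ s in t 0..t N, g s) - ∑ i ∈ Finset.range N, (t (i + 1) - t i) * g (t i)|
      ≤ ε * (t N - t 0) := by
  rw [← intervalIntegral.sum_integral_adjacent_intervals fun i _ => hg.intervalIntegrable _ _,
    ← Finset.sum_sub_distrib]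
  refine (Finset.abs_sum_le_sum_abs _ _).trans ?_
  rw [← Finset.sum_range_sub, Finset.mul_sum]
  refine Finset.sum_le_sum fun i hi => ?_
  have hle := ht i.le_succ
  have h1 : (∫ s in t i..t (i + 1), g s) - (t (i + 1) - t i) * g (t i)
      = ∫ s in t i..t (i + 1), (g s - g (t i)) := by
    rw [intervalIntegral.integral_sub (hg.intervalIntegrable _ _)
      (intervalIntegrable_const), intervalIntegral.integral_const, smul_eq_mul]
  rw [h1, ← abs_of_nonneg (sub_nonneg.2 hle)]
  refine intervalIntegral.norm_integral_le_of_norm_le_const (E := ℝ) fun s hs => ?_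
  rw [Set.uIoc_of_le hle] at hs
  exact h i (Finset.mem_range.1 hi) s ⟨hs.1.le, hs.2⟩

/-- The `k`-th point of the partition of `[a, b]` into `M` intervals of equal length. -/
noncomputable def gridPoint (a b : ℝ) (M k : ℕ) : ℝ := a + k * ((b - a) / M)

lemma gridPoint_zero (a b : ℝ) (M : ℕ) : gridPoint a b M 0 = a := by simp [gridPoint]

lemma gridPoint_self (a b : ℝ) {M : ℕ} (hM : M ≠ 0) : gridPoint a b M M = b := by
  have : (M : ℝ) ≠ 0 := by exact_mod_cast hM
  rw [gridPoint]; field_simp; ring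

lemma gridPoint_succ_sub (a b : ℝ) (M k : ℕ) :
    gridPoint a b M (k + 1) - gridPoint a b M k = (b - a) / M := by
  simp only [gridPoint]; push_cast; ring

lemma monotone_gridPoint {a b : ℝ} (hab : a ≤ b) (M : ℕ) : Monotone (gridPoint a b M) := by
  refine monotone_nat_of_le_succ fun k => ?_
  rw [← sub_nonneg, gridPoint_succ_sub]
  exact div_nonneg (sub_nonneg.2 hab) (Nat.cast_nonneg _)

lemma gridPoint_mem {a b : ℝ} (hab : a ≤ b) {M k : ℕ} (hk : k ≤ M) :
    gridPoint a b M k ∈ Set.Icc a b := by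
  rcases eq_or_ne M 0 with rfl | hM
  · simp [gridPoint, hab]
  · exact ⟨(gridPoint_zero a b M).symm.le.trans (monotone_gridPoint hab M k.zero_le),
      (monotone_gridPoint hab M hk).trans (gridPoint_self a b hM).le⟩

lemma tendsto_riemannSum {g : ℝ → ℝ} (hg : Continuous g) {a b : ℝ} (hab : a ≤ b) :
    Tendsto (fun M : ℕ => ∑ k ∈ Finset.range M, (b - a) / M * g (gridPoint a b M k)) atTop
      (𝓝 (∫ s in a..b, g s)) := by
  rw [Metric.tendsto_atTop]
  intro ε hε
  have huc := isCompact_Icc.uniformContinuousOn_of_continuous (hg.continuousOn (s := Set.Icc a b))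
  rw [Metric.uniformContinuousOn_iff] at huc
  -- The added 1 allows a = b in the choice of ε / (b - a + 1).
  have hpos : 0 < b - a + 1 := by linarith
  obtain ⟨δ, hδ, huc⟩ := huc (ε / (b - a + 1)) (by positivity)
  obtain ⟨M₀, hM₀⟩ := exists_nat_gt ((b - a) / δ)
  refine ⟨M₀ + 1, fun M hM => ?_⟩
  have hM0 : M ≠ 0 := by omega
  have hMp : (0 : ℝ) < M := by positivity
  have hstep : (b - a) / M < δ := by
    rw [div_lt_iff₀ hδ] at hM₀
    rw [div_lt_iff₀ hMp]
    have : (M₀ : ℝ) ≤ M := by exact_mod_cast (by omega : M₀ ≤ M)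
    nlinarith
  have key := abs_integral_sub_sum_le hg (monotone_gridPoint hab M) (ε := ε / (b - a + 1)) M
    fun i hi s hs => by
      have h1 := gridPoint_mem hab (M := M) (k := i) hi.le
      have h2 := gridPoint_mem hab (M := M) (k := i + 1) hi
      have h3 := gridPoint_succ_sub a b M i
      refine (huc s ⟨h1.1.trans hs.1, hs.2.trans h2.2⟩ _ h1 ?_).le
      rw [Real.dist_eq, abs_of_nonneg (sub_nonneg.2 hs.1)]
      linarith [hs.2]
  rw [gridPoint_zero, gridPoint_self a b hM0] at key
  simp only [gridPoint_succ_sub] at key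
  rw [dist_comm, Real.dist_eq]
  refine key.trans_lt ?_
  rw [div_mul_eq_mul_div, div_lt_iff₀ hpos]
  nlinarith

end RiemannSum

/-! ### Integrals of smooth functions against a scalar Brownian path. -/

section WienerIntegral

variable {Ω : Type*} [MeasurableSpace Ω] {P : Measure Ω}

/-- A real process, indexed by real times, whose restriction to `[0, ∞)` is continuous and has the
mean and covariance of Brownian motion. -/
structure HasBrownianCovariance (β : ℝ → Ω → ℝ) (P : Measure Ω) : Prop where
  memLp : ∀ t, MemLp (β t) 2 P
  integral_eq : ∀ t, ∫ ω, β t ω ∂P = 0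
  covariance_eq : ∀ s t, 0 ≤ s → 0 ≤ t → cov[β s, β t; P] = min s t
  cont : ∀ᵐ ω ∂P, Continuous fun t => β t ω

/-- The integral `∫ₐᵇ φ dβ` of a continuously differentiable function, with derivative `φ'`, against
a continuous function, defined through integration by parts. -/
noncomputable def partsIntegral (φ φ' β : ℝ → ℝ) (a b : ℝ) : ℝ :=
  φ b * β b - φ a * β a - ∫ s in a..b, φ' s * β s

/-- An exact error formula: on one cell, summation by parts leaves (φ(t_{i+1}) - φ(t_i)) β(t_{i+1}),
which is the integral of φ' β(t_{i+1}). -/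
lemma partsIntegral_sub_sum {φ φ' β : ℝ → ℝ} (hφ : ∀ s, HasDerivAt φ (φ' s) s)
    (hφ' : Continuous φ') (hβ : Continuous β) (t : ℕ → ℝ) (N : ℕ) :
    partsIntegral φ φ' β (t 0) (t N) - ∑ i ∈ Finset.range N, φ (t i) * (β (t (i + 1)) - β (t i))
      = ∑ i ∈ Finset.range N, ∫ s in t i..t (i + 1), φ' s * (β (t (i + 1)) - β s) := by
  have hint : ∀ u v, IntervalIntegrable (fun s => φ' s * β s) volume u v :=
    fun u v => (hφ'.mul hβ).intervalIntegrable u v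
  rw [partsIntegral, ← Finset.sum_range_sub (fun i => φ (t i) * β (t i)),
    ← intervalIntegral.sum_integral_adjacent_intervals fun i _ => hint _ _,
    ← Finset.sum_sub_distrib, ← Finset.sum_sub_distrib]
  refine Finset.sum_congr rfl fun i _ => ?_
  simp_rw [mul_sub]
  have hint' : IntervalIntegrable (fun s => φ' s * β (t (i + 1))) volume (t i) (t (i + 1)) :=
    (hφ'.mul continuous_const).intervalIntegrable _ _
  rw [intervalIntegral.integral_sub hint' (hint _ _),
    intervalIntegral.integral_mul_const,
    intervalIntegral.integral_eq_sub_of_hasDerivAt (fun s _ => hφ s) (hφ'.intervalIntegrable _ _)]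
  ring

namespace HasBrownianCovariance

variable {β : ℝ → Ω → ℝ}

lemma memLp_sub (hβ : HasBrownianCovariance β P) (u v : ℝ) :
    MemLp (fun ω => β v ω - β u ω) 2 P := (hβ.memLp v).sub (hβ.memLp u)

lemma covariance_sub_sub [IsProbabilityMeasure P] (hβ : HasBrownianCovariance β P)
    {u v u' v' : ℝ} (hu : 0 ≤ u) (hv : 0 ≤ v) (hu' : 0 ≤ u') (hv' : 0 ≤ v') :
    cov[fun ω => β v ω - β u ω, fun ω => β v' ω - β u' ω; P]
      = min v v' - min v u' - (min u v' - min u u') := by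
  have h1 := hβ.memLp
  rw [covariance_fun_sub_left (h1 v) (h1 u) (hβ.memLp_sub u' v'),
    covariance_fun_sub_right (h1 v) (h1 v') (h1 u'),
    covariance_fun_sub_right (h1 u) (h1 v') (h1 u'),
    hβ.covariance_eq _ _ hv hv', hβ.covariance_eq _ _ hv hu', hβ.covariance_eq _ _ hu hv',
    hβ.covariance_eq _ _ hu hu']

lemma eLpNorm_sub_le [IsProbabilityMeasure P] (hβ : HasBrownianCovariance β P)
    {u v : ℝ} (hu : 0 ≤ u) (huv : u ≤ v) :
    eLpNorm (fun ω => β v ω - β u ω) 2 P ≤ ENNReal.ofReal (√(v - u)) := by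
  have h1 := hβ.memLp
  refine eLpNorm_two_le_of_integral_sq_le (hβ.memLp_sub u v) (by positivity) ?_
  have h2 := hβ.covariance_sub_sub hu (hu.trans huv) hu (hu.trans huv)
  rw [covariance_eq_sub (hβ.memLp_sub u v) (hβ.memLp_sub u v), integral_sub
    ((h1 v).integrable (by norm_num)) ((h1 u).integrable (by norm_num)), hβ.integral_eq,
    hβ.integral_eq] at h2
  rw [Real.sq_sqrt (by linarith)]
  simp only [Pi.mul_apply, min_self, min_eq_right huv, min_eq_left huv] at h2
  linarith

lemma covariance_sum_sum [IsProbabilityMeasure P] (hβ : HasBrownianCovariance β P)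
    {t : ℕ → ℝ} (ht : Monotone t) (h0 : 0 ≤ t 0) (c d : ℕ → ℝ) (N : ℕ) :
    cov[fun ω => ∑ i ∈ Finset.range N, c i * (β (t (i + 1)) ω - β (t i) ω),
      fun ω => ∑ i ∈ Finset.range N, d i * (β (t (i + 1)) ω - β (t i) ω); P]
      = ∑ i ∈ Finset.range N, (t (i + 1) - t i) * (c i * d i) := by
  have hL : ∀ i, MemLp (fun ω => β (t (i + 1)) ω - β (t i) ω) 2 P :=
    fun i => (hβ.memLp _).sub (hβ.memLp _)
  rw [covariance_fun_sum_fun_sum' (fun i _ => (hL i).const_mul _)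
    (fun i _ => (hL i).const_mul _)]
  have hn : ∀ i, 0 ≤ t i := fun i => h0.trans (ht i.zero_le)
  refine Finset.sum_congr rfl fun i hi => ?_
  rw [Finset.sum_eq_single i]
  · rw [covariance_const_mul_left, covariance_const_mul_right,
      hβ.covariance_sub_sub (hn _) (hn _) (hn _) (hn _)]
    have := ht i.le_succ
    simp only [min_self, min_eq_right this, min_eq_left this]
    ring
  · intro j _ hj
    rw [covariance_const_mul_left, covariance_const_mul_right,
      hβ.covariance_sub_sub (hn _) (hn _) (hn _) (hn _)]
    rcases lt_or_gt_of_ne hj with h | h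
    · have h1 := ht h
      have h2 := ht i.le_succ
      have h3 := ht j.le_succ
      simp only [Nat.succ_eq_add_one] at h1 h2 h3
      rw [min_eq_right (h1.trans h2), min_eq_right (by linarith), min_eq_right (by linarith),
        min_eq_right (by linarith)]
      ring
    · have h1 := ht h
      have h2 := ht i.le_succ
      have h3 := ht j.le_succ
      simp only [Nat.succ_eq_add_one] at h1 h2 h3
      rw [min_eq_left (by linarith), min_eq_left (by linarith), min_eq_left (by linarith),
        min_eq_left (by linarith)]
      ring
  · exact fun h => absurd hi h

/-- Minkowski's inequality for integrals, obtained from Riemann sums: the bound holds for each sum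
and survives the almost sure limit. Measurability of the integral in ω comes from the same limit. -/
lemma eLpNorm_integral_le [IsProbabilityMeasure P] (hβ : HasBrownianCovariance β P)
    {ψ : ℝ → ℝ} (hψ : Continuous ψ) {u v C : ℝ} (hu : 0 ≤ u) (huv : u ≤ v)
    (hC : ∀ s ∈ Set.Icc u v, |ψ s| ≤ C) :
    MemLp (fun ω => ∫ s in u..v, ψ s * (β v ω - β s ω)) 2 P ∧
    eLpNorm (fun ω => ∫ s in u..v, ψ s * (β v ω - β s ω)) 2 P
      ≤ ENNReal.ofReal (C * (v - u) * √(v - u)) := by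
  have hL : ∀ s, MemLp (fun ω => β v ω - β s ω) 2 P := fun s => (hβ.memLp v).sub (hβ.memLp s)
  have hC0 : 0 ≤ C := (abs_nonneg _).trans (hC u ⟨le_rfl, huv⟩)
  have hmeas : ∀ M : ℕ, MemLp (fun ω => ∑ k ∈ Finset.range M, (v - u) / M *
      (ψ (gridPoint u v M k) * (β v ω - β (gridPoint u v M k) ω))) 2 P :=
    fun M => memLp_finsetSum _ fun k _ => ((hL _).const_mul _).const_mul _
  have hlim : ∀ᵐ ω ∂P, Tendsto (fun M : ℕ => ∑ k ∈ Finset.range M, (v - u) / M *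
      (ψ (gridPoint u v M k) * (β v ω - β (gridPoint u v M k) ω))) atTop
      (𝓝 (∫ s in u..v, ψ s * (β v ω - β s ω))) := by
    filter_upwards [hβ.cont] with ω hω
    exact tendsto_riemannSum (g := fun s => ψ s * (β v ω - β s ω)) (by fun_prop) huv
  have hb : eLpNorm (fun ω => ∫ s in u..v, ψ s * (β v ω - β s ω)) 2 P
      ≤ ENNReal.ofReal (C * (v - u) * √(v - u)) := by
    refine Lp.eLpNorm_le_of_ae_tendsto (u := atTop) ?_ (fun M => (hmeas M).1) hlim
    filter_upwards [eventually_gt_atTop 0] with M hM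
    have hM' : (0 : ℝ) < M := by exact_mod_cast hM
    have e1 : (fun ω => ∑ k ∈ Finset.range M, (v - u) / M *
        (ψ (gridPoint u v M k) * (β v ω - β (gridPoint u v M k) ω)))
        = ∑ k ∈ Finset.range M, ((v - u) / M * ψ (gridPoint u v M k)) •
          fun ω => (β v ω - β (gridPoint u v M k) ω) := by
      ext ω
      simp [Finset.sum_apply, mul_assoc]
    rw [e1]
    refine (eLpNorm_sum_le (fun k _ => ((hL _).const_smul _).1) (by norm_num)).trans ?_
    have e2 : ∀ k ∈ Finset.range M, eLpNorm (((v - u) / M * ψ (gridPoint u v M k)) •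
          fun ω => (β v ω - β (gridPoint u v M k) ω)) 2 P
        ≤ ENNReal.ofReal ((v - u) / M * C * √(v - u)) := by
      intro k hk
      have hmem := gridPoint_mem huv (Finset.mem_range.1 hk).le
      rw [eLpNorm_const_smul, ENNReal.ofReal_mul (by positivity [sub_nonneg.2 huv])]
      refine mul_le_mul' ?_ ((hβ.eLpNorm_sub_le (hu.trans hmem.1) hmem.2).trans
        (ENNReal.ofReal_le_ofReal (Real.sqrt_le_sqrt (by linarith [hmem.1]))))
      rw [Real.enorm_eq_ofReal_abs]
      refine ENNReal.ofReal_le_ofReal ?_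
      rw [abs_mul, abs_of_nonneg (div_nonneg (sub_nonneg.2 huv) hM'.le)]
      exact mul_le_mul_of_nonneg_left (hC _ hmem) (div_nonneg (sub_nonneg.2 huv) hM'.le)
    refine (Finset.sum_le_sum e2).trans ?_
    rw [Finset.sum_const, Finset.card_range, nsmul_eq_mul, ← ENNReal.ofReal_natCast,
      ← ENNReal.ofReal_mul hM'.le]
    refine ENNReal.ofReal_le_ofReal (le_of_eq ?_)
    field_simp
  exact ⟨⟨aestronglyMeasurable_of_tendsto_ae _ (fun M => (hmeas M).1) hlim,
    hb.trans_lt ENNReal.ofReal_lt_top⟩, hb⟩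

variable {φ φ' ψ ψ' : ℝ → ℝ} {a b : ℝ}

lemma partsIntegral_sub_sum_ae (hβ : HasBrownianCovariance β P)
    (hφ : ∀ s, HasDerivAt φ (φ' s) s) (hφ' : Continuous φ') (t : ℕ → ℝ) (N : ℕ) :
    (fun ω => partsIntegral φ φ' (β · ω) (t 0) (t N)
      - ∑ i ∈ Finset.range N, φ (t i) * (β (t (i + 1)) ω - β (t i) ω))
    =ᵐ[P] ∑ i ∈ Finset.range N, fun ω =>
      ∫ s in t i..t (i + 1), φ' s * (β (t (i + 1)) ω - β s ω) := by
  filter_upwards [hβ.cont] with ω hω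
  rw [partsIntegral_sub_sum hφ hφ' hω, Finset.sum_apply]

/-- Each cell of the error formula costs C times its length times √δ. The bound depends on the
partition only through its endpoints and mesh, as the definition of the Wiener integral requires. -/
lemma eLpNorm_partsIntegral_sub_sum_le [IsProbabilityMeasure P] (hβ : HasBrownianCovariance β P)
    (hφ : ∀ s, HasDerivAt φ (φ' s) s) (hφ' : Continuous φ') {t : ℕ → ℝ} (ht : Monotone t)
    (h0 : 0 ≤ t 0) {N : ℕ} {C δ : ℝ} (hC : ∀ s ∈ Set.Icc (t 0) (t N), |φ' s| ≤ C)
    (hδ : ∀ i < N, t (i + 1) - t i ≤ δ) :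
    eLpNorm (fun ω => partsIntegral φ φ' (β · ω) (t 0) (t N)
      - ∑ i ∈ Finset.range N, φ (t i) * (β (t (i + 1)) ω - β (t i) ω)) 2 P
      ≤ ENNReal.ofReal (C * (t N - t 0) * √δ) := by
  have hC0 : 0 ≤ C := (abs_nonneg _).trans (hC (t 0) ⟨le_rfl, ht N.zero_le⟩)
  have key : ∀ i ∈ Finset.range N, _ := fun i hi =>
    hβ.eLpNorm_integral_le hφ' (h0.trans (ht i.zero_le)) (ht i.le_succ) (C := C)
    fun s hs => hC s ⟨(ht i.zero_le).trans hs.1, hs.2.trans (ht (Finset.mem_range.1 hi))⟩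
  rw [eLpNorm_congr_ae (hβ.partsIntegral_sub_sum_ae hφ hφ' t N)]
  refine (eLpNorm_sum_le (fun i hi => (key i hi).1.1) (by norm_num)).trans ?_
  refine (Finset.sum_le_sum fun i hi => (key i hi).2.trans (ENNReal.ofReal_le_ofReal
    (mul_le_mul_of_nonneg_left (Real.sqrt_le_sqrt (hδ i (Finset.mem_range.1 hi)))
      (mul_nonneg hC0 (sub_nonneg.2 (ht i.le_succ)))))).trans ?_
  rw [← ENNReal.ofReal_sum_of_nonneg fun i _ =>
    mul_nonneg (mul_nonneg hC0 (sub_nonneg.2 (ht i.le_succ))) (Real.sqrt_nonneg _)]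
  refine ENNReal.ofReal_le_ofReal (le_of_eq ?_)
  rw [← Finset.sum_mul, ← Finset.mul_sum]
  simp only [Nat.succ_eq_add_one]
  rw [Finset.sum_range_sub]

lemma memLp_partsIntegral [IsProbabilityMeasure P] (hβ : HasBrownianCovariance β P)
    (hφ : ∀ s, HasDerivAt φ (φ' s) s) (hφ' : Continuous φ') (ha : 0 ≤ a) (hab : a ≤ b) :
    MemLp (fun ω => partsIntegral φ φ' (β · ω) a b) 2 P := by
  obtain ⟨C, hC⟩ := (isCompact_Icc (a := a) (b := b)).exists_bound_of_continuousOn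
    hφ'.continuousOn
  have h1 := (hβ.eLpNorm_integral_le hφ' ha hab hC).1
  have h2 : MemLp (fun ω => φ a * (β b ω - β a ω)) 2 P :=
    ((hβ.memLp b).sub (hβ.memLp a)).const_mul _
  refine (memLp_congr_ae ?_).1 (h1.add h2)
  filter_upwards [hβ.cont] with ω hω
  -- The one-cell partition writes the integral as φ(a)(β(b) - β(a)) plus the error term, both known
  -- to be square integrable.
  have := partsIntegral_sub_sum hφ hφ' hω (fun i => if i = 0 then a else b) 1
  simp at this
  simp only [Pi.add_apply]
  linarith

lemma tendstoL2_partsIntegral [IsProbabilityMeasure P] (hβ : HasBrownianCovariance β P)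
    (hφ : ∀ s, HasDerivAt φ (φ' s) s) (hφ' : Continuous φ') (ha : 0 ≤ a) (hab : a ≤ b) :
    TendstoL2 (fun M ω => ∑ k ∈ Finset.range M, φ (gridPoint a b M k) *
        (β (gridPoint a b M (k + 1)) ω - β (gridPoint a b M k) ω))
      (fun ω => partsIntegral φ φ' (β · ω) a b) P where
  memLp M := memLp_finsetSum _ fun k _ => (hβ.memLp_sub _ _).const_mul _
  memLp_lim := hβ.memLp_partsIntegral hφ hφ' ha hab
  tendsto := by
    obtain ⟨C, hC⟩ := (isCompact_Icc (a := a) (b := b)).exists_bound_of_continuousOn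
      hφ'.continuousOn
    have h1 : Tendsto (fun M : ℕ => ENNReal.ofReal (C * (b - a) * √((b - a) / M))) atTop (𝓝 0) := by
      have := (tendsto_const_div_atTop_nhds_zero_nat (b - a)).sqrt.const_mul (C * (b - a))
      simpa using ENNReal.tendsto_ofReal this
    refine tendsto_of_tendsto_of_tendsto_of_le_of_le' tendsto_const_nhds h1
      (Eventually.of_forall fun _ => zero_le) ?_
    filter_upwards [eventually_ne_atTop 0] with M hM
    have key := hβ.eLpNorm_partsIntegral_sub_sum_le hφ hφ' (monotone_gridPoint hab M) (N := M)
      (C := C) (δ := (b - a) / M) (by rwa [gridPoint_zero])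
      (by rw [gridPoint_zero, gridPoint_self a b hM]; exact hC)
      (fun i _ => (gridPoint_succ_sub a b M i).le)
    rw [gridPoint_zero, gridPoint_self a b hM] at key
    rw [← eLpNorm_neg]
    refine le_trans (le_of_eq ?_) key
    congr 1
    ext ω
    rw [Pi.neg_apply, neg_sub]

lemma integral_partsIntegral [IsProbabilityMeasure P] (hβ : HasBrownianCovariance β P)
    (hφ : ∀ s, HasDerivAt φ (φ' s) s) (hφ' : Continuous φ') (ha : 0 ≤ a) (hab : a ≤ b) :
    ∫ ω, partsIntegral φ φ' (β · ω) a b ∂P = 0 := by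
  refine tendsto_nhds_unique (hβ.tendstoL2_partsIntegral hφ hφ' ha hab).tendsto_integral ?_
  have hi := fun s => (hβ.memLp s).integrable (by norm_num)
  refine tendsto_const_nhds.congr fun M => ?_
  rw [integral_finsetSum _ fun k _ => ((hβ.memLp_sub _ _).integrable (by norm_num)).const_mul _]
  symm
  refine Finset.sum_eq_zero fun k _ => ?_
  rw [integral_const_mul, integral_sub (hi _) (hi _), hβ.integral_eq, hβ.integral_eq]
  simp

/-- The Itô isometry: increments over distinct cells are uncorrelated, so the covariance of the
approximating sums is a Riemann sum for φψ. -/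
lemma covariance_partsIntegral [IsProbabilityMeasure P] (hβ : HasBrownianCovariance β P)
    (hφ : ∀ s, HasDerivAt φ (φ' s) s) (hφ' : Continuous φ')
    (hψ : ∀ s, HasDerivAt ψ (ψ' s) s) (hψ' : Continuous ψ') (ha : 0 ≤ a) (hab : a ≤ b) :
    cov[fun ω => partsIntegral φ φ' (β · ω) a b, fun ω => partsIntegral ψ ψ' (β · ω) a b; P]
      = ∫ s in a..b, φ s * ψ s := by
  refine tendsto_nhds_unique ((hβ.tendstoL2_partsIntegral hφ hφ' ha hab).tendsto_covariance
    (hβ.tendstoL2_partsIntegral hψ hψ' ha hab)) ?_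
  have hc : Continuous fun s => φ s * ψ s :=
    (continuous_iff_continuousAt.2 fun s => (hφ s).continuousAt).mul
      (continuous_iff_continuousAt.2 fun s => (hψ s).continuousAt)
  refine (tendsto_riemannSum hc hab).congr fun M => ?_
  rw [hβ.covariance_sum_sum (monotone_gridPoint hab M) (by rwa [gridPoint_zero])
    (fun k => φ (gridPoint a b M k)) (fun k => ψ (gridPoint a b M k)) M]
  simp_rw [gridPoint_succ_sub]

lemma covariance_partsIntegral_eq_zero [IsProbabilityMeasure P] (hβ : HasBrownianCovariance β P)
    (hφ : ∀ s, HasDerivAt φ (φ' s) s) (hφ' : Continuous φ') (ha : 0 ≤ a) (hab : a ≤ b)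
    {Z : Ω → ℝ} (hZ : MemLp Z 2 P)
    (h : ∀ u v, a ≤ u → u ≤ v → v ≤ b → cov[fun ω => β v ω - β u ω, Z; P] = 0) :
    cov[fun ω => partsIntegral φ φ' (β · ω) a b, Z; P] = 0 := by
  refine tendsto_nhds_unique ((hβ.tendstoL2_partsIntegral hφ hφ' ha hab).tendsto_covariance
    (TendstoL2.const hZ)) ?_
  refine tendsto_const_nhds.congr fun M => ?_
  rw [covariance_fun_sum_left' (fun k _ => (hβ.memLp_sub _ _).const_mul _) hZ]
  symm
  refine Finset.sum_eq_zero fun k hk => ?_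
  rw [covariance_const_mul_left]
  have hk := Finset.mem_range.1 hk
  have := h _ _ (gridPoint_mem hab hk.le).1 (monotone_gridPoint hab M k.le_succ)
    (gridPoint_mem hab (Nat.succ_le_of_lt hk)).2
  simp only [Nat.succ_eq_add_one] at this
  rw [this, mul_zero]

end HasBrownianCovariance

end WienerIntegral

/-! ### Variation of constants along a continuous path. -/

section Pathwise

variable {n m : ℕ} (F : Matrix (Fin n) (Fin n) ℝ) (G : Matrix (Fin n) (Fin m) ℝ)

lemma continuous_exp_sub_mul_apply (b : ℝ) (i : Fin n) (j : Fin m) :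
    Continuous fun s : ℝ => (NormedSpace.exp ((b - s) • F) * G) i j := by
  have h : Continuous fun s : ℝ => NormedSpace.exp ((b - s) • F) :=
    (continuous_exp_smul F).comp (by fun_prop : Continuous fun s : ℝ => b - s)
  exact Continuous.matrix_elem (h.matrix_mul continuous_const) i j

lemma hasDerivAt_exp_sub_mul_apply (b : ℝ) (i : Fin n) (j : Fin m) (s : ℝ) :
    HasDerivAt (fun s : ℝ => (NormedSpace.exp ((b - s) • F) * G) i j)
      (-(NormedSpace.exp ((b - s) • F) * (F * G)) i j) s := by
  open scoped Matrix.Norms.Operator in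
  have h1 : ∀ k, HasDerivAt (fun s : ℝ => NormedSpace.exp ((b - s) • F) i k)
      (-(NormedSpace.exp ((b - s) • F) * F) i k) s := by
    intro k
    have h2 := hasDerivAt_matrix_iff.1 (hasDerivAt_exp_smul F (b - s)) i k
    have h3 : HasDerivAt (fun s : ℝ => b - s) (-1) s := by
      simpa using (hasDerivAt_id s).const_sub b
    exact (HasDerivAt.comp s h2 h3).congr_deriv (by ring)
  have h2 : ∑ k, -(NormedSpace.exp ((b - s) • F) * F) i k * G k j
      = -(NormedSpace.exp ((b - s) • F) * (F * G)) i j := by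
    rw [← Matrix.mul_assoc, Matrix.mul_apply (M := NormedSpace.exp ((b - s) • F) * F),
      ← Finset.sum_neg_distrib]
    exact Finset.sum_congr rfl fun k _ => neg_mul _ _
  exact (HasDerivAt.fun_sum fun k _ => (h1 k).mul_const (G k j)).congr_deriv h2

/-- The stochastic integral `∫ₐᵇ exp(F (b - τ)) G dw(τ)` along a continuous path `w`, defined
through integration by parts. -/
noncomputable def stochasticConvolution (w : ℝ → Fin m → ℝ) (a b : ℝ) : Fin n → ℝ := fun i =>
  ∑ j, partsIntegral (fun s => (NormedSpace.exp ((b - s) • F) * G) i j)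
    (fun s => -(NormedSpace.exp ((b - s) • F) * (F * G)) i j) (fun s => w s j) a b

variable {F G}

/-- z = x - Gw is differentiable although x and w need not be, with z' = Fx. Hence exp((b-s)F) z(s)
has derivative exp((b-s)F) F G w(s), and integrating it produces precisely the integrated-by-parts
convolution. -/
lemma eq_add_stochasticConvolution {x : ℝ → Fin n → ℝ} {w : ℝ → Fin m → ℝ} {c : Fin n → ℝ}
    (hx : Continuous x) (hw : Continuous w)
    (h : ∀ t, 0 ≤ t → x t = c + (∫ s in (0 : ℝ)..t, F *ᵥ x s) + G *ᵥ w t)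
    {a b : ℝ} (ha : 0 ≤ a) (hab : a ≤ b) :
    x b = NormedSpace.exp ((b - a) • F) *ᵥ x a + stochasticConvolution F G w a b := by
  have hFx : Continuous fun s => F *ᵥ x s := continuous_const.matrix_mulVec hx
  -- z is defined by the integral rather than as x - Gw, so that it is differentiable at every real
  -- time, although the equation is given only for t ≥ 0.
  obtain ⟨z, hz⟩ : ∃ z : ℝ → Fin n → ℝ, ∀ t, z t = c + ∫ s in (0 : ℝ)..t, F *ᵥ x s :=
    ⟨_, fun _ => rfl⟩
  have hzd : ∀ s k, HasDerivAt (fun t => z t k) ((F *ᵥ x s) k) s := by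
    intro s k
    have h1 := (intervalIntegral.integral_hasDerivAt_right (hFx.intervalIntegrable 0 s)
      (hFx.stronglyMeasurableAtFilter _ _) hFx.continuousAt).const_add c
    refine hasDerivAt_pi.1 (h1.congr_of_eventuallyEq ?_) k
    exact Eventually.of_forall hz
  have hxz : ∀ t, 0 ≤ t → x t - z t = G *ᵥ w t := by
    intro t ht
    rw [h t ht, hz t, add_sub_cancel_left]
  have hzc : Continuous z := continuous_pi fun k =>
    continuous_iff_continuousAt.2 fun s => (hzd s k).continuousAt
  ext i
  have hE := fun k => hasDerivAt_exp_sub_mul_apply F (1 : Matrix (Fin n) (Fin n) ℝ) b i k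
  simp only [Matrix.mul_one] at hE
  have hcE := fun k => continuous_exp_sub_mul_apply F (1 : Matrix (Fin n) (Fin n) ℝ) b i k
  have hcE' := fun k => continuous_exp_sub_mul_apply F F b i k
  simp only [Matrix.mul_one] at hcE
  have hy : ∀ s ∈ Set.uIcc a b, HasDerivAt (fun s => (NormedSpace.exp ((b - s) • F) *ᵥ z s) i)
      (∑ k, (-(NormedSpace.exp ((b - s) • F) * F) i k * z s k
        + NormedSpace.exp ((b - s) • F) i k * (F *ᵥ x s) k)) s := by
    intro s _
    exact HasDerivAt.fun_sum (u := Finset.univ) fun k _ => (hE k s).mul (hzd s k)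
  have hcont : Continuous fun s => ∑ k, (-(NormedSpace.exp ((b - s) • F) * F) i k * z s k
        + NormedSpace.exp ((b - s) • F) i k * (F *ᵥ x s) k) := by
    refine continuous_finsetSum _ fun k _ => ((hcE' k).neg.mul ?_).add ((hcE k).mul ?_)
    · exact (continuous_apply k).comp hzc
    · exact (continuous_apply k).comp hFx
  have key := intervalIntegral.integral_eq_sub_of_hasDerivAt hy (hcont.intervalIntegrable a b)
  have hcongr : ∫ s in a..b, ∑ k, (-(NormedSpace.exp ((b - s) • F) * F) i k * z s k
        + NormedSpace.exp ((b - s) • F) i k * (F *ᵥ x s) k)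
      = ∑ j, ∫ s in a..b, (NormedSpace.exp ((b - s) • F) * (F * G)) i j * w s j := by
    have hint : ∀ j, IntervalIntegrable (fun s => (NormedSpace.exp ((b - s) • F) * (F * G)) i j
        * w s j) volume a b := fun j => ((continuous_exp_sub_mul_apply F (F * G) b
      i j).mul ((continuous_apply j).comp hw)).intervalIntegrable a b
    rw [← intervalIntegral.integral_finsetSum fun j _ => hint j]
    refine intervalIntegral.integral_congr fun s hs => ?_
    rw [Set.uIcc_of_le hab] at hs
    have e1 : ∑ k, (-(NormedSpace.exp ((b - s) • F) * F) i k * z s k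
        + NormedSpace.exp ((b - s) • F) i k * (F *ᵥ x s) k)
        = ((NormedSpace.exp ((b - s) • F) * F) *ᵥ (x s - z s)) i := by
      rw [Matrix.mulVec_sub, ← Matrix.mulVec_mulVec, Finset.sum_add_distrib, Pi.sub_apply]
      simp only [Matrix.mulVec, dotProduct, neg_mul, Finset.sum_neg_distrib]
      ring
    refine e1.trans ?_
    rw [hxz s (ha.trans hs.1), Matrix.mulVec_mulVec, Matrix.mul_assoc]
    rfl
  rw [hcongr] at key
  have hb := hxz b (ha.trans hab)
  have hA := hxz a ha
  rw [sub_self, zero_smul, NormedSpace.exp_zero, Matrix.one_mulVec] at key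
  have hb' : x b i = z b i + (G *ᵥ w b) i := by rw [← hb, Pi.sub_apply]; ring
  have ha' : z a = x a - G *ᵥ w a := by rw [← hA]; abel
  rw [ha', Matrix.mulVec_sub, Pi.sub_apply, Matrix.mulVec_mulVec] at key
  rw [hb', Pi.add_apply, stochasticConvolution]
  simp only [partsIntegral, neg_mul, intervalIntegral.integral_neg, sub_neg_eq_add,
    Finset.sum_add_distrib, Finset.sum_sub_distrib, key, sub_self, zero_smul, NormedSpace.exp_zero,
    Matrix.one_mul]
  simp only [Matrix.mulVec, dotProduct]
  ring

end Pathwise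

/-! ### Moments of the stochastic convolution of a Wiener process. -/

section Wiener

variable {Ω : Type*} [MeasurableSpace Ω] {P : Measure Ω} {n m : ℕ}
  {F : Matrix (Fin n) (Fin n) ℝ} {G : Matrix (Fin n) (Fin m) ℝ} {w : ℝ≥0 → Ω → (Fin m → ℝ)}

namespace IsWiener

lemma memLp (hw : IsWiener w P) (t : ℝ≥0) (j : Fin m) : MemLp (fun ω => w t ω j) 2 P :=
  ((IsPreBrownianReal.isGaussianProcess
    (hw.brownian j).toIsPreBrownianReal).hasGaussianLaw_eval t).memLp_two

lemma hasBrownianCovariance (hw : IsWiener w P) (j : Fin m) :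
    HasBrownianCovariance (fun t ω => w t.toNNReal ω j) P where
  memLp t := hw.memLp _ _
  integral_eq t := (hw.brownian j).integral_eval _
  covariance_eq s t hs ht := by
    rw [(hw.brownian j).covariance_fun_eval]
    push_cast
    rw [Real.coe_toNNReal s hs, Real.coe_toNNReal t ht]
  cont := by
    filter_upwards [(hw.brownian j).cont] with ω hω using hω.comp continuous_real_toNNReal

lemma continuous_paths (hw : IsWiener w P) : ∀ᵐ ω ∂P, Continuous fun t => w t ω := by
  filter_upwards [ae_all_iff.2 fun j => (hw.brownian j).cont] with ω hω using continuous_pi hω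

lemma covariance_eq_zero (hw : IsWiener w P) {j k : Fin m} (hjk : j ≠ k) (s t : ℝ≥0) :
    cov[fun ω => w s ω j, fun ω => w t ω k; P] = 0 :=
  ((hw.indep.indepFun hjk).comp (measurable_pi_apply s) (measurable_pi_apply t)).covariance_eq_zero
    (hw.memLp s j) (hw.memLp t k)

variable [IsProbabilityMeasure P] {a b c d : ℝ}

lemma memLp_stochasticConvolution (hw : IsWiener w P) (ha : 0 ≤ a) (hab : a ≤ b) (i : Fin n) :
    MemLp (fun ω => stochasticConvolution F G (fun t => w t.toNNReal ω) a b i) 2 P :=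
  memLp_finsetSum _ fun j _ => (hw.hasBrownianCovariance j).memLp_partsIntegral
    (hasDerivAt_exp_sub_mul_apply F G b i j) (continuous_exp_sub_mul_apply F (F * G) b i j).neg
    ha hab

lemma integral_stochasticConvolution (hw : IsWiener w P) (ha : 0 ≤ a) (hab : a ≤ b) (i : Fin n) :
    ∫ ω, stochasticConvolution F G (fun t => w t.toNNReal ω) a b i ∂P = 0 := by
  simp only [stochasticConvolution]
  rw [integral_finsetSum]
  · exact Finset.sum_eq_zero fun j _ => (hw.hasBrownianCovariance j).integral_partsIntegral
      (hasDerivAt_exp_sub_mul_apply F G b i j) (continuous_exp_sub_mul_apply F (F * G) b i j).neg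
      ha hab
  · exact fun j _ => ((hw.hasBrownianCovariance j).memLp_partsIntegral
      (hasDerivAt_exp_sub_mul_apply F G b i j) (continuous_exp_sub_mul_apply F (F * G) b i j).neg
      ha hab).integrable (by norm_num)

lemma covariance_stochasticConvolution_eq_zero (hw : IsWiener w P) (ha : 0 ≤ a) (hab : a ≤ b)
    {Z : Ω → ℝ} (hZ : MemLp Z 2 P)
    (h : ∀ j u v, a ≤ u → u ≤ v → v ≤ b →
      cov[fun ω => w v.toNNReal ω j - w u.toNNReal ω j, Z; P] = 0) (i : Fin n) :
    cov[fun ω => stochasticConvolution F G (fun t => w t.toNNReal ω) a b i, Z; P] = 0 := by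
  simp only [stochasticConvolution]
  rw [covariance_fun_sum_left (fun j => (hw.hasBrownianCovariance j).memLp_partsIntegral
      (hasDerivAt_exp_sub_mul_apply F G b i j) (continuous_exp_sub_mul_apply F (F * G) b i j).neg
      ha hab) hZ]
  exact Finset.sum_eq_zero fun j _ => (hw.hasBrownianCovariance j).covariance_partsIntegral_eq_zero
    (hasDerivAt_exp_sub_mul_apply F G b i j) (continuous_exp_sub_mul_apply F (F * G) b i j).neg
    ha hab hZ (h j)

lemma covariance_increment_eq_zero (hw : IsWiener w P) {j k : Fin m} (ha : 0 ≤ a) (hab : a ≤ b)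
    (hbc : b ≤ c) (hcd : c ≤ d) :
    cov[fun ω => w b.toNNReal ω j - w a.toNNReal ω j,
      fun ω => w d.toNNReal ω k - w c.toNNReal ω k; P] = 0 := by
  have hb := ha.trans hab
  have hc := hb.trans hbc
  rcases eq_or_ne j k with rfl | hjk
  · rw [(hw.hasBrownianCovariance j).covariance_sub_sub ha hb hc (hc.trans hcd), min_eq_left hbc,
      min_eq_left (hbc.trans hcd), min_eq_left (hab.trans hbc),
      min_eq_left (hab.trans (hbc.trans hcd))]
    ring
  · rw [covariance_fun_sub_left (hw.memLp _ _) (hw.memLp _ _)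
      ((hw.hasBrownianCovariance k).memLp_sub c d),
      covariance_fun_sub_right (hw.memLp _ _) (hw.memLp _ _) (hw.memLp _ _),
      covariance_fun_sub_right (hw.memLp _ _) (hw.memLp _ _) (hw.memLp _ _)]
    simp only [hw.covariance_eq_zero hjk, sub_zero]

/-- The limit argument is used once in each slot of the covariance, which reduces the claim to two
increments over ordered intervals. -/
lemma covariance_stochasticConvolution_disjoint (hw : IsWiener w P) (ha : 0 ≤ a) (hab : a ≤ b)
    (hbc : b ≤ c) (hcd : c ≤ d) (i k : Fin n) :
    cov[fun ω => stochasticConvolution F G (fun t => w t.toNNReal ω) a b i,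
      fun ω => stochasticConvolution F G (fun t => w t.toNNReal ω) c d k; P] = 0 := by
  have hc := (ha.trans hab).trans hbc
  refine hw.covariance_stochasticConvolution_eq_zero ha hab
    (hw.memLp_stochasticConvolution hc hcd k) (fun j u v hu huv hv => ?_) i
  rw [covariance_comm]
  refine hw.covariance_stochasticConvolution_eq_zero hc hcd
    ((hw.hasBrownianCovariance j).memLp_sub u v) (fun j' u' v' hu' huv' hv' => ?_) k
  rw [covariance_comm]
  exact hw.covariance_increment_eq_zero (ha.trans hu) huv (hv.trans (hbc.trans hu')) huv'

lemma covariance_stochasticConvolution (hw : IsWiener w P) (ha : 0 ≤ a) (hab : a ≤ b)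
    (i k : Fin n) :
    cov[fun ω => stochasticConvolution F G (fun t => w t.toNNReal ω) a b i,
      fun ω => stochasticConvolution F G (fun t => w t.toNNReal ω) a b k; P]
      = gramian F G (b - a) i k := by
  have hL := fun (i : Fin n) j => (hw.hasBrownianCovariance j).memLp_partsIntegral
    (hasDerivAt_exp_sub_mul_apply F G b i j) (continuous_exp_sub_mul_apply F (F * G) b i j).neg
    ha hab
  have hc : ∀ j, Continuous fun s => (NormedSpace.exp ((b - s) • F) * G) i j
      * (NormedSpace.exp ((b - s) • F) * G) k j :=
    fun j => (continuous_exp_sub_mul_apply F G b i j).mul (continuous_exp_sub_mul_apply F G b k j)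
  simp only [stochasticConvolution]
  rw [covariance_fun_sum_fun_sum (hL i) (hL k)]
  have h1 : ∀ j, ∑ j', cov[fun ω => partsIntegral
      (fun s => (NormedSpace.exp ((b - s) • F) * G) i j)
      (fun s => -(NormedSpace.exp ((b - s) • F) * (F * G)) i j) (fun s => w s.toNNReal ω j) a b,
      fun ω => partsIntegral (fun s => (NormedSpace.exp ((b - s) • F) * G) k j')
      (fun s => -(NormedSpace.exp ((b - s) • F) * (F * G)) k j')
      (fun s => w s.toNNReal ω j') a b; P]
      = ∫ s in a..b, (NormedSpace.exp ((b - s) • F) * G) i j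
        * (NormedSpace.exp ((b - s) • F) * G) k j := by
    intro j
    rw [Finset.sum_eq_single j]
    · exact (hw.hasBrownianCovariance j).covariance_partsIntegral
        (hasDerivAt_exp_sub_mul_apply F G b i j) (continuous_exp_sub_mul_apply F (F * G) b i j).neg
        (hasDerivAt_exp_sub_mul_apply F G b k j) (continuous_exp_sub_mul_apply F (F * G) b k j).neg
        ha hab
    · intro j' _ hj
      refine (hw.hasBrownianCovariance j).covariance_partsIntegral_eq_zero
        (hasDerivAt_exp_sub_mul_apply F G b i j) (continuous_exp_sub_mul_apply F (F * G) b i j).neg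
        ha hab (hL k j') fun u v _ _ _ => ?_
      rw [covariance_comm]
      refine (hw.hasBrownianCovariance j').covariance_partsIntegral_eq_zero
        (hasDerivAt_exp_sub_mul_apply F G b k j')
        (continuous_exp_sub_mul_apply F (F * G) b k j').neg
        ha hab ((hw.hasBrownianCovariance j).memLp_sub u v) fun u' v' _ _ _ => ?_
      rw [covariance_fun_sub_left (hw.memLp _ _) (hw.memLp _ _)
        ((hw.hasBrownianCovariance j).memLp_sub u v),
        covariance_fun_sub_right (hw.memLp _ _) (hw.memLp _ _) (hw.memLp _ _),
        covariance_fun_sub_right (hw.memLp _ _) (hw.memLp _ _) (hw.memLp _ _)]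
      simp only [hw.covariance_eq_zero hj, sub_zero]
    · simp
  simp only [h1]
  rw [← intervalIntegral.integral_finsetSum fun j _ => (hc j).intervalIntegrable a b, gramian_apply]
  -- The substitution τ = b - s turns the isometry integral into the Gramian.
  have h2 := intervalIntegral.integral_comp_sub_left (a := a) (b := b) (fun τ =>
    (NormedSpace.exp (τ • F) * (G * Gᵀ) * (NormedSpace.exp (τ • F))ᵀ) i k) b
  rw [sub_self] at h2
  rw [← h2]
  congr 1
  ext s
  rw [← Matrix.mul_assoc, Matrix.mul_assoc _ Gᵀ, ← Matrix.transpose_mul, Matrix.mul_apply]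
  rfl

lemma isWienerIntegral_stochasticConvolution (hw : IsWiener w P) {a b : ℝ≥0} (hab : a ≤ b)
    {I : Ω → Fin n → ℝ}
    (hI : ∀ᵐ ω ∂P, I ω = stochasticConvolution F G (fun t => w t.toNNReal ω) a b) :
    IsWienerIntegral (fun τ => NormedSpace.exp (((b : ℝ) - (τ : ℝ)) • F) * G) w a b I P := by
  have hab' : (a : ℝ) ≤ b := by exact_mod_cast hab
  have hIi : ∀ i, (fun ω => stochasticConvolution F G (fun t => w t.toNNReal ω) a b i)
      =ᵐ[P] fun ω => I ω i := by
    intro i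
    filter_upwards [hI] with ω hω
    rw [hω]
  refine ⟨MemLp.of_eval fun i => (memLp_congr_ae (hIi i)).1
    (hw.memLp_stochasticConvolution a.2 hab' i), fun ε hε => ?_⟩
  have hC : ∀ (i : Fin n) (j : Fin m), ∃ C, ∀ s ∈ Set.Icc (a : ℝ) b,
      ‖-(NormedSpace.exp (((b : ℝ) - s) • F) * (F * G)) i j‖ ≤ C := fun i j =>
    (isCompact_Icc (a := (a : ℝ)) (b := b)).exists_bound_of_continuousOn
      (continuous_exp_sub_mul_apply F (F * G) b i j).neg.continuousOn
  choose C hC using hC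
  have hC0 : ∀ i j, 0 ≤ C i j := fun i j => (norm_nonneg _).trans (hC i j a ⟨le_rfl, hab'⟩)
  set K := ∑ i, ∑ j, C i j * (b - a) with hK
  have hK0 : 0 ≤ K := Finset.sum_nonneg fun i _ => Finset.sum_nonneg fun j _ =>
    mul_nonneg (hC0 i j) (sub_nonneg.2 hab')
  -- The total error is at most K√δ, where K sums the scalar constants over all entries; K + 1
  -- avoids dividing by zero.
  refine ⟨(ε / (K + 1)) ^ 2, by positivity, fun N t ht h0 hN hδ => ?_⟩
  have hKε : K * √((ε / (K + 1)) ^ 2) ≤ ε := by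
    rw [Real.sqrt_sq (by positivity), mul_div_assoc', div_le_iff₀ (by positivity)]
    nlinarith
  have hterm : ∀ i j, eLpNorm (fun ω => partsIntegral
      (fun s => (NormedSpace.exp (((b : ℝ) - s) • F) * G) i j)
      (fun s => -(NormedSpace.exp (((b : ℝ) - s) • F) * (F * G)) i j)
      (fun s => w s.toNNReal ω j) a b - ∑ k ∈ Finset.range N,
      (NormedSpace.exp (((b : ℝ) - t k) • F) * G) i j * (w (t (k + 1)) ω j - w (t k) ω j)) 2 P
      ≤ ENNReal.ofReal (C i j * (b - a) * √((ε / (K + 1)) ^ 2)) := by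
    intro i j
    have key := (hw.hasBrownianCovariance j).eLpNorm_partsIntegral_sub_sum_le
      (hasDerivAt_exp_sub_mul_apply F G b i j) (continuous_exp_sub_mul_apply F (F * G) b i j).neg
      (t := fun k => (t k : ℝ)) (fun k l hkl => by exact_mod_cast ht hkl) (t 0).2 (N := N)
      (C := C i j) (by rw [h0, hN]; exact hC i j) (fun k hk => (hδ k hk).le)
    simpa only [h0, hN, Real.toNNReal_coe] using key
  have hmem : ∀ i j, MemLp (fun ω => partsIntegral
      (fun s => (NormedSpace.exp (((b : ℝ) - s) • F) * G) i j)
      (fun s => -(NormedSpace.exp (((b : ℝ) - s) • F) * (F * G)) i j)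
      (fun s => w s.toNNReal ω j) a b - ∑ k ∈ Finset.range N,
      (NormedSpace.exp (((b : ℝ) - t k) • F) * G) i j * (w (t (k + 1)) ω j - w (t k) ω j)) 2 P := by
    intro i j
    exact ((hw.hasBrownianCovariance j).memLp_partsIntegral
      (hasDerivAt_exp_sub_mul_apply F G b i j) (continuous_exp_sub_mul_apply F (F * G) b i j).neg
      a.2 hab').sub (memLp_finsetSum _ fun k _ => ((hw.memLp _ _).sub (hw.memLp _ _)).const_mul _)
  have hle : ∀ᵐ ω ∂P, ‖I ω - ∑ k ∈ Finset.range N,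
      (NormedSpace.exp (((b : ℝ) - t k) • F) * G) *ᵥ (w (t (k + 1)) ω - w (t k) ω)‖
      ≤ (∑ i, ∑ j, fun ω => ‖partsIntegral
        (fun s => (NormedSpace.exp (((b : ℝ) - s) • F) * G) i j)
        (fun s => -(NormedSpace.exp (((b : ℝ) - s) • F) * (F * G)) i j)
        (fun s => w s.toNNReal ω j) a b - ∑ k ∈ Finset.range N,
        (NormedSpace.exp (((b : ℝ) - t k) • F) * G) i j * (w (t (k + 1)) ω j - w (t k) ω j)‖) ω := by
    filter_upwards [hI] with ω hω
    simp only [Finset.sum_apply]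
    -- The sup norm of the vector error is dominated by the sum of all scalar errors.
    refine (pi_norm_le_iff_of_nonneg (by positivity)).2 fun i => ?_
    refine le_trans ?_ (Finset.single_le_sum (f := fun i => ∑ j, ‖_‖)
      (fun i _ => by positivity) (Finset.mem_univ i))
    refine le_trans (le_of_eq ?_) (norm_sum_le _ _)
    congr 1
    rw [Finset.sum_sub_distrib, hω, Pi.sub_apply, Finset.sum_apply, Finset.sum_comm]
    rfl
  refine (eLpNorm_mono_ae_real hle).trans ?_
  refine (eLpNorm_sum_le (fun i _ => ?_) (by norm_num)).trans ?_
  · exact Finset.aestronglyMeasurable_sum _ fun j _ => (hmem i j).1.norm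
  refine (Finset.sum_le_sum fun i _ => (eLpNorm_sum_le (fun j _ => (hmem i j).1.norm)
    (by norm_num)).trans (Finset.sum_le_sum fun j _ =>
      (eLpNorm_norm _).le.trans (hterm i j))).trans ?_
  have hnn : ∀ i j, 0 ≤ C i j * (b - a) * √((ε / (K + 1)) ^ 2) := fun i j =>
    mul_nonneg (mul_nonneg (hC0 i j) (sub_nonneg.2 hab')) (Real.sqrt_nonneg _)
  rw [Finset.sum_congr rfl fun i _ => (ENNReal.ofReal_sum_of_nonneg fun j _ => hnn i j).symm,
    ← ENNReal.ofReal_sum_of_nonneg fun i _ => Finset.sum_nonneg fun j _ => hnn i j]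
  refine ENNReal.ofReal_le_ofReal (le_trans (le_of_eq ?_) hKε)
  simp only [hK, Finset.sum_mul]

end IsWiener

end Wiener

/-! ### Covariance matrices of random vectors. -/

section CovMatrix

variable {Ω : Type*} [MeasurableSpace Ω] {P : Measure Ω} {k l m n : ℕ}

/-- The matrix of covariances of the entries of `X` with those of `Y`. -/
noncomputable def covMatrix (X : Ω → Fin m → ℝ) (Y : Ω → Fin n → ℝ) (P : Measure Ω) :
    Matrix (Fin m) (Fin n) ℝ :=
  Matrix.of fun i j => cov[fun ω => X ω i, fun ω => Y ω j; P]

lemma covMatrix_comm (X : Ω → Fin m → ℝ) (Y : Ω → Fin n → ℝ) :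
    covMatrix Y X P = (covMatrix X Y P)ᵀ := by
  ext i j
  exact covariance_comm _ _

lemma covMatrix_congr {X X' : Ω → Fin m → ℝ} {Y Y' : Ω → Fin n → ℝ} (hX : X =ᵐ[P] X')
    (hY : Y =ᵐ[P] Y') : covMatrix X Y P = covMatrix X' Y' P := by
  ext i j
  have h1 : (fun ω => X ω i) =ᵐ[P] fun ω => X' ω i := by
    filter_upwards [hX] with ω hω
    rw [hω]
  have h2 : (fun ω => Y ω j) =ᵐ[P] fun ω => Y' ω j := by
    filter_upwards [hY] with ω hω
    rw [hω]
  simp only [covMatrix, Matrix.of_apply, covariance]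
  rw [integral_congr_ae h1, integral_congr_ae h2]
  refine integral_congr_ae ?_
  filter_upwards [h1, h2] with ω e1 e2
  rw [e1, e2]

lemma memLp_mulVec {X : Ω → Fin m → ℝ} (hX : ∀ i, MemLp (fun ω => X ω i) 2 P)
    (A : Matrix (Fin k) (Fin m) ℝ) (i : Fin k) : MemLp (fun ω => (A *ᵥ X ω) i) 2 P :=
  memLp_finsetSum Finset.univ fun j _ => (hX j).const_mul (A i j)

lemma integral_mulVec {X : Ω → Fin m → ℝ} (hX : ∀ i, Integrable (fun ω => X ω i) P)
    (A : Matrix (Fin k) (Fin m) ℝ) (i : Fin k) :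
    ∫ ω, (A *ᵥ X ω) i ∂P = (A *ᵥ fun j => ∫ ω, X ω j ∂P) i := by
  simp only [Matrix.mulVec, dotProduct]
  rw [integral_finsetSum _ fun j _ => (hX j).const_mul (A i j)]
  simp only [integral_const_mul]

variable [IsProbabilityMeasure P]

lemma covMatrix_add_left {X X' : Ω → Fin m → ℝ} {Y : Ω → Fin n → ℝ}
    (hX : ∀ i, MemLp (fun ω => X ω i) 2 P) (hX' : ∀ i, MemLp (fun ω => X' ω i) 2 P)
    (hY : ∀ i, MemLp (fun ω => Y ω i) 2 P) :
    covMatrix (fun ω => X ω + X' ω) Y P = covMatrix X Y P + covMatrix X' Y P := by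
  ext i j
  exact covariance_add_left (hX i) (hX' i) (hY j)

lemma covMatrix_mulVec_left {X : Ω → Fin m → ℝ} {Y : Ω → Fin n → ℝ}
    (hX : ∀ i, MemLp (fun ω => X ω i) 2 P) (hY : ∀ i, MemLp (fun ω => Y ω i) 2 P)
    (A : Matrix (Fin k) (Fin m) ℝ) :
    covMatrix (fun ω => A *ᵥ X ω) Y P = A * covMatrix X Y P := by
  ext i j
  simp only [covMatrix, Matrix.of_apply, Matrix.mul_apply, Matrix.mulVec, dotProduct]
  rw [covariance_fun_sum_left (fun j => (hX j).const_mul _) (hY j)]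
  simp only [covariance_const_mul_left]

lemma covMatrix_add_right {X : Ω → Fin m → ℝ} {Y Y' : Ω → Fin n → ℝ}
    (hX : ∀ i, MemLp (fun ω => X ω i) 2 P) (hY : ∀ i, MemLp (fun ω => Y ω i) 2 P)
    (hY' : ∀ i, MemLp (fun ω => Y' ω i) 2 P) :
    covMatrix X (fun ω => Y ω + Y' ω) P = covMatrix X Y P + covMatrix X Y' P := by
  rw [covMatrix_comm, covMatrix_add_left hY hY' hX, Matrix.transpose_add, ← covMatrix_comm,
    ← covMatrix_comm]

lemma covMatrix_mulVec_right {X : Ω → Fin m → ℝ} {Y : Ω → Fin n → ℝ}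
    (hX : ∀ i, MemLp (fun ω => X ω i) 2 P) (hY : ∀ i, MemLp (fun ω => Y ω i) 2 P)
    (A : Matrix (Fin k) (Fin n) ℝ) :
    covMatrix X (fun ω => A *ᵥ Y ω) P = covMatrix X Y P * Aᵀ := by
  rw [covMatrix_comm, covMatrix_mulVec_left hY hX, Matrix.transpose_mul, ← covMatrix_comm]

lemma covMatrix_eq_of_identDistrib {Ω' : Type*} [MeasurableSpace Ω'] {P' : Measure Ω'}
    [IsProbabilityMeasure P'] {X : Ω → Fin m → ℝ} {Y : Ω' → Fin m → ℝ}
    (h : IdentDistrib X Y P P') (hX : ∀ i, MemLp (fun ω => X ω i) 2 P) :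
    covMatrix X X P = covMatrix Y Y P' := by
  have h1 : ∀ i, IdentDistrib (fun ω => X ω i) (fun ω => Y ω i) P P' :=
    fun i => h.comp (measurable_pi_apply i)
  have hY : ∀ i, MemLp (fun ω => Y ω i) 2 P' := fun i => (h1 i).memLp_iff.1 (hX i)
  ext i j
  simp only [covMatrix, Matrix.of_apply]
  rw [covariance_eq_sub (hX i) (hX j), covariance_eq_sub (hY i) (hY j), (h1 i).integral_eq,
    (h1 j).integral_eq]
  congr 1
  exact (h.comp ((measurable_pi_apply i).mul (measurable_pi_apply j))).integral_eq

end CovMatrix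

/-! ### One-dimensional laws of stationary processes. -/

section Stationary

variable {Ω E T : Type*} [MeasurableSpace Ω] {P : Measure Ω} [MeasurableSpace E]

lemma IsStationary.identDistrib [AddZeroClass T] {X : T → Ω → E} (h : IsStationary X P) (s : T) :
    IdentDistrib (X s) (X 0) P P := by
  simpa [Function.comp_def] using (h s).comp (u := fun x : T → E => x 0) (measurable_pi_apply 0)

end Stationary

/-! ### Second moments of white noise. -/

section WhiteNoise

variable {Ω : Type*} [MeasurableSpace Ω] {P : Measure Ω} {r : ℕ} {v : ℕ → Ω → (Fin r → ℝ)}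

namespace IsWhiteNoise

lemma hasLaw_apply (hv : IsWhiteNoise v P) (k : ℕ) (i : Fin r) :
    HasLaw (fun ω => v k ω i) (gaussianReal 0 1) P :=
  (measurePreserving_eval (fun _ : Fin r => gaussianReal 0 1) i).fun_comp_hasLaw (hv.hasLaw k)

lemma memLp (hv : IsWhiteNoise v P) (k : ℕ) (i : Fin r) : MemLp (fun ω => v k ω i) 2 P :=
  memLp_two_of_hasLaw (hv.hasLaw_apply k i)

lemma covMatrix_eq [IsProbabilityMeasure P] (hv : IsWhiteNoise v P) (k l : ℕ) :
    covMatrix (v k) (v l) P = if k = l then 1 else 0 := by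
  split_ifs with hkl
  · subst hkl
    ext i j
    have hind : iIndepFun (fun i ω => v k ω i) P :=
      (iIndepFun_iff_hasLaw_pi_pi fun i => hv.hasLaw_apply k i).2 (hv.hasLaw k)
    rw [Matrix.one_apply]
    exact covariance_iid (hv.hasLaw_apply k) hind i j
  · ext i j
    exact ((hv.indep.indepFun hkl).comp (measurable_pi_apply i)
      (measurable_pi_apply j)).covariance_eq_zero (hv.memLp k i) (hv.memLp l j)

end IsWhiteNoise

end WhiteNoise

/-! ### Mean, covariances and law of a discrete-time model. -/

section DiscreteModel

variable {Ω : Type*} [MeasurableSpace Ω] {P : Measure Ω} {n r p : ℕ}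
  {A : Matrix (Fin n) (Fin n) ℝ} {B : Matrix (Fin n) (Fin r) ℝ} {C : Matrix (Fin p) (Fin n) ℝ}
  {x : ℕ → Ω → (Fin n → ℝ)} {v : ℕ → Ω → (Fin r → ℝ)} {ζ : ℕ → Ω → (Fin p → ℝ)}

namespace IsDiscreteModel

lemma memLp (hm : IsDiscreteModel A B C x v ζ P) (k : ℕ) (i : Fin n) :
    MemLp (fun ω => x k ω i) 2 P :=
  ((isGaussianProcess_uncurry hm.gaussian).hasGaussianLaw_eval (k, i)).memLp_two

lemma state_ae_eq (hm : IsDiscreteModel A B C x v ζ P) (k : ℕ) :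
    x (k + 1) =ᵐ[P] fun ω => A *ᵥ x k ω + B *ᵥ v k ω := by
  filter_upwards [hm.state_eq] with ω hω using hω k

variable [IsProbabilityMeasure P]

/-- Causality: x_j is built from x_0 and the noise strictly before time j. -/
lemma covMatrix_noise_state (hm : IsDiscreteModel A B C x v ζ P) {j k : ℕ} (hjk : j ≤ k) :
    covMatrix (v k) (x j) P = 0 := by
  have hv := hm.noise.memLp
  have hx := hm.memLp
  induction j with
  | zero =>
    ext i l
    refine (IndepFun.comp (φ := fun z : Fin n → ℝ => z l)
      (ψ := fun z : ℕ → Fin r → ℝ => z k i) hm.indep_init (measurable_pi_apply l)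
      (by fun_prop)).symm.covariance_eq_zero (hv k i) (hx 0 l)
  | succ j ih =>
    rw [covMatrix_congr (ae_eq_refl _) (hm.state_ae_eq j), covMatrix_add_right (hv k)
      (memLp_mulVec (hx j) A) (memLp_mulVec (hv j) B), covMatrix_mulVec_right (hv k) (hx j),
      covMatrix_mulVec_right (hv k) (hv j), ih (by omega), hm.noise.covMatrix_eq,
      if_neg (by omega)]
    simp

lemma covMatrix_state_succ (hm : IsDiscreteModel A B C x v ζ P) {j k : ℕ} (hjk : j ≤ k) :
    covMatrix (x (k + 1)) (x j) P = A * covMatrix (x k) (x j) P := by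
  have hv := hm.noise.memLp
  have hx := hm.memLp
  rw [covMatrix_congr (hm.state_ae_eq k) (ae_eq_refl _), covMatrix_add_left
    (memLp_mulVec (hx k) A) (memLp_mulVec (hv k) B) (hx j), covMatrix_mulVec_left (hx k) (hx j),
    covMatrix_mulVec_left (hv k) (hx j), hm.covMatrix_noise_state hjk, Matrix.mul_zero, add_zero]

lemma covMatrix_state_self (hm : IsDiscreteModel A B C x v ζ P) (k : ℕ) :
    covMatrix (x k) (x k) P = covMatrix (x 0) (x 0) P :=
  covMatrix_eq_of_identDistrib (hm.stationary.identDistrib k) (hm.memLp k)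

/-- Expand the covariance of x_1 by the state equation and use that stationarity makes it equal to
that of x_0. -/
lemma covMatrix_stein (hm : IsDiscreteModel A B C x v ζ P) :
    covMatrix (x 0) (x 0) P = A * covMatrix (x 0) (x 0) P * Aᵀ + B * Bᵀ := by
  have hv := hm.noise.memLp
  have hx := hm.memLp
  have hn : covMatrix (v 0) (x 1) P = Bᵀ := by
    rw [covMatrix_congr (ae_eq_refl _) (hm.state_ae_eq 0), covMatrix_add_right (hv 0)
      (memLp_mulVec (hx 0) A) (memLp_mulVec (hv 0) B), covMatrix_mulVec_right (hv 0) (hx 0),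
      covMatrix_mulVec_right (hv 0) (hv 0), hm.covMatrix_noise_state le_rfl, hm.noise.covMatrix_eq]
    simp
  have h10 := hm.covMatrix_state_succ (le_refl 0)
  rw [← hm.covMatrix_state_self 1]
  conv_lhs => rw [covMatrix_congr (hm.state_ae_eq 0) (ae_eq_refl _), covMatrix_add_left
    (memLp_mulVec (hx 0) A) (memLp_mulVec (hv 0) B) (hx 1), covMatrix_mulVec_left (hx 0) (hx 1),
    covMatrix_mulVec_left (hv 0) (hx 1), hn, covMatrix_comm (x 1) (x 0), h10]
  rw [Matrix.transpose_mul, ← covMatrix_comm, hm.covMatrix_state_self 1, Matrix.mul_assoc]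

lemma covMatrix_state (hm : IsDiscreteModel A B C x v ζ P) (k l : ℕ) :
    covMatrix (x (k + l)) (x k) P = A ^ l * covMatrix (x 0) (x 0) P := by
  induction l with
  | zero => rw [add_zero, pow_zero, Matrix.one_mul, hm.covMatrix_state_self]
  | succ l ih =>
    rw [← add_assoc, hm.covMatrix_state_succ (by omega), ih, pow_succ', Matrix.mul_assoc]

/-- The constant mean m satisfies m = Am, and 1 is not an eigenvalue of a stable A. -/
lemma integral_state (hm : IsDiscreteModel A B C x v ζ P) (hA : IsSchur A) (k : ℕ) (i : Fin n) :
    ∫ ω, x k ω i ∂P = 0 := by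
  have hxi : ∀ k i, Integrable (fun ω => x k ω i) P :=
    fun k i => (hm.memLp k i).integrable (by norm_num)
  have hvi : ∀ k i, Integrable (fun ω => v k ω i) P :=
    fun k i => (hm.noise.memLp k i).integrable (by norm_num)
  have hst : ∀ k i, ∫ ω, x k ω i ∂P = ∫ ω, x 0 ω i ∂P := fun k i =>
    ((hm.stationary.identDistrib k).comp (measurable_pi_apply i)).integral_eq
  have h0 : (fun i => ∫ ω, x 0 ω i ∂P) = 0 := by
    refine hA.eq_zero_of_mulVec_eq ?_
    ext i
    have hae : (fun ω => x (0 + 1) ω i) =ᵐ[P] fun ω => (A *ᵥ x 0 ω) i + (B *ᵥ v 0 ω) i := by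
      filter_upwards [hm.state_ae_eq 0] with ω hω
      rw [hω, Pi.add_apply]
    have hBv : (fun j => ∫ ω, v 0 ω j ∂P) = 0 := by
      ext j
      exact integral_of_hasLaw (hm.noise.hasLaw_apply 0 j)
    rw [← hst (0 + 1) i, integral_congr_ae hae, integral_add
      ((memLp_mulVec (hm.memLp 0) A i).integrable (by norm_num))
      ((memLp_mulVec (hm.noise.memLp 0) B i).integrable (by norm_num)),
      integral_mulVec (hxi 0), integral_mulVec (hvi 0), hBv, Matrix.mulVec_zero, Pi.zero_apply,
      add_zero]
  rw [hst]
  exact congrFun h0 i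

/-- The law of the state and output of a stable discrete-time model is determined by `A`, `B Bᵀ` and
`C`. -/
lemma identDistrib {Ω' : Type*} [MeasurableSpace Ω'] {P' : Measure Ω'} [IsProbabilityMeasure P']
    {r' : ℕ} {B' : Matrix (Fin n) (Fin r') ℝ} {x' : ℕ → Ω' → (Fin n → ℝ)}
    {v' : ℕ → Ω' → (Fin r' → ℝ)} {ζ' : ℕ → Ω' → (Fin p → ℝ)}
    (hm : IsDiscreteModel A B C x v ζ P) (hm' : IsDiscreteModel A B' C x' v' ζ' P')
    (hA : IsSchur A) (hB : B * Bᵀ = B' * B'ᵀ) :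
    IdentDistrib (fun ω (k : ℕ) => (x k ω, ζ k ω)) (fun ω (k : ℕ) => (x' k ω, ζ' k ω)) P P' := by
  have h0 : covMatrix (x 0) (x 0) P = covMatrix (x' 0) (x' 0) P' :=
    hA.stein_unique hm.covMatrix_stein (by rw [hB]; exact hm'.covMatrix_stein)
  have hcov : ∀ s t, covMatrix (x s) (x t) P = covMatrix (x' s) (x' t) P' := by
    intro s t
    rcases le_total t s with h | h
    · obtain ⟨l, rfl⟩ := Nat.exists_eq_add_of_le h
      rw [hm.covMatrix_state, hm'.covMatrix_state, h0]
    · obtain ⟨l, rfl⟩ := Nat.exists_eq_add_of_le h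
      rw [covMatrix_comm, hm.covMatrix_state, covMatrix_comm (x' _), hm'.covMatrix_state, h0]
  have hx : IdentDistrib (fun ω t => x t ω) (fun ω t => x' t ω) P P' :=
    identDistrib_of_covariance_eq hm.gaussian hm'.gaussian hm.measurable_state hm'.measurable_state
      (fun t i => by rw [hm.integral_state hA, hm'.integral_state hA])
      fun s t i j => congrFun (congrFun (hcov s t) i) j
  have hu : Measurable fun (z : ℕ → Fin n → ℝ) k => (z k, C *ᵥ z k) := by
    have : ∀ k, Measurable fun z : ℕ → Fin n → ℝ => C *ᵥ z k := fun k =>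
      (Continuous.matrix_mulVec continuous_const (continuous_apply k)).measurable
    fun_prop
  have hmeas : AEMeasurable (fun ω (k : ℕ) => (x k ω, ζ k ω)) P := by
    have h1 := hm.measurable_state
    have h2 := hm.measurable_output
    exact Measurable.aemeasurable (by fun_prop)
  have hmeas' : AEMeasurable (fun ω (k : ℕ) => (x' k ω, ζ' k ω)) P' := by
    have h1 := hm'.measurable_state
    have h2 := hm'.measurable_output
    exact Measurable.aemeasurable (by fun_prop)
  have e1 : (fun ω (k : ℕ) => (x k ω, C *ᵥ x k ω)) =ᵐ[P] fun ω k => (x k ω, ζ k ω) := by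
    filter_upwards [hm.output_eq] with ω hω
    ext k : 1
    rw [hω]
  have e2 : (fun ω (k : ℕ) => (x' k ω, C *ᵥ x' k ω)) =ᵐ[P'] fun ω k => (x' k ω, ζ' k ω) := by
    filter_upwards [hm'.output_eq] with ω hω
    ext k : 1
    rw [hω]
  -- The outputs equal Cx only almost surely, so both sides are first replaced by the measurable
  -- image of the state sequence.
  refine ((IdentDistrib.of_ae_eq hmeas e1.symm).trans (hx.comp hu)).trans
    (IdentDistrib.of_ae_eq hmeas' e2.symm).symm

end IsDiscreteModel

end DiscreteModel

/-! ### Sampling a continuous-time model. -/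

section Sampling

variable {Ω : Type*} [MeasurableSpace Ω] {P : Measure Ω} {n m p : ℕ}
  {F : Matrix (Fin n) (Fin n) ℝ} {G : Matrix (Fin n) (Fin m) ℝ} {H : Matrix (Fin p) (Fin n) ℝ}
  {x : ℝ≥0 → Ω → (Fin n → ℝ)} {w : ℝ≥0 → Ω → (Fin m → ℝ)} {ζ : ℝ≥0 → Ω → (Fin p → ℝ)}

lemma IsWiener.covariance_stochasticConvolution_of_indepFun [IsProbabilityMeasure P]
    (hw : IsWiener w P) {k : ℕ} {Z : Ω → Fin k → ℝ} (hZw : IndepFun Z (fun ω t => w t ω) P)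
    (hZ : ∀ j, MemLp (fun ω => Z ω j) 2 P) {a b : ℝ} (ha : 0 ≤ a) (hab : a ≤ b) (i : Fin n)
    (j : Fin k) : cov[fun ω => stochasticConvolution F G (fun t => w t.toNNReal ω) a b i,
      fun ω => Z ω j; P] = 0 := by
  refine hw.covariance_stochasticConvolution_eq_zero ha hab (hZ j) (fun l u v _ _ _ => ?_) i
  refine (IndepFun.comp (φ := fun z : Fin k → ℝ => z j) (ψ := fun z : ℝ≥0 → Fin m → ℝ =>
    z v.toNNReal l - z u.toNNReal l) hZw (measurable_pi_apply j)
    (by fun_prop)).symm.covariance_eq_zero ?_ (hZ j)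
  exact (hw.memLp _ _).sub (hw.memLp _ _)

namespace IsContinuousModel

lemma memLp (hm : IsContinuousModel F G H x w ζ P) (t : ℝ≥0) (i : Fin n) :
    MemLp (fun ω => x t ω i) 2 P :=
  ((isGaussianProcess_uncurry hm.gaussian).hasGaussianLaw_eval (t, i)).memLp_two

lemma state_ae_eq (hm : IsContinuousModel F G H x w ζ P) {a b : ℝ≥0} (hab : a ≤ b) :
    (fun ω => x b ω - NormedSpace.exp (((b : ℝ) - a) • F) *ᵥ x a ω) =ᵐ[P]
      fun ω => stochasticConvolution F G (fun t => w t.toNNReal ω) a b := by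
  filter_upwards [hm.continuous_paths, hm.wiener.continuous_paths, hm.state_eq] with ω hx hw h
  have := eq_add_stochasticConvolution (F := F) (G := G) (x := fun t => x t.toNNReal ω)
    (w := fun t => w t.toNNReal ω) (c := x 0 ω) (hx.comp continuous_real_toNNReal)
    (hw.comp continuous_real_toNNReal) (fun t ht => by
      have := h t.toNNReal
      rwa [Real.coe_toNNReal t ht] at this) a.coe_nonneg (b := b) (by exact_mod_cast hab)
  simp only [Real.toNNReal_coe] at this
  rw [this]
  exact add_sub_cancel_left _ _

variable [IsProbabilityMeasure P]

lemma covariance_init_stochasticConvolution (hm : IsContinuousModel F G H x w ζ P) {a b : ℝ}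
    (ha : 0 ≤ a) (hab : a ≤ b) (i j : Fin n) :
    cov[fun ω => stochasticConvolution F G (fun t => w t.toNNReal ω) a b i,
      fun ω => x 0 ω j; P] = 0 :=
  hm.wiener.covariance_stochasticConvolution_of_indepFun hm.indep_init (hm.memLp 0) ha hab i j

/-- Sampling a continuous-time model. The white noise is obtained by normalizing the one-step
prediction error of the sampled state. -/
lemma exists_isDiscreteModel (hm : IsContinuousModel F G H x w ζ P) (h : ℝ≥0)
    {B : Matrix (Fin n) (Fin n) ℝ} (hB : B * Bᵀ = gramian F G h)
    (hQ : (gramian F G h).PosDef) :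
    ∃ v : ℕ → Ω → (Fin n → ℝ),
      IsDiscreteModel (NormedSpace.exp ((h : ℝ) • F)) B H (sampled h x) v (sampled h ζ) P ∧
      ∀ k : ℕ, IsWienerIntegral
        (fun τ => NormedSpace.exp ((((k : ℝ) + 1) * (h : ℝ) - (τ : ℝ)) • F) * G) w
        ((k : ℝ≥0) * h) (((k : ℝ≥0) + 1) * h) (fun ω => B *ᵥ v k ω) P := by
  have hdet : IsUnit B.det := by
    have h1 : (B * Bᵀ).det ≠ 0 := by rw [hB]; exact hQ.det_pos.ne'
    rw [Matrix.det_mul, Matrix.det_transpose] at h1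
    exact isUnit_iff_ne_zero.2 (left_ne_zero_of_mul h1)
  have hBB : B * B⁻¹ = 1 := Matrix.mul_nonsing_inv B hdet
  have hBB' : B⁻¹ * B = 1 := Matrix.nonsing_inv_mul B hdet
  set A := NormedSpace.exp ((h : ℝ) • F) with hAdef
  set y := sampled h x with hy
  -- The prediction error is defined from the state itself, not from the integral: it is then
  -- measurable, linear in x, and satisfies the state equation everywhere.
  set e : ℕ → Ω → Fin n → ℝ := fun k ω => y (k + 1) ω - A *ᵥ y k ω with he
  set v : ℕ → Ω → Fin n → ℝ := fun k ω => B⁻¹ *ᵥ e k ω with hv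
  have hBv : ∀ k ω, B *ᵥ v k ω = e k ω := fun k ω => by
    rw [hv, Matrix.mulVec_mulVec, hBB, Matrix.one_mulVec]
  have hstep : ∀ k : ℕ, (k : ℝ) * h ≤ ((k : ℝ) + 1) * h := fun k => by
    nlinarith [h.2, h.coe_nonneg]
  have hpos : ∀ k : ℕ, 0 ≤ (k : ℝ) * h := fun k => by positivity
  have hstep' : ∀ k : ℕ, (k : ℝ≥0) * h ≤ ((k : ℝ≥0) + 1) * h := fun k => by
    exact_mod_cast hstep k
  have hconv : ∀ k : ℕ, e k =ᵐ[P] fun ω =>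
      stochasticConvolution F G (fun t => w t.toNNReal ω) ((k : ℝ) * h) (((k : ℝ) + 1) * h) := by
    intro k
    have h1 := hm.state_ae_eq (hstep' k)
    push_cast at h1
    have h2 : ((k : ℝ) + 1) * h - k * h = h := by ring
    rw [h2] at h1
    refine Filter.EventuallyEq.trans (Eventually.of_forall fun ω => ?_) h1
    simp [he, hy, sampled, hAdef]
  have hemeas : ∀ k, Measurable (e k) := fun k =>
    (hm.measurable_state _).sub
      ((Continuous.matrix_mulVec continuous_const continuous_id).measurable.comp
        (hm.measurable_state _))
  have hvmeas : ∀ k, Measurable (v k) := fun k =>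
    (Continuous.matrix_mulVec continuous_const continuous_id).measurable.comp (hemeas k)
  have heL : ∀ k i, MemLp (fun ω => e k ω i) 2 P := fun k i =>
    (hm.memLp _ i).sub (memLp_mulVec (hm.memLp _) A i)
  have hvL : ∀ k i, MemLp (fun ω => v k ω i) 2 P := fun k => memLp_mulVec (heL k) B⁻¹
  have hecov : ∀ k l, covMatrix (e k) (e l) P = if k = l then B * Bᵀ else 0 := by
    intro k l
    rw [covMatrix_congr (hconv k) (hconv l)]
    have hle : ∀ {k l : ℕ}, k < l → ((k : ℝ) + 1) * h ≤ l * h := fun hkl =>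
      mul_le_mul_of_nonneg_right (by exact_mod_cast hkl) h.coe_nonneg
    split_ifs with hkl
    · subst hkl
      ext i j
      rw [hB]
      simp only [covMatrix, Matrix.of_apply]
      rw [hm.wiener.covariance_stochasticConvolution (hpos k) (hstep k)]
      congr 1
      ring
    · ext i j
      simp only [covMatrix, Matrix.of_apply, Matrix.zero_apply]
      rcases lt_or_gt_of_ne hkl with h1 | h1
      · exact hm.wiener.covariance_stochasticConvolution_disjoint (hpos k) (hstep k) (hle h1)
          (hstep l) i j
      · rw [covariance_comm]
        exact hm.wiener.covariance_stochasticConvolution_disjoint (hpos l) (hstep l) (hle h1)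
          (hstep k) j i
  -- The normalization is B⁻¹(BB')(B⁻¹)' = 1.
  have hvcov : ∀ k l, covMatrix (v k) (v l) P = if k = l then 1 else 0 := by
    intro k l
    rw [hv, covMatrix_mulVec_left (heL k) (hvL l), covMatrix_mulVec_right (heL k) (heL l), hecov]
    split_ifs with hkl
    · rw [Matrix.mul_assoc, ← Matrix.transpose_mul, hBB', Matrix.transpose_one, Matrix.mul_one,
        hBB']
    · simp
  have hvx : ∀ k, covMatrix (x 0) (v k) P = 0 := by
    intro k
    rw [hv, covMatrix_mulVec_right (hm.memLp 0) (heL k)]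
    have : covMatrix (x 0) (e k) P = 0 := by
      rw [covMatrix_congr (ae_eq_refl _) (hconv k), covMatrix_comm]
      ext i j
      exact hm.covariance_init_stochasticConvolution (hpos k) (hstep k) j i
    rw [this, Matrix.zero_mul]
  have hvmean : ∀ k i, ∫ ω, v k ω i ∂P = 0 := by
    intro k i
    have : (fun j => ∫ ω, e k ω j ∂P) = 0 := by
      ext j
      have hj : (fun ω => e k ω j) =ᵐ[P] fun ω => stochasticConvolution F G
          (fun t => w t.toNNReal ω) ((k : ℝ) * h) (((k : ℝ) + 1) * h) j := by
        filter_upwards [hconv k] with ω hω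
        rw [hω]
      rw [integral_congr_ae hj,
        hm.wiener.integral_stochasticConvolution (hpos k) (hstep k), Pi.zero_apply]
    rw [hv]
    simp only
    rw [integral_mulVec fun j => (heL k j).integrable (by norm_num), this, Matrix.mulVec_zero,
      Pi.zero_apply]
  -- The initial state and all the noise are linear in x at finitely many times, hence jointly
  -- Gaussian. This turns the vanishing covariances above into independence.
  have hgauss : IsGaussianProcess (Sum.elim (fun (i : Fin n) ω => x 0 ω i)
      fun (q : ℕ × Fin n) ω => v q.1 ω q.2) P := by
    classical
    refine hm.gaussian.of_isGaussianProcess ?_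
    rintro (i | ⟨k, i⟩)
    · exact ⟨{0}, (ContinuousLinearMap.proj i).comp (ContinuousLinearMap.proj (R := ℝ)
        (φ := fun _ : ({0} : Finset ℝ≥0) => Fin n → ℝ) ⟨0, by simp⟩), fun ω => rfl⟩
    · let J : Finset ℝ≥0 := {((k + 1 : ℕ) : ℝ≥0) * h, (k : ℝ≥0) * h}
      let p1 : (J → Fin n → ℝ) →L[ℝ] (Fin n → ℝ) := ContinuousLinearMap.proj (R := ℝ)
        (φ := fun _ : J => Fin n → ℝ) ⟨((k + 1 : ℕ) : ℝ≥0) * h, by simp [J]⟩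
      let p2 : (J → Fin n → ℝ) →L[ℝ] (Fin n → ℝ) := ContinuousLinearMap.proj (R := ℝ)
        (φ := fun _ : J => Fin n → ℝ) ⟨(k : ℝ≥0) * h, by simp [J]⟩
      exact ⟨J, (ContinuousLinearMap.proj i).comp ((Matrix.mulVecLin B⁻¹).toContinuousLinearMap.comp
        (p1 - (Matrix.mulVecLin A).toContinuousLinearMap.comp p2)), fun ω => rfl⟩
  have hVgauss : IsGaussianProcess (fun (q : ℕ × Fin n) ω => v q.1 ω q.2) P :=
    hgauss.comp_right Sum.inr
  have hvij : ∀ k i, AEMeasurable (fun ω => v k ω i) P := fun k i => (hvL k i).1.aemeasurable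
  have hlaw1 : ∀ k i, HasLaw (fun ω => v k ω i) (gaussianReal 0 1) P := by
    intro k i
    refine ⟨hvij k i, ?_⟩
    rw [(hVgauss.hasGaussianLaw_eval (k, i)).map_eq_gaussianReal]
    have hvar : Var[fun ω => v k ω i; P] = 1 := by
      rw [← covariance_self (hvij k i)]
      have := congrFun (congrFun (hvcov k k) i) i
      simpa [covMatrix] using this
    have e1 : ∫ ω, v k ω i ∂P = 0 := hvmean k i
    rw [e1, hvar, Real.toNNReal_one]
  have hindq : ∀ k, iIndepFun (fun i ω => v k ω i) P := by
    intro k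
    -- The independence criterion concerns families of processes, so each coordinate is treated as a
    -- process indexed by one point.
    have h1 : IsGaussianProcess (fun (q : (_ : Fin n) × Unit) ω => v k ω q.1) P :=
      hVgauss.comp_right fun q : (_ : Fin n) × Unit => (k, q.1)
    have h2 := h1.iIndepFun_of_covariance_eq_zero (X := fun i (_ : Unit) ω => v k ω i)
      (fun i _ => hvij k i) fun i j hij _ _ => by
        have := congrFun (congrFun (hvcov k k) i) j
        simpa [covMatrix, hij] using this
    exact h2.comp (fun i (z : Unit → ℝ) => z ()) fun i => measurable_pi_apply ()
  have hindv : iIndepFun v P := by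
    have h1 : IsGaussianProcess (fun (q : (_ : ℕ) × Fin n) ω => v q.1 ω q.2) P :=
      hVgauss.comp_right fun q : (_ : ℕ) × Fin n => (q.1, q.2)
    exact h1.iIndepFun_of_covariance_eq_zero (X := fun k i ω => v k ω i) hvij
      fun k l hkl i j => by
        have := congrFun (congrFun (hvcov k l) i) j
        simpa [covMatrix, hkl] using this
  have hind0 : IndepFun (y 0) (fun ω k => v k ω) P := by
    have h1 := hgauss.indepFun_of_covariance_eq_zero (fun i => (hm.memLp 0 i).1.aemeasurable)
      (fun q => hvij q.1 q.2) fun i q => congrFun (congrFun (hvx q.1) i) q.2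
    have h2 := h1.comp (φ := id) (ψ := fun (z : ℕ × Fin n → ℝ) k i => z (k, i)) measurable_id
      (by fun_prop)
    have h3 : y 0 = x 0 := by simp [hy, sampled]
    rw [h3]
    exact h2
  refine ⟨v, ⟨⟨hvmeas, fun k => (hindq k).hasLaw_pi (hlaw1 k), hindv⟩,
    fun k => hm.measurable_state _, fun k => hm.measurable_output _, hind0,
    hm.gaussian.comp_right fun k : ℕ => (k : ℝ≥0) * h, fun s => ?_,
    Eventually.of_forall fun ω k => ?_, ?_⟩, fun k => ?_⟩
  · have := (hm.stationary ((s : ℝ≥0) * h)).comp (u := fun (z : ℝ≥0 → Fin n → ℝ) (k : ℕ) =>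
      z ((k : ℝ≥0) * h)) (by fun_prop)
    convert this using 1
    · ext ω k i
      simp [sampled, hy, add_mul]
    · rfl
  · rw [hBv]
    simp [he]
  · filter_upwards [hm.output_eq] with ω hω k using hω _
  · have := hm.wiener.isWienerIntegral_stochasticConvolution (F := F) (G := G) (hstep' k)
      (I := fun ω => B *ᵥ v k ω) (by
        filter_upwards [hconv k] with ω hω
        rw [hBv, hω]
        push_cast
        rfl)
    push_cast at this
    exact this

end IsContinuousModel

end Sampling

/-! ### Finite linear combinations of a Gaussian process. -/

section GaussianSpan

variable {Ω S T : Type*} [MeasurableSpace Ω] {P : Measure Ω}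

lemma isGaussianProcess_of_mem_span {Z : T → Ω → ℝ} {Y : S → Ω → ℝ} (hZ : IsGaussianProcess Z P)
    (h : ∀ s, Y s ∈ Submodule.span ℝ (Set.range Z)) : IsGaussianProcess Y P := by
  refine hZ.of_isGaussianProcess fun s => ?_
  obtain ⟨c, hc⟩ := Finsupp.mem_span_range_iff_exists_finsupp.1 (h s)
  refine ⟨c.support, ∑ i : c.support, c i • ContinuousLinearMap.proj i, fun ω => ?_⟩
  rw [← hc, Finsupp.sum, Finset.sum_apply, ← Finset.sum_coe_sort]
  simp

end GaussianSpan

/-! ### Solving the integral equation pathwise. -/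

section Solution

variable {n m : ℕ} {F : Matrix (Fin n) (Fin n) ℝ} {G : Matrix (Fin n) (Fin m) ℝ}

/-- Factoring exp(tF) out of the integral leaves an integrand independent of t, so the result can be
differentiated in t. -/
lemma stochasticConvolution_eq {w : ℝ → Fin m → ℝ} (hw : Continuous w) (t : ℝ) :
    stochasticConvolution F G w 0 t = G *ᵥ w t - NormedSpace.exp (t • F) *ᵥ (G *ᵥ w 0) +
      NormedSpace.exp (t • F) *ᵥ fun k =>
        ∫ s in (0 : ℝ)..t, (NormedSpace.exp ((0 - s) • F) *ᵥ (F *ᵥ (G *ᵥ w s))) k := by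
  have hwj : ∀ j, Continuous fun s => w s j := fun j => (continuous_apply j).comp hw
  have hint : ∀ (c : ℝ) (i : Fin n) (j : Fin m), IntervalIntegrable (fun s =>
      (NormedSpace.exp ((c - s) • F) * (F * G)) i j * w s j) volume 0 t := fun c i j =>
    ((continuous_exp_sub_mul_apply F (F * G) c i j).mul (hwj j)).intervalIntegrable _ _
  ext i
  have h1 : (NormedSpace.exp (t • F) *ᵥ fun k =>
        ∫ s in (0 : ℝ)..t, (NormedSpace.exp ((0 - s) • F) *ᵥ (F *ᵥ (G *ᵥ w s))) k) i
      = ∑ j, ∫ s in (0 : ℝ)..t, (NormedSpace.exp ((t - s) • F) * (F * G)) i j * w s j := by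
    have h2 : ∀ (c : ℝ) (k : Fin n) (s : ℝ),
        (NormedSpace.exp ((c - s) • F) *ᵥ (F *ᵥ (G *ᵥ w s))) k
        = ∑ j, (NormedSpace.exp ((c - s) • F) * (F * G)) k j * w s j := by
      intro c k s
      rw [Matrix.mulVec_mulVec, Matrix.mulVec_mulVec, Matrix.mul_assoc]
      rfl
    rw [← intervalIntegral.integral_finsetSum fun j _ => hint t i j]
    simp only [Matrix.mulVec, dotProduct]
    have h3 : ∀ k, IntervalIntegrable (fun s =>
        (NormedSpace.exp ((0 - s) • F) *ᵥ (F *ᵥ (G *ᵥ w s))) k) volume 0 t := by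
      intro k
      simp only [h2]
      exact (continuous_finsetSum _ fun j _ =>
        (continuous_exp_sub_mul_apply F (F * G) 0 k j).mul (hwj j)).intervalIntegrable _ _
    have h4 : ∀ k, NormedSpace.exp (t • F) i k * ∫ s in (0 : ℝ)..t,
        (NormedSpace.exp ((0 - s) • F) *ᵥ (F *ᵥ (G *ᵥ w s))) k = ∫ s in (0 : ℝ)..t,
        NormedSpace.exp (t • F) i k * (NormedSpace.exp ((0 - s) • F) *ᵥ (F *ᵥ (G *ᵥ w s))) k :=
      fun k => (intervalIntegral.integral_const_mul _ _).symm
    refine (Finset.sum_congr rfl fun k _ => h4 k).trans ?_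
    rw [← intervalIntegral.integral_finsetSum fun k _ => (h3 k).const_mul _]
    refine intervalIntegral.integral_congr fun s _ => ?_
    have h5 : (NormedSpace.exp (t • F) *ᵥ
        (NormedSpace.exp ((0 - s) • F) *ᵥ (F *ᵥ (G *ᵥ w s)))) i
        = (NormedSpace.exp ((t - s) • F) *ᵥ (F *ᵥ (G *ᵥ w s))) i := by
      rw [Matrix.mulVec_mulVec, ← exp_add_smul]
      congr 4
      ring
    exact h5.trans (h2 t i s)
  rw [Pi.add_apply, h1, Pi.sub_apply, stochasticConvolution]
  simp only [partsIntegral, neg_mul, intervalIntegral.integral_neg, sub_neg_eq_add,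
    Finset.sum_add_distrib, Finset.sum_sub_distrib, sub_self, zero_smul, NormedSpace.exp_zero,
    Matrix.one_mul, sub_zero, Matrix.mulVec_mulVec]
  rfl

/-- The variation of constants formula. -/
lemma exp_mulVec_add_stochasticConvolution {w : ℝ → Fin m → ℝ} (hw : Continuous w)
    (q : Fin n → ℝ) {x : ℝ → Fin n → ℝ}
    (hx : ∀ t, x t = NormedSpace.exp (t • F) *ᵥ q + stochasticConvolution F G w 0 t) :
    Continuous x ∧ ∀ t, x t = (q - G *ᵥ w 0) + (∫ s in (0 : ℝ)..t, F *ᵥ x s) + G *ᵥ w t := by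
  open scoped Matrix.Norms.Operator in
  have hwj : ∀ j, Continuous fun s => w s j := fun j => (continuous_apply j).comp hw
  have hgc : ∀ k, Continuous fun s : ℝ =>
      (NormedSpace.exp ((0 - s) • F) *ᵥ (F *ᵥ (G *ᵥ w s))) k := by
    intro k
    have h2 : ∀ s : ℝ, (NormedSpace.exp ((0 - s) • F) *ᵥ (F *ᵥ (G *ᵥ w s))) k
        = ∑ j, (NormedSpace.exp ((0 - s) • F) * (F * G)) k j * w s j := by
      intro s
      rw [Matrix.mulVec_mulVec, Matrix.mulVec_mulVec, Matrix.mul_assoc]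
      rfl
    simp only [h2]
    exact continuous_finsetSum _ fun j _ =>
      (continuous_exp_sub_mul_apply F (F * G) 0 k j).mul (hwj j)
  -- u is exp(-tF)(x - Gw), the differentiable part of the solution in coordinates moving with the
  -- flow.
  obtain ⟨u, hu⟩ : ∃ u : ℝ → Fin n → ℝ, ∀ t k, u t k = (q - G *ᵥ w 0) k + ∫ s in (0 : ℝ)..t,
      (NormedSpace.exp ((0 - s) • F) *ᵥ (F *ᵥ (G *ᵥ w s))) k := ⟨_, fun _ _ => rfl⟩
  have hud : ∀ t k, HasDerivAt (fun t => u t k)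
      ((NormedSpace.exp ((0 - t) • F) *ᵥ (F *ᵥ (G *ᵥ w t))) k) t := by
    intro t k
    have := (intervalIntegral.integral_hasDerivAt_right ((hgc k).intervalIntegrable 0 t)
      ((hgc k).stronglyMeasurableAtFilter _ _) (hgc k).continuousAt).const_add ((q - G *ᵥ w 0) k)
    exact this.congr_of_eventuallyEq (Eventually.of_forall fun s => hu s k)
  have hxz : ∀ t, x t = NormedSpace.exp (t • F) *ᵥ u t + G *ᵥ w t := by
    intro t
    have : u t = (q - G *ᵥ w 0) + fun k => ∫ s in (0 : ℝ)..t,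
      (NormedSpace.exp ((0 - s) • F) *ᵥ (F *ᵥ (G *ᵥ w s))) k := funext fun k => hu t k
    rw [this, hx, stochasticConvolution_eq hw, Matrix.mulVec_add, Matrix.mulVec_sub]
    abel
  have hEd := fun t i k => hasDerivAt_matrix_iff.1 (hasDerivAt_exp_smul' F t) i k
  have hzd : ∀ t, HasDerivAt (fun t => NormedSpace.exp (t • F) *ᵥ u t) (F *ᵥ x t) t := by
    intro t
    refine hasDerivAt_pi.2 fun i => ?_
    refine (HasDerivAt.fun_sum (u := Finset.univ) fun k _ =>
      (hEd t i k).mul (hud t k)).congr_deriv ?_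
    rw [Finset.sum_add_distrib]
    have e1 : ∑ k, (F * NormedSpace.exp (t • F)) i k * u t k
        = (F *ᵥ (NormedSpace.exp (t • F) *ᵥ u t)) i := by
      rw [Matrix.mulVec_mulVec]; rfl
    have e2 : ∑ k, NormedSpace.exp (t • F) i k *
        (NormedSpace.exp ((0 - t) • F) *ᵥ (F *ᵥ (G *ᵥ w t))) k = (F *ᵥ (G *ᵥ w t)) i := by
      have : (NormedSpace.exp (t • F) *ᵥ (NormedSpace.exp ((0 - t) • F) *ᵥ (F *ᵥ (G *ᵥ w t)))) i
          = (F *ᵥ (G *ᵥ w t)) i := by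
        rw [Matrix.mulVec_mulVec, ← exp_add_smul]
        simp
      exact this
    rw [e1, e2, hxz t, Matrix.mulVec_add, Pi.add_apply]
  have hzc : Continuous fun t => NormedSpace.exp (t • F) *ᵥ u t :=
    continuous_iff_continuousAt.2 fun t => (hzd t).continuousAt
  have hxc : Continuous x := by
    rw [funext hxz]
    exact hzc.add (continuous_const.matrix_mulVec hw)
  refine ⟨hxc, fun t => ?_⟩
  have h1 := intervalIntegral.integral_eq_sub_of_hasDerivAt (fun s _ => hzd s)
    ((continuous_const.matrix_mulVec hxc : Continuous fun s => F *ᵥ x s).intervalIntegrable 0 t)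
  have h0 : NormedSpace.exp ((0 : ℝ) • F) *ᵥ u 0 = q - G *ᵥ w 0 := by
    rw [zero_smul, NormedSpace.exp_zero, Matrix.one_mulVec]
    ext k
    simp [hu]
  rw [h0] at h1
  rw [h1, hxz t]
  abel

end Solution

/-! ### Measurability of the stochastic convolution. -/

section Measurability

variable {Ω : Type*} [MeasurableSpace Ω] {n m : ℕ} {F : Matrix (Fin n) (Fin n) ℝ}
  {G : Matrix (Fin n) (Fin m) ℝ}

lemma measurable_stochasticConvolution {w : ℝ → Ω → Fin m → ℝ} (hw : ∀ t, Measurable (w t))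
    (hc : ∀ ω, Continuous fun t => w t ω) {a b : ℝ} (hab : a ≤ b) :
    Measurable fun ω => stochasticConvolution F G (fun t => w t ω) a b := by
  have hwj : ∀ t j, Measurable fun ω => w t ω j := fun t j => (measurable_pi_apply j).comp (hw t)
  refine measurable_pi_lambda _ fun i => Finset.measurable_fun_sum _ fun j _ => ?_
  refine (((hwj b j).const_mul _).sub ((hwj a j).const_mul _)).sub ?_
  refine measurable_of_tendsto_metrizable (f := fun (M : ℕ) ω => ∑ k ∈ Finset.range M,
    (b - a) / M * (-(NormedSpace.exp ((b - gridPoint a b M k) • F) * (F * G)) i j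
      * w (gridPoint a b M k) ω j))
    (fun M => Finset.measurable_fun_sum _ fun k _ => ((hwj _ j).const_mul _).const_mul _) ?_
  refine tendsto_pi_nhds.2 fun ω => ?_
  exact tendsto_riemannSum (g := fun s => -(NormedSpace.exp ((b - s) • F) * (F * G)) i j * w s ω j)
    ((continuous_exp_sub_mul_apply F (F * G) b i j).neg.mul ((continuous_apply j).comp (hc ω))) hab

end Measurability

/-! ### A probability space carrying the initial vector and the Wiener process. -/

section NoiseSpace

/-- There is a probability space with a standard normal vector and an independent Wiener process
with continuous paths. -/
lemma exists_normal_wiener (r m : ℕ) : ∃ (Ω : Type) (_ : MeasurableSpace Ω) (P : Measure Ω)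
    (ξ : Ω → Fin r → ℝ) (w : ℝ≥0 → Ω → (Fin m → ℝ)), IsProbabilityMeasure P ∧ Measurable ξ ∧
    HasLaw ξ (Measure.pi fun _ : Fin r => gaussianReal 0 1) P ∧ IsWiener w P ∧
    (∀ ω, Continuous fun t => w t ω) ∧ IndepFun ξ (fun ω t => w t ω) P := by
  obtain ⟨Ω₁, _, P₁, β, hP₁, hβm, hβc, hβ⟩ := exists_brownian
  have hβm' : Measurable fun ω t => β t ω := measurable_pi_lambda _ hβm
  set P : Measure ((Fin r → ℝ) × (Fin m → Ω₁)) :=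
    (Measure.pi fun _ : Fin r => gaussianReal 0 1).prod (Measure.pi fun _ : Fin m => P₁) with hP
  have hsnd : MeasurePreserving (Prod.snd : (Fin r → ℝ) × (Fin m → Ω₁) → Fin m → Ω₁) P
      (Measure.pi fun _ : Fin m => P₁) := measurePreserving_snd
  have hcoord : ∀ j, MeasurePreserving (fun ω : (Fin r → ℝ) × (Fin m → Ω₁) => ω.2 j) P P₁ :=
    fun j => (measurePreserving_eval (fun _ : Fin m => P₁) j).comp hsnd
  have hind : iIndepFun (fun (j : Fin m) (ω : (Fin r → ℝ) × (Fin m → Ω₁)) (t : ℝ≥0) =>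
      β t (ω.2 j)) P := by
    have h1 := iIndepFun_pi (μ := fun _ : Fin m => P₁) (X := fun _ ω t => β t ω)
      fun _ => hβm'.aemeasurable
    have hm1 : ∀ j : Fin m, Measurable fun (ω : Fin m → Ω₁) (t : ℝ≥0) => β t (ω j) :=
      fun j => hβm'.comp (measurable_pi_apply j)
    have hm2 : Measurable fun (ω : Fin m → Ω₁) (j : Fin m) (t : ℝ≥0) => β t (ω j) :=
      measurable_pi_lambda _ hm1
    rw [iIndepFun_iff_map_fun_eq_pi_map fun j => (hm1 j).aemeasurable] at h1
    -- Independence is known on the power of the Brownian space; written as an equality of laws, it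
    -- is pulled back along the second projection.
    refine (iIndepFun_iff_map_fun_eq_pi_map
      fun j => ((hm1 j).comp measurable_snd).aemeasurable).2 ?_
    rw [← hsnd.map_eq] at h1
    simp only [Measure.map_map hm2 measurable_snd, Measure.map_map (hm1 _) measurable_snd] at h1
    exact h1
  refine ⟨_, inferInstance, P, Prod.fst, fun t ω j => β t (ω.2 j), inferInstance, measurable_fst,
    measurePreserving_fst.hasLaw, ⟨fun t => ?_, fun j => ⟨⟨fun I => ?_⟩, ?_⟩, hind⟩,
    fun ω => ?_, ?_⟩
  · have := hβm t
    fun_prop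
  · exact (hβ.hasLaw I).comp (hcoord j).hasLaw
  · exact Eventually.of_forall fun ω => hβc _
  · exact continuous_pi fun j => hβc _
  · have hY : Measurable fun (ω : Fin m → Ω₁) (t : ℝ≥0) (j : Fin m) => β t (ω j) := by
      have := hβm
      fun_prop
    exact indepFun_prod (X := id) measurable_id hY

end NoiseSpace

/-! ### Construction of a stationary continuous-time model. -/

section Construction

variable {Ω : Type*} [MeasurableSpace Ω] {P : Measure Ω} [IsProbabilityMeasure P] {n m r p : ℕ}

/-- A finite subfamily is a linear image of ξ together with the components of w on a common finite
set J of times, and these are independent Gaussian vectors. -/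
lemma IsWiener.isGaussianProcess_sum {ξ : Ω → Fin r → ℝ} {w : ℝ≥0 → Ω → (Fin m → ℝ)}
    (hw : IsWiener w P) (hξ : HasLaw ξ (Measure.pi fun _ : Fin r => gaussianReal 0 1) P)
    (hind : IndepFun ξ (fun ω t => w t ω) P) :
    IsGaussianProcess (Sum.elim (fun i ω => ξ ω i) fun (q : Fin m × ℝ≥0) ω => w q.2 ω q.1) P where
  hasGaussianLaw I := by
    classical
    -- The time 0 assigned to the indices of ξ is a dummy value.
    let J : Finset ℝ≥0 := I.image (Sum.elim (fun _ => 0) fun q => q.2)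
    have h1 : HasGaussianLaw (fun ω (j : Fin m) => J.restrict fun t => w t ω j) P := by
      have h2 : iIndepFun (fun (j : Fin m) ω => J.restrict fun t => w t ω j) P :=
        hw.indep.comp (fun _ z => J.restrict z) fun _ => by fun_prop
      exact h2.hasGaussianLaw fun j =>
        (IsPreBrownianReal.isGaussianProcess (hw.brownian j).toIsPreBrownianReal).hasGaussianLaw J
    have h2 : HasGaussianLaw ξ P := by
      have hl : ∀ i, HasLaw (fun ω => ξ ω i) (gaussianReal 0 1) P := fun i =>
        (measurePreserving_eval (fun _ : Fin r => gaussianReal 0 1) i).fun_comp_hasLaw hξ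
      exact ((iIndepFun_iff_hasLaw_pi_pi hl).2 hξ).hasGaussianLaw fun i => (hl i).hasGaussianLaw
    have h3 : IndepFun ξ (fun ω (j : Fin m) => J.restrict fun t => w t ω j) P :=
      hind.comp (φ := id) (ψ := fun (z : ℝ≥0 → Fin m → ℝ) j => J.restrict fun t => z t j)
        measurable_id (by fun_prop)
    have h4 := h3.hasGaussianLaw h2 h1
    let L : ((Fin r → ℝ) × (Fin m → J → ℝ)) →L[ℝ] (I → ℝ) := ContinuousLinearMap.pi fun q =>
      match q with
      | ⟨Sum.inl i, _⟩ => (ContinuousLinearMap.proj i).comp (ContinuousLinearMap.fst ℝ _ _)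
      | ⟨Sum.inr q, h⟩ => (ContinuousLinearMap.proj (R := ℝ) (φ := fun _ : J => ℝ)
          ⟨q.2, Finset.mem_image.2 ⟨_, h, rfl⟩⟩).comp ((ContinuousLinearMap.proj (R := ℝ)
            (φ := fun _ : Fin m => J → ℝ) q.1).comp (ContinuousLinearMap.snd ℝ _ _))
    refine (h4.map L).congr (Eventually.of_forall fun ω => ?_)
    ext ⟨q | q, h⟩ <;> rfl

variable {F S : Matrix (Fin n) (Fin n) ℝ} {G : Matrix (Fin n) (Fin m) ℝ}
  {C : Matrix (Fin p) (Fin n) ℝ}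

/-- Variation of constants, started from a normal vector with stationary covariance, yields a
continuous-time model. -/
lemma IsWiener.isContinuousModel {ξ : Ω → Fin r → ℝ} {w : ℝ≥0 → Ω → (Fin m → ℝ)}
    (hw : IsWiener w P) (hwc : ∀ ω, Continuous fun t => w t ω) (hξm : Measurable ξ)
    (hξ : HasLaw ξ (Measure.pi fun _ : Fin r => gaussianReal 0 1) P)
    (hind : IndepFun ξ (fun ω t => w t ω) P) {R : Matrix (Fin n) (Fin r) ℝ} (hR : R * Rᵀ = S)
    (hG : G * Gᵀ = -(F * S + S * Fᵀ)) {x : ℝ≥0 → Ω → (Fin n → ℝ)}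
    (hx : ∀ t ω, x t ω = NormedSpace.exp ((t : ℝ) • F) *ᵥ (R *ᵥ ξ ω)
      + stochasticConvolution F G (fun t => w t.toNNReal ω) 0 t) :
    IsContinuousModel F G C x w (fun t ω => C *ᵥ x t ω) P := by
  have hwc' : ∀ ω, Continuous fun t : ℝ => w t.toNNReal ω :=
    fun ω => (hwc ω).comp continuous_real_toNNReal
  have hl : ∀ i, HasLaw (fun ω => ξ ω i) (gaussianReal 0 1) P := fun i =>
    (measurePreserving_eval (fun _ : Fin r => gaussianReal 0 1) i).fun_comp_hasLaw hξ
  have hξL : ∀ i, MemLp (fun ω => ξ ω i) 2 P := fun i => memLp_two_of_hasLaw (hl i)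
  set x₀ : Ω → Fin n → ℝ := fun ω => R *ᵥ ξ ω with hx₀
  have hmul : ∀ {k l : ℕ} (M : Matrix (Fin k) (Fin l) ℝ), Measurable fun z : Fin l → ℝ => M *ᵥ z :=
    fun M => (Continuous.matrix_mulVec continuous_const continuous_id).measurable
  replace hx : ∀ t ω, x t ω = NormedSpace.exp ((t : ℝ) • F) *ᵥ x₀ ω
      + stochasticConvolution F G (fun t => w t.toNNReal ω) 0 t := hx
  have hx₀m : Measurable x₀ := (hmul R).comp hξm
  have hx₀L : ∀ i, MemLp (fun ω => x₀ ω i) 2 P := memLp_mulVec hξL R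
  have hx₀w : IndepFun x₀ (fun ω t => w t ω) P := hind.comp (hmul R) measurable_id
  have hpath : ∀ ω, _ := fun ω => exp_mulVec_add_stochasticConvolution (F := F) (G := G) (hwc' ω)
    (x₀ ω) (x := fun t => NormedSpace.exp (t • F) *ᵥ x₀ ω
      + stochasticConvolution F G (fun t => w t.toNNReal ω) 0 t) fun _ => rfl
  have hx0 : ∀ ω, x 0 ω = x₀ ω := by
    intro ω
    rw [hx, NNReal.coe_zero, zero_smul, NormedSpace.exp_zero, Matrix.one_mulVec,
      stochasticConvolution_eq (hwc' ω)]
    simp only [intervalIntegral.integral_same, zero_smul, NormedSpace.exp_zero, Matrix.one_mulVec,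
      sub_self, zero_add]
    exact add_zero _
  have hxm : ∀ t, Measurable (x t) := by
    intro t
    rw [funext (hx t)]
    exact ((hmul _).comp hx₀m).add
      (measurable_stochasticConvolution (fun t => hw.measurable _) hwc' t.coe_nonneg)
  have hNL : ∀ {a b : ℝ}, 0 ≤ a → a ≤ b → ∀ i, MemLp (fun ω =>
      stochasticConvolution F G (fun t => w t.toNNReal ω) a b i) 2 P :=
    fun ha hab i => hw.memLp_stochasticConvolution ha hab i
  have hEL : ∀ (t : ℝ) i, MemLp (fun ω => (NormedSpace.exp (t • F) *ᵥ x₀ ω) i) 2 P :=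
    fun t => memLp_mulVec hx₀L _
  have hxL : ∀ t i, MemLp (fun ω => x t ω i) 2 P := by
    intro t i
    simp only [hx]
    exact (hEL t i).add (hNL le_rfl t.coe_nonneg i)
  have hmean : ∀ t i, ∫ ω, x t ω i ∂P = 0 := by
    intro t i
    have h0 : (fun i => ∫ ω, x₀ ω i ∂P) = 0 := by
      ext i
      rw [integral_mulVec fun i => (hξL i).integrable (by norm_num)]
      simp [fun i => integral_of_hasLaw (hl i), Matrix.mulVec, dotProduct]
    simp only [hx, Pi.add_apply]
    rw [integral_add ((hEL t i).integrable (by norm_num))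
      ((hNL le_rfl t.coe_nonneg i).integrable (by norm_num)),
      hw.integral_stochasticConvolution le_rfl t.coe_nonneg,
      integral_mulVec fun i => (hx₀L i).integrable (by norm_num), h0]
    simp
  have hcov0 : covMatrix x₀ x₀ P = S := by
    have h1 : covMatrix ξ ξ P = 1 := by
      ext i j
      rw [Matrix.one_apply]
      exact covariance_iid hl ((iIndepFun_iff_hasLaw_pi_pi hl).2 hξ) i j
    rw [covMatrix_mulVec_left hξL hx₀L, covMatrix_mulVec_right hξL hξL, h1, Matrix.one_mul, hR]
  have hcovN0 : ∀ {a b : ℝ}, 0 ≤ a → a ≤ b → covMatrix (fun ω =>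
      stochasticConvolution F G (fun t => w t.toNNReal ω) a b) x₀ P = 0 := by
    intro a b ha hab
    ext i j
    exact hw.covariance_stochasticConvolution_of_indepFun hx₀w hx₀L ha hab i j
  -- The covariance is exp(tF) S exp(tF)' plus the Gramian up to t, and the Lyapunov equation makes
  -- this sum equal to S.
  have hself : ∀ t, covMatrix (x t) (x t) P = S := by
    intro t
    have e0 := hcovN0 le_rfl t.coe_nonneg
    have e1 : covMatrix (fun ω => stochasticConvolution F G (fun t => w t.toNNReal ω) 0 t)
        (fun ω => stochasticConvolution F G (fun t => w t.toNNReal ω) 0 t) P = gramian F G t := by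
      ext i j
      have := hw.covariance_stochasticConvolution (F := F) (G := G) le_rfl t.coe_nonneg i j
      rwa [sub_zero] at this
    have hN := hNL le_rfl t.coe_nonneg
    have hL : ∀ i, MemLp (fun ω => (NormedSpace.exp ((t : ℝ) • F) *ᵥ x₀ ω
        + stochasticConvolution F G (fun t => w t.toNNReal ω) 0 t) i) 2 P :=
      fun i => (hEL t i).add (hN i)
    rw [funext (hx t), covMatrix_add_left (hEL t) hN hL,
      covMatrix_add_right (hEL t) (hEL t) hN, covMatrix_add_right hN (hEL t) hN,
      covMatrix_mulVec_left hx₀L (hEL t), covMatrix_mulVec_right hx₀L hx₀L, hcov0,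
      covMatrix_mulVec_left hx₀L hN, covMatrix_comm _ x₀, e0, covMatrix_mulVec_right hN hx₀L, e0,
      e1,
      gramian_eq_sub hG]
    simp [Matrix.mul_assoc]
  -- Restarting variation of constants at time s leaves a convolution over [s, s+d] uncorrelated
  -- with x(s). The result depends only on the lag d, which gives stationarity.
  have hcov : ∀ (s d : ℝ≥0), covMatrix (x (s + d)) (x s) P = NormedSpace.exp ((d : ℝ) • F) * S := by
    intro s d
    have hsd : (s : ℝ) ≤ s + d := by simp
    have h1 : ∀ ω, x (s + d) ω = NormedSpace.exp ((d : ℝ) • F) *ᵥ x s ω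
        + stochasticConvolution F G (fun t => w t.toNNReal ω) s (s + d) := by
      intro ω
      have := eq_add_stochasticConvolution (hpath ω).1 (hwc' ω) (fun t _ => (hpath ω).2 t)
        s.coe_nonneg hsd
      rw [add_sub_cancel_left] at this
      rw [hx, hx]
      push_cast
      exact this
    have hN := hNL s.coe_nonneg hsd
    have h2 : covMatrix (fun ω => stochasticConvolution F G (fun t => w t.toNNReal ω) s (s + d))
        (x s) P = 0 := by
      rw [funext (hx s), covMatrix_add_right hN (hEL s) (hNL le_rfl s.coe_nonneg),
        covMatrix_mulVec_right hN hx₀L, hcovN0 s.coe_nonneg hsd, Matrix.zero_mul, zero_add]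
      ext i j
      simp only [covMatrix, Matrix.of_apply, Matrix.zero_apply]
      rw [covariance_comm]
      exact hw.covariance_stochasticConvolution_disjoint le_rfl s.coe_nonneg le_rfl hsd j i
    rw [funext h1, covMatrix_add_left (memLp_mulVec (hxL s) _) hN (hxL s),
      covMatrix_mulVec_left (hxL s) (hxL s), hself, h2, add_zero]
  have hgauss : IsGaussianProcess x P := by
    refine isGaussianProcess_curry ?_
    have hZ := hw.isGaussianProcess_sum hξ hind
    set Z := Sum.elim (fun i ω => ξ ω i) fun (q : Fin m × ℝ≥0) ω => w q.2 ω q.1 with hZdef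
    refine isGaussianProcess_of_tendstoL2 (X := fun M (q : ℝ≥0 × Fin n) ω =>
      (NormedSpace.exp ((q.1 : ℝ) • F) *ᵥ x₀ ω) q.2 + ∑ j, ∑ k ∈ Finset.range M,
        (NormedSpace.exp (((q.1 : ℝ) - gridPoint 0 q.1 M k) • F) * G) q.2 j *
        (w (gridPoint 0 q.1 M (k + 1)).toNNReal ω j - w (gridPoint 0 q.1 M k).toNNReal ω j))
      (fun M => isGaussianProcess_of_mem_span hZ fun q => ?_) fun q => ?_
    · have hZl : ∀ i, (fun ω => ξ ω i) ∈ Submodule.span ℝ (Set.range Z) :=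
        fun i => Submodule.subset_span ⟨Sum.inl i, rfl⟩
      have hZr : ∀ t j, (fun ω => w t ω j) ∈ Submodule.span ℝ (Set.range Z) :=
        fun t j => Submodule.subset_span ⟨Sum.inr (j, t), rfl⟩
      have e : (fun ω => (NormedSpace.exp ((q.1 : ℝ) • F) *ᵥ x₀ ω) q.2 +
          ∑ j, ∑ k ∈ Finset.range M,
          (NormedSpace.exp (((q.1 : ℝ) - gridPoint 0 q.1 M k) • F) * G) q.2 j *
          (w (gridPoint 0 q.1 M (k + 1)).toNNReal ω j - w (gridPoint 0 q.1 M k).toNNReal ω j))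
          = (∑ i, (NormedSpace.exp ((q.1 : ℝ) • F) * R) q.2 i • fun ω => ξ ω i)
          + ∑ j, ∑ k ∈ Finset.range M,
          (NormedSpace.exp (((q.1 : ℝ) - gridPoint 0 q.1 M k) • F) * G) q.2 j •
          ((fun ω => w (gridPoint 0 q.1 M (k + 1)).toNNReal ω j)
            - fun ω => w (gridPoint 0 q.1 M k).toNNReal ω j) := by
        ext ω
        simp only [hx₀, Matrix.mulVec_mulVec, Pi.add_apply, Finset.sum_apply, Pi.smul_apply,
          Pi.sub_apply, smul_eq_mul]
        rfl
      rw [e]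
      exact Submodule.add_mem _ (Submodule.sum_mem _ fun i _ => Submodule.smul_mem _ _ (hZl i))
        (Submodule.sum_mem _ fun j _ => Submodule.sum_mem _ fun k _ => Submodule.smul_mem _ _
          (Submodule.sub_mem _ (hZr _ j) (hZr _ j)))
    · have h1 := (TendstoL2.const (hEL q.1 q.2)).add (TendstoL2.sum Finset.univ fun j _ =>
        (hw.hasBrownianCovariance j).tendstoL2_partsIntegral
          (hasDerivAt_exp_sub_mul_apply F G q.1 q.2 j)
          (continuous_exp_sub_mul_apply F (F * G) q.1 q.2 j).neg le_rfl q.1.coe_nonneg)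
      simp only [hx]
      exact h1
  have hstat : IsStationary x P := by
    intro s
    refine identDistrib_of_covariance_eq (hgauss.comp_right fun t => t + s) hgauss
      (fun t => hxm _) hxm (fun t i => (hmean _ i).trans (hmean t i).symm) fun t u i j => ?_
    have key : covMatrix (x (t + s)) (x (u + s)) P = covMatrix (x t) (x u) P := by
      rcases le_total u t with h | h
      · obtain ⟨d, rfl⟩ := exists_add_of_le h
        rw [add_right_comm, hcov, hcov]
      · obtain ⟨d, rfl⟩ := exists_add_of_le h
        rw [covMatrix_comm, add_right_comm, hcov, covMatrix_comm (x (t + d)), hcov]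
    exact congrFun (congrFun key i) j
  refine ⟨hw, hxm, fun t => (hmul C).comp (hxm t), ?_, hgauss, hstat,
    Eventually.of_forall fun ω => ?_, ?_, Eventually.of_forall fun ω t => rfl⟩
  · rw [funext hx0]
    exact hx₀w
  · have := (hpath ω).1.comp (NNReal.continuous_coe)
    convert this using 2 with t
    exact hx t ω
  · have hw0 : ∀ᵐ ω ∂P, ∀ j, w 0 ω j = 0 :=
      ae_all_iff.2 fun j => (hw.brownian j).eval_zero_ae_eq_zero
    filter_upwards [hw0] with ω hω t
    have h1 := (hpath ω).2 t
    have h2 : w 0 ω = 0 := funext hω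
    simp only [Real.toNNReal_zero, h2, Matrix.mulVec_zero, sub_zero, Real.toNNReal_coe] at h1
    rw [hx0, hx, h1]
    congr 2
    refine intervalIntegral.integral_congr fun s hs => ?_
    rw [Set.uIcc_of_le t.coe_nonneg] at hs
    rw [hx, Real.coe_toNNReal s hs.1]

end Construction

/-- Every positive semidefinite solution of the Lyapunov equation is the state covariance of a
continuous-time model. -/
lemma exists_isContinuousModel {n m p : ℕ} {F S : Matrix (Fin n) (Fin n) ℝ}
    {G : Matrix (Fin n) (Fin m) ℝ} (C : Matrix (Fin p) (Fin n) ℝ) (hS : S.PosSemidef)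
    (hG : G * Gᵀ = -(F * S + S * Fᵀ)) :
    ∃ (Ω : Type) (_ : MeasurableSpace Ω) (P : Measure Ω)
      (x : ℝ≥0 → Ω → (Fin n → ℝ)) (w : ℝ≥0 → Ω → (Fin m → ℝ)) (ζ : ℝ≥0 → Ω → (Fin p → ℝ)),
      IsProbabilityMeasure P ∧ IsContinuousModel F G C x w ζ P := by
  obtain ⟨r, R, _, hR⟩ := exists_fullRank_factor hS
  obtain ⟨Ω, _, P, ξ, w, hP, hξm, hξ, hw, hwc, hind⟩ := exists_normal_wiener r m
  exact ⟨Ω, _, P, _, w, _, hP, hw.isContinuousModel hwc hξm hξ hind hR hG fun _ _ => rfl⟩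

/-! ### The law of the samples. -/

section SampledLaw

variable {Ω Ω' : Type*} [MeasurableSpace Ω] [MeasurableSpace Ω'] {P : Measure Ω} {P' : Measure Ω'}
  [IsProbabilityMeasure P] [IsProbabilityMeasure P'] {n m p r : ℕ}
  {F : Matrix (Fin n) (Fin n) ℝ} {G : Matrix (Fin n) (Fin m) ℝ} {H : Matrix (Fin p) (Fin n) ℝ}

/-- The samples of a stable continuous-time model have the law of any discrete-time model with the
sampled parameters. -/
lemma IsContinuousModel.identDistrib_sampled {x : ℝ≥0 → Ω → (Fin n → ℝ)}
    {w : ℝ≥0 → Ω → (Fin m → ℝ)} {ζ : ℝ≥0 → Ω → (Fin p → ℝ)} {B : Matrix (Fin n) (Fin r) ℝ}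
    {y : ℕ → Ω' → (Fin n → ℝ)} {v : ℕ → Ω' → (Fin r → ℝ)} {η : ℕ → Ω' → (Fin p → ℝ)} {h : ℝ≥0}
    (hm : IsContinuousModel F G H x w ζ P)
    (hd : IsDiscreteModel (NormedSpace.exp ((h : ℝ) • F)) B H y v η P')
    (hF : IsSchur (NormedSpace.exp ((h : ℝ) • F))) (hQ : (gramian F G h).PosDef)
    (hB : B * Bᵀ = gramian F G h) :
    IdentDistrib (fun ω (k : ℕ) => (sampled h x k ω, sampled h ζ k ω))
      (fun ω (k : ℕ) => (y k ω, η k ω)) P P' := by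
  -- For B of any width the law is compared through an intermediate model: the samples themselves,
  -- driven through a square factor.
  obtain ⟨B₀, _, hB₀⟩ := exists_posDef_factor hQ
  obtain ⟨v₀, hv₀, _⟩ := hm.exists_isDiscreteModel h hB₀ hQ
  exact hv₀.identDistrib hd hF (hB₀.trans hB.symm)

end SampledLaw

end SampledModel

/-! ### The theorem, assembled from the parts above. -/

theorem theorem2 :
    -- Sampling a continuous-time model.
    (∀ (n m p : ℕ) (F : Matrix (Fin n) (Fin n) ℝ) (G : Matrix (Fin n) (Fin m) ℝ)
        (H : Matrix (Fin p) (Fin n) ℝ) (h : ℝ≥0),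
      0 < h → SampledModel.IsHurwitz F → SampledModel.IsControllable F G →
      SampledModel.IsSchur (NormedSpace.exp ((h : ℝ) • F)) ∧
      -- the noise covariance is nonsingular, and has a positive definite square root
      (SampledModel.gramian F G h).PosDef ∧
      (∃ B : Matrix (Fin n) (Fin n) ℝ, B.PosDef ∧ B * Bᵀ = SampledModel.gramian F G h) ∧
      -- every square factor `B` of it yields a discrete-time model of the sampled process
      (∀ (B : Matrix (Fin n) (Fin n) ℝ), B * Bᵀ = SampledModel.gramian F G h →
        ∀ (Ω : Type*) (_ : MeasurableSpace Ω) (P : Measure Ω)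
          (x : ℝ≥0 → Ω → (Fin n → ℝ)) (w : ℝ≥0 → Ω → (Fin m → ℝ)) (ζ : ℝ≥0 → Ω → (Fin p → ℝ)),
          IsProbabilityMeasure P → SampledModel.IsContinuousModel F G H x w ζ P →
          ∃ v : ℕ → Ω → (Fin n → ℝ),
            SampledModel.IsDiscreteModel (NormedSpace.exp ((h : ℝ) • F)) B H
              (SampledModel.sampled h x) v (SampledModel.sampled h ζ) P ∧
            ∀ k : ℕ, SampledModel.IsWienerIntegral
              (fun τ => NormedSpace.exp ((((k : ℝ) + 1) * (h : ℝ) - (τ : ℝ)) • F) * G) w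
              ((k : ℝ≥0) * h) (((k : ℝ≥0) + 1) * h) (fun ω => B *ᵥ v k ω) P) ∧
      -- a factor `B` of any width yields a discrete-time model with the law of the sampled process
      ∀ (r : ℕ) (B : Matrix (Fin n) (Fin r) ℝ), B * Bᵀ = SampledModel.gramian F G h →
        ∀ (Ω : Type*) (_ : MeasurableSpace Ω) (P : Measure Ω)
          (x : ℝ≥0 → Ω → (Fin n → ℝ)) (w : ℝ≥0 → Ω → (Fin m → ℝ)) (ζ : ℝ≥0 → Ω → (Fin p → ℝ))
          (Ω' : Type*) (_ : MeasurableSpace Ω') (P' : Measure Ω')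
          (y : ℕ → Ω' → (Fin n → ℝ)) (v : ℕ → Ω' → (Fin r → ℝ)) (η : ℕ → Ω' → (Fin p → ℝ)),
          IsProbabilityMeasure P → SampledModel.IsContinuousModel F G H x w ζ P →
          IsProbabilityMeasure P' →
          SampledModel.IsDiscreteModel (NormedSpace.exp ((h : ℝ) • F)) B H y v η P' →
          IdentDistrib
            (fun ω (k : ℕ) => (SampledModel.sampled h x k ω, SampledModel.sampled h ζ k ω))
            (fun ω (k : ℕ) => (y k ω, η k ω)) P P') ∧
    -- Recovering a continuous-time model.
    (∀ (n r p : ℕ) (A : Matrix (Fin n) (Fin n) ℝ) (B : Matrix (Fin n) (Fin r) ℝ)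
        (C : Matrix (Fin p) (Fin n) ℝ) (L S F : Matrix (Fin n) (Fin n) ℝ) (h : ℝ≥0),
      0 < h → SampledModel.IsSchur A → SampledModel.IsPrincipalLog L A → (B * Bᵀ).det ≠ 0 →
      S = A * S * Aᵀ + B * Bᵀ → (-(L * S + S * Lᵀ)).PosSemidef →
      F = (1 / (h : ℝ)) • L →
      -- a full-column-rank factor `G` exists
      (∃ (m : ℕ) (G : Matrix (Fin n) (Fin m) ℝ), G.rank = m ∧ G * Gᵀ = -(F * S + S * Fᵀ)) ∧
      -- for every such factor, the discrete-time model arises by sampling `(F, G, C)`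
      ∀ (m : ℕ) (G : Matrix (Fin n) (Fin m) ℝ), G.rank = m → G * Gᵀ = -(F * S + S * Fᵀ) →
        SampledModel.IsHurwitz F ∧ SampledModel.IsControllable F G ∧
        A = NormedSpace.exp ((h : ℝ) • F) ∧ B * Bᵀ = SampledModel.gramian F G h ∧
        -- a continuous-time model with these parameters exists
        (∃ (Ω : Type) (_ : MeasurableSpace Ω) (P : Measure Ω)
          (x : ℝ≥0 → Ω → (Fin n → ℝ)) (w : ℝ≥0 → Ω → (Fin m → ℝ)) (ζ : ℝ≥0 → Ω → (Fin p → ℝ)),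
          IsProbabilityMeasure P ∧ SampledModel.IsContinuousModel F G C x w ζ P) ∧
        -- and its samples have the law of the discrete-time model
        ∀ (Ω : Type*) (_ : MeasurableSpace Ω) (P : Measure Ω)
          (x : ℝ≥0 → Ω → (Fin n → ℝ)) (w : ℝ≥0 → Ω → (Fin m → ℝ)) (ζ : ℝ≥0 → Ω → (Fin p → ℝ))
          (Ω' : Type*) (_ : MeasurableSpace Ω') (P' : Measure Ω')
          (y : ℕ → Ω' → (Fin n → ℝ)) (v : ℕ → Ω' → (Fin r → ℝ)) (η : ℕ → Ω' → (Fin p → ℝ)),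
          IsProbabilityMeasure P → SampledModel.IsContinuousModel F G C x w ζ P →
          IsProbabilityMeasure P' → SampledModel.IsDiscreteModel A B C y v η P' →
          IdentDistrib
            (fun ω (k : ℕ) => (SampledModel.sampled h x k ω, SampledModel.sampled h ζ k ω))
            (fun ω (k : ℕ) => (y k ω, η k ω)) P P') := by
  open SampledModel in
  refine ⟨fun n m p F G H h hh hF hFG => ?_, fun n r p A B C L S F h hh hA hL hdet hS hLS hF => ?_⟩
  · have hSchur := hF.isSchur_exp (NNReal.coe_pos.2 hh)
    have hQ := gramian_posDef (NNReal.coe_pos.2 hh) hFG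
    refine ⟨hSchur, hQ, exists_posDef_factor hQ, fun B hB Ω _ P x w ζ _ hm =>
      hm.exists_isDiscreteModel h hB hQ, fun r B hB Ω _ P x w ζ Ω' _ P' y v η _ hm _ hd =>
      hm.identDistrib_sampled hd hSchur hQ hB⟩
  · have hh' : (0 : ℝ) < h := NNReal.coe_pos.2 hh
    have hhF : (h : ℝ) • F = L := by
      rw [hF, smul_smul, mul_one_div_cancel hh'.ne', one_smul]
    have hexp : NormedSpace.exp ((h : ℝ) • F) = A := by rw [hhF, hL.1]
    refine ⟨exists_fullRank_factor ?_, fun m G _ hG => ?_⟩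
    · have h1 : -(F * S + S * Fᵀ) = (1 / (h : ℝ)) • -(L * S + S * Lᵀ) := by
        rw [hF, Matrix.transpose_smul, Matrix.smul_mul, Matrix.mul_smul, ← smul_add, smul_neg]
      rw [h1]
      exact hLS.smul (by positivity)
    -- The Lyapunov equation gives Gramian = S - ASA', and the Stein equation says that this is BB'.
    · have hgram : B * Bᵀ = gramian F G h := by
        rw [gramian_eq_sub hG, hexp, eq_sub_iff_add_eq, add_comm]
        exact hS.symm
      have hQ : (gramian F G h).PosDef := by
        rw [← hgram]
        have hpsd : (B * Bᵀ).PosSemidef := by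
          simpa using Matrix.posSemidef_self_mul_conjTranspose B
        exact hpsd.posDef_iff_det_ne_zero.2 hdet
      -- S must be positive semidefinite to serve as the covariance of the initial state.
      have hSpsd := hA.posSemidef_stein hS
      rw [← hexp] at hA
      refine ⟨IsHurwitz.of_isSchur_exp hh' hA, isControllable_of_gramian_posDef hQ, hexp.symm,
        hgram, exists_isContinuousModel C hSpsd hG,
        fun Ω _ P x w ζ Ω' _ P' y v η _ hm _ hd => ?_⟩
      rw [← hexp] at hd
      exact hm.identDistrib_sampled hd hA hQ hgram
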